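/- **Setting.** Let $i_1,\dots,i_n$ be positive integers and $a=i_1+\dots+i_n$. For $N\ge 1$ let $h_N(t)=(1+\nu_N)^t=\sum_k\binom tk\nu_N^k$ be the one-parameter unipotent group on $\mathbb R^N$, where $(1+\nu_N)(s_1,\dots,s_N)=(s_1,s_2+s_1,\dots,s_N+s_{N-1})$, and let $h=h_{i_1}\times\dots\times h_{i_n}$, acting on $\mathbb R^a$. Let $G=\mathbb R\ltimes_h\mathbb R^a$ be the quasi-Abelian nilpotent group with the law $(t,v)(t',v')=(t+t',v+h(t)v')$, $\mathfrak g$ its Lie algebra, $\mathfrak a\subset\mathfrak g$ the Abelian ideal tangent to $\mathbb R^a$, $\Gamma=\mathbb Z\ltimes_h\mathbb Z^a$, and $M=\Gamma\backslash G$, with its $G$-invariant probability measure $\mathcal L$. Let $\xi=\log(1,0)$, $\tilde\eta_j=\log(0,e_j)$ and let $\omega$ be the invariant volume form with $\omega(\xi,\tilde\eta_1,\dots,\tilde\eta_a)=1$. A *normalised adapted basis* $\mathcal F=(X,Y_1,\dots,Y_a)$ of $\mathfrak g$ consists of $X\notin\mathfrak a$ and a basis $Y$ of $\mathfrak a$ with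 $\omega(X,Y_1,\dots,Y_a)=1$. Elements of $\mathfrak g$ act on functions on $M$ by $Zf(x)=\frac{d}{dr}f(x\exp rZ)|_{r=0}$. **Width.** For $O\subset\mathbb R^a$ let $w(O)$ be the supremum of the volumes of the $a$-dimensional rectangles centred at the origin (of any orientation) contained in $O\cap[-\frac12,\frac12]^a$, and for $\Omega\subset\mathbb R\times\mathbb R^a$ let $w_\Omega(\tau)=w(\{\mathbf s:(\tau,\mathbf s)\in\Omega\})$. For $x\in M$, $T\ge 1$, let $\mathcal O_{x,T}$ be the family of the open sets $\Omega$ with $[0,T]\times\{0\}\subset\Omega\subset\mathbb R\times[-\frac12,\frac12]^a$ on which the map $\phi_x(t,\mathbf s)=x\exp(tX)\exp(\sum_j s_jY_j)$ is injective. Put $$w_{\mathcal F}(x,T)=\sup_{\Omega\in\mathcal O_{x,T}}\Big(\frac1T\int_0^T\frac{d\tau}{w_\Omega(\tau)}\Big)^{-1},\qquad w_{\mathcal F}(y)=\sup\{w_{\mathcal F}(x,1): y\in\{x\exp(tX):0\le t\le 1\}\},$$ with $\sup\emptyset=0$. **Norms.** Let $\Delta_Y=-\sum_jY_j^2$, $|f|_{\mathcal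 F,\sigma}=\|(I+\Delta_Y)^{\sigma/2}f\|_{L^2(M)}$, and let $W^\sigma(M,\mathcal F)\subset L^2(M)$ be the completion of $C^\infty(M)$ for this norm. **Theorem.** (1) For every $a$ and $\sigma>a/2$ there is a constant $C_{a,\sigma}>0$ such that, for all $(i_1,\dots,i_n)$ with sum $a$, all normalised adapted bases $\mathcal F=(X,Y)$, all $T\ge1$ and all $x\in M$ with $w_{\mathcal F}(x,T)>0$, the functional $B^T_X(x)(f)=\frac1T\int_0^Tf(x\exp(tX))\,dt$, defined for $f\in C^\infty(M)$, extends by continuity to $W^\sigma(M,\mathcal F)$, and for all $f\in W^\sigma(M,\mathcal F)$ $$|B^T_X(x)(f)|\le\frac{C_{a,\sigma}}{T^{1/2}\,w_{\mathcal F}(x,T)^{1/2}}\,|f|_{\mathcal F,\sigma}.$$ (2) For every $\sigma>a/2$ there are positive constants $C_\sigma$, depending only on $\sigma$, and $C_{a,\sigma}$, depending only on $a$ and $\sigma$, such that, for all $(i_1,\dots,i_n)$ with sum $a$, all normalised adapted bases $\mathcal F=(X,Y)$ and all $u\in W^{\sigma+1}(M,\mathcal F)$ with (distributional) derivative $Xu\in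 W^\sigma(M,\mathcal F)$, the distributions $[X,Y_j]u$ belong to $W^\sigma(M,\mathcal F)$, $u$ has a continuous representative, and for this representative and all $y\in M$ $$|u(y)|\le\frac{C_{a,\sigma}}{w_{\mathcal F}(y)^{1/2}}\Big\{|u|_{\mathcal F,\sigma}+|Xu|_{\mathcal F,\sigma}+C_\sigma\sum_{j=1}^a\big|[X,Y_j]u\big|_{\mathcal F,\sigma}\Big\}$$ (where the right-hand side is $+\infty$ if $w_{\mathcal F}(y)=0$ and $u\ne0$). -/

import Mathlib

open MeasureTheory Filter Topology
open scoped ENNReal NNReal ContDiff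

noncomputable section

namespace QuasiAbelian

/-! ### The group `G = ℝ ⋉_h ℝ^a` and its Lie algebra -/

/-- The index set `J = {(m, p) : 1 ≤ m ≤ n, 1 ≤ p ≤ i_m}` (indices are shifted to start at `0`). -/
abbrev Idx {n : ℕ} (ι : Fin n → ℕ) : Type := Σ m : Fin n, Fin (ι m)

/-- The one-parameter group `t ↦ (1 + N)^t` of unipotent automorphisms of `ℝ^N`, where
`1 + N : (s_1, …, s_N) ↦ (s_1, s_2 + s_1, …, s_N + s_{N-1})`.
Its entries are generalised binomial coefficients. -/
def jordanFlow (N : ℕ) (t : ℝ) : Matrix (Fin N) (Fin N) ℝ :=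
  Matrix.of fun p q => if q ≤ p then Ring.choose t ((p : ℕ) - (q : ℕ)) else 0

theorem jordanFlow_add (N : ℕ) (s t : ℝ) :
    jordanFlow N (s + t) = jordanFlow N s * jordanFlow N t := by
  ext p q
  rw [Matrix.mul_apply]
  simp only [jordanFlow, Matrix.of_apply]
  by_cases hqp : q ≤ p
  · rw [if_pos hqp, Ring.add_choose_eq _ (Commute.all s t)]
    have hqp' : (q : ℕ) ≤ p := hqp
    symm
    refine Finset.sum_bij_ne_zero (fun r _ _ => ((p : ℕ) - (r : ℕ), (r : ℕ) - (q : ℕ))) ?_ ?_ ?_ ?_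
    · intro r _ hr
      have h1 : r ≤ p := by by_contra h; simp [h] at hr
      have h2 : q ≤ r := by by_contra h; simp [h] at hr
      have h1' : (r : ℕ) ≤ p := h1
      have h2' : (q : ℕ) ≤ r := h2
      rw [Finset.HasAntidiagonal.mem_antidiagonal]
      omega
    · intro r _ hr r' _ hr' h
      have h2 : q ≤ r := by by_contra h; simp [h] at hr
      have h4 : q ≤ r' := by by_contra h; simp [h] at hr'
      have h2' : (q : ℕ) ≤ r := h2
      have h4' : (q : ℕ) ≤ r' := h4
      simp only [Prod.mk.injEq] at h
      apply Fin.ext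
      omega
    · rintro ⟨k, l⟩ hkl hne
      simp only [Finset.HasAntidiagonal.mem_antidiagonal] at hkl
      have hp := p.2
      refine ⟨⟨(q : ℕ) + l, by omega⟩, Finset.mem_univ _, ?_, ?_⟩
      · rw [if_pos (Fin.le_def.mpr (by dsimp only; omega)),
          if_pos (Fin.le_def.mpr (by dsimp only; omega))]
        have e1 : (p : ℕ) - ((q : ℕ) + l) = k := by omega
        have e2 : (q : ℕ) + l - (q : ℕ) = l := by omega
        simpa only [e1, e2] using hne
      · simp only [Prod.mk.injEq]
        omega
    · intro r _ hr
      have h1 : r ≤ p := by by_contra h; simp [h] at hr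
      have h2 : q ≤ r := by by_contra h; simp [h] at hr
      rw [if_pos h1, if_pos h2]
  · rw [if_neg hqp]
    symm
    apply Finset.sum_eq_zero
    intro r _
    by_cases h1 : r ≤ p
    · have h2 : ¬ q ≤ r := fun h => hqp (h.trans h1)
      rw [if_neg h2, mul_zero]
    · rw [if_neg h1, zero_mul]

theorem jordanFlow_zero (N : ℕ) : jordanFlow N 0 = 1 := by
  ext p q
  simp only [jordanFlow, Matrix.of_apply, Matrix.one_apply]
  rcases lt_trichotomy p q with h | h | h
  · rw [if_neg (not_le.mpr h), if_neg (ne_of_lt h)]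
  · subst h; simp
  · have h' : (q : ℕ) < p := h
    rw [if_pos h.le, if_neg (ne_of_gt h), Ring.choose_zero_pos ℝ (by omega)]

/-- The logarithm of `jordanFlow N 1`, that is, the infinitesimal generator of `jordanFlow N`. -/
def jordanLog (N : ℕ) : Matrix (Fin N) (Fin N) ℝ :=
  Matrix.of fun p q =>
    if q < p then (-1 : ℝ) ^ ((p : ℕ) - (q : ℕ) - 1) / (((p : ℕ) : ℝ) - ((q : ℕ) : ℝ)) else 0

variable {n : ℕ} (ι : Fin n → ℕ)

/-- The one-parameter group `h = h_{i_1} × ⋯ × h_{i_n}` of automorphisms of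
`ℝ^a = ℝ^{i_1} × ⋯ × ℝ^{i_n}`. -/
def twist (t : ℝ) : Matrix (Idx ι) (Idx ι) ℝ :=
  Matrix.blockDiagonal' fun m => jordanFlow (ι m) t

theorem twist_add (s t : ℝ) : twist ι (s + t) = twist ι s * twist ι t := by
  simp only [twist, jordanFlow_add]
  rw [Matrix.blockDiagonal'_mul]

theorem twist_zero : twist ι 0 = 1 := by
  simp only [twist, jordanFlow_zero]
  exact Matrix.blockDiagonal'_one

/-- The infinitesimal generator of `twist`, i.e. `ad ξ` restricted to the Abelian ideal. -/
def twistGen : Matrix (Idx ι) (Idx ι) ℝ :=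
  Matrix.blockDiagonal' fun m => jordanLog (ι m)

/-- The Lie group `G = ℝ ⋉_h ℝ^a`, in its global coordinates. -/
def Grp : Type := ℝ × (Idx ι → ℝ)

instance : TopologicalSpace (Grp ι) := inferInstanceAs (TopologicalSpace (ℝ × (Idx ι → ℝ)))
instance : MeasurableSpace (Grp ι) := inferInstanceAs (MeasurableSpace (ℝ × (Idx ι → ℝ)))

variable {ι} in
/-- The element of `G` with coordinates `(t, v)`. -/
def Grp.of (t : ℝ) (v : Idx ι → ℝ) : Grp ι := (t, v)

/-- The group law `(t, v) (t', v') = (t + t', v + h(t) v')`. -/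
instance : Group (Grp ι) where
  mul g k := Grp.of (g.1 + k.1) (g.2 + (twist ι g.1).mulVec k.2)
  one := Grp.of 0 0
  inv g := Grp.of (-g.1) (-((twist ι (-g.1)).mulVec g.2))
  mul_assoc g k l := by
    refine Prod.ext (add_assoc _ _ _) ?_
    change g.2 + (twist ι g.1).mulVec k.2 + (twist ι (g.1 + k.1)).mulVec l.2
      = g.2 + (twist ι g.1).mulVec (k.2 + (twist ι k.1).mulVec l.2)
    rw [twist_add, Matrix.mulVec_add, Matrix.mulVec_mulVec, add_assoc]
  one_mul g := by
    refine Prod.ext (zero_add _) ?_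
    change 0 + (twist ι 0).mulVec g.2 = g.2
    rw [twist_zero, Matrix.one_mulVec, zero_add]
  mul_one g := by
    refine Prod.ext (add_zero _) ?_
    change g.2 + (twist ι g.1).mulVec 0 = g.2
    rw [Matrix.mulVec_zero, add_zero]
  inv_mul_cancel g := by
    refine Prod.ext (neg_add_cancel _) ?_
    change -((twist ι (-g.1)).mulVec g.2) + (twist ι (-g.1)).mulVec g.2 = 0
    exact neg_add_cancel _

/-- The Lie algebra `𝔤 = T_e G` in the coordinates of `G`: the vector `(τ, w)` is
`τ ξ + ∑ w_j η̃_j`, where `ξ = log (1, 0)` and `η̃_j = log (0, e_j)`. -/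
abbrev LieAlg : Type := ℝ × (Idx ι → ℝ)

variable {ι} in
/-- The bracket of `𝔤`: the Abelian ideal `𝔞` is `{(0, w)}`, and `ad ξ` acts on it by `twistGen`. -/
def bracket (Z W : LieAlg ι) : LieAlg ι :=
  (0, Z.1 • (twistGen ι).mulVec W.2 - W.1 • (twistGen ι).mulVec Z.2)

variable {ι} in
/-- The exponential map `𝔤 → G`: `t ↦ exp (t (τ, w)) = (t τ, ∫_0^t h(r τ) w dr)` is the
one-parameter subgroup with velocity `(τ, w)` at the identity. -/
def expG (Z : LieAlg ι) : Grp ι :=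
  Grp.of Z.1 (∫ r in (0 : ℝ)..1, (twist ι (r * Z.1)).mulVec Z.2)

/-! ### The nilmanifold `M = Γ \ G` -/

theorem twist_int (k : ℤ) (v : Idx ι → ℤ) : ∃ w : Idx ι → ℤ,
    (twist ι (k : ℝ)).mulVec (fun j => (v j : ℝ)) = fun j => (w j : ℝ) := by
  have key : ∀ p q : Idx ι, ∃ z : ℤ, twist ι (k : ℝ) p q = (z : ℝ) := by
    rintro ⟨m, p⟩ ⟨m', q⟩
    simp only [twist, Matrix.blockDiagonal'_apply]
    split_ifs with h
    · subst h
      simp only [jordanFlow, Matrix.of_apply, cast_eq]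
      split_ifs
      · exact ⟨Ring.choose k _, (Ring.map_choose (Int.castRingHom ℝ) k _).symm⟩
      · exact ⟨0, by simp⟩
    · exact ⟨0, by simp⟩
  choose A hA using key
  refine ⟨fun p => ∑ q, A p q * v q, ?_⟩
  funext p
  simp [Matrix.mulVec, dotProduct, hA]

/-- The lattice `Γ = ℤ ⋉ ℤ^a`. -/
def lattice : Subgroup (Grp ι) where
  carrier := {g | ∃ (k : ℤ) (v : Idx ι → ℤ), g = Grp.of (k : ℝ) fun j => (v j : ℝ)}
  mul_mem' := by
    rintro _ _ ⟨k, v, rfl⟩ ⟨l, w, rfl⟩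
    obtain ⟨u, hu⟩ := twist_int ι k w
    refine ⟨k + l, v + u, Prod.ext ?_ ?_⟩
    · change (k : ℝ) + l = ((k + l : ℤ) : ℝ)
      push_cast; rfl
    · change (fun j => (v j : ℝ)) + (twist ι (k : ℝ)).mulVec (fun j => (w j : ℝ))
        = fun j => (((v + u) j : ℤ) : ℝ)
      rw [hu]
      funext j
      simp
  one_mem' := by
    refine ⟨0, 0, Prod.ext ?_ ?_⟩
    · change (0 : ℝ) = ((0 : ℤ) : ℝ)
      simp
    · change (0 : Idx ι → ℝ) = fun j => (((0 : Idx ι → ℤ) j : ℤ) : ℝ)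
      funext j
      simp
  inv_mem' := by
    rintro _ ⟨k, v, rfl⟩
    obtain ⟨u, hu⟩ := twist_int ι (-k) v
    refine ⟨-k, -u, Prod.ext ?_ ?_⟩
    · change -(k : ℝ) = ((-k : ℤ) : ℝ)
      push_cast; rfl
    · change -((twist ι (-(k : ℝ))).mulVec (fun j => (v j : ℝ))) = fun j => (((-u) j : ℤ) : ℝ)
      rw [Int.cast_neg] at hu
      rw [hu]
      funext j
      simp

/-- The nilmanifold `M = Γ \ G`, the space of right cosets `Γ g`, with the quotient topology and
the quotient measurable structure. -/
def Nil : Type := Quotient (QuotientGroup.rightRel (lattice ι))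

instance : TopologicalSpace (Nil ι) :=
  inferInstanceAs (TopologicalSpace (Quotient (QuotientGroup.rightRel (lattice ι))))
instance : MeasurableSpace (Nil ι) :=
  inferInstanceAs (MeasurableSpace (Quotient (QuotientGroup.rightRel (lattice ι))))

variable {ι}

/-- The projection `g ↦ Γ g`. -/
def Nil.mk (g : Grp ι) : Nil ι := Quotient.mk (QuotientGroup.rightRel (lattice ι)) g

/-- The right action `(Γ g) k = Γ g k` of `G` on `M`. -/
def Nil.act (x : Nil ι) (k : Grp ι) : Nil ι :=
  Quotient.map' (s₁ := QuotientGroup.rightRel (lattice ι))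
    (s₂ := QuotientGroup.rightRel (lattice ι)) (fun g => g * k)
    (fun g g' hg => by
      rw [QuotientGroup.rightRel_apply] at hg ⊢
      simpa [mul_assoc] using hg) x

variable (ι) in
/-- The invariant probability measure on `M` : the image of Lebesgue measure
on the fundamental domain `[0,1) × [0,1)^a` of `Γ`. -/
def haar : Measure (Nil ι) :=
  Measure.map (fun p : ℝ × (Idx ι → ℝ) => Nil.mk (Grp.of p.1 p.2))
    ((volume : Measure (ℝ × (Idx ι → ℝ))).restrict
      (Set.Ico (0 : ℝ) 1 ×ˢ Set.univ.pi fun _ => Set.Ico (0 : ℝ) 1))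

/-- `f ∈ C^∞(M)`, complex-valued: the lift of `f` to `G` is smooth. -/
def Smooth (f : Nil ι → ℂ) : Prop :=
  ContDiff ℝ ∞ fun p : ℝ × (Idx ι → ℝ) => f (Nil.mk (Grp.of p.1 p.2))

/-- The derivative `(Z f)(x) = d/dr f(x exp(rZ))` at `r = 0` of a function along `Z ∈ 𝔤`. -/
def lieD (Z : LieAlg ι) (f : Nil ι → ℂ) (x : Nil ι) : ℂ :=
  deriv (fun r : ℝ => f (x.act (expG (r • Z)))) 0

/-! ### Adapted bases, widths -/

variable (ι) in
/-- An adapted basis `(X, Y)` of `𝔤`: `X ∉ 𝔞` and `Y` is a basis of the Abelian ideal `𝔞`. -/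
structure AdaptedBasis where
  X : LieAlg ι
  Y : Idx ι → LieAlg ι
  X_notMem : X.1 ≠ 0
  Y_mem : ∀ j, (Y j).1 = 0
  Y_indep : LinearIndependent ℝ Y

/-- The volume form `ω` with `ω(ξ, …, η̃_j, …) = 1`, evaluated on `(X, Y)`. -/
def volForm (X : LieAlg ι) (Y : Idx ι → LieAlg ι) : ℝ :=
  (Matrix.of fun p q : Option (Idx ι) =>
    q.elim (p.elim X Y).1 (p.elim X Y).2).det

/-- The basis is normalised: `ω(X, Y) = 1`. -/
def AdaptedBasis.Normalised (F : AdaptedBasis ι) : Prop := volForm F.X F.Y = 1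

/-- The map `φ_x(t, s) = x exp(tX) exp(s · Y)`. -/
def AdaptedBasis.phi (F : AdaptedBasis ι) (x : Nil ι) (p : ℝ × (Idx ι → ℝ)) : Nil ι :=
  (x.act (expG (p.1 • F.X))).act (expG (∑ j, p.2 j • F.Y j))

/-- The cube `[-1/2, 1/2]^a`. -/
def cube (J : Type*) : Set (J → ℝ) := {s | ∀ j, |s j| ≤ 1 / 2}

/-- `R` is an `a`-dimensional rectangle centred at the origin (with sides in the directions of some
orthonormal basis, given by the rows of `A`). -/
def IsSymmRectangle {J : Type*} [Fintype J] [DecidableEq J] (R : Set (J → ℝ)) : Prop :=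
  ∃ A ∈ Matrix.orthogonalGroup J ℝ, ∃ r : J → ℝ, (∀ j, 0 < r j) ∧
    R = {s | ∀ j, |A.mulVec s j| ≤ r j}

/-- The inner width of `O ⊆ ℝ^a`. -/
def innerWidth {J : Type*} [Fintype J] [DecidableEq J] (O : Set (J → ℝ)) : ℝ≥0∞ :=
  ⨆ (R : Set (J → ℝ)) (_ : IsSymmRectangle R) (_ : R ⊆ cube J) (_ : R ⊆ O), volume R

/-- The width function of `Ω ⊆ ℝ × ℝ^a`. -/
def widthFun {J : Type*} [Fintype J] [DecidableEq J] (Ω : Set (ℝ × (J → ℝ))) (τ : ℝ) : ℝ≥0∞ :=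
  innerWidth {s | (τ, s) ∈ Ω}

/-- The family of the open sets `Ω` on which `φ_x` is injective, with
`[0,T] × {0} ⊆ Ω ⊆ ℝ × [-1/2,1/2]^a`. -/
def AdaptedBasis.admissible (F : AdaptedBasis ι) (x : Nil ι) (T : ℝ) :
    Set (Set (ℝ × (Idx ι → ℝ))) :=
  {Ω | IsOpen Ω ∧ (∀ t ∈ Set.Icc 0 T, (t, 0) ∈ Ω) ∧ (∀ p ∈ Ω, p.2 ∈ cube (Idx ι)) ∧
    Set.InjOn (F.phi x) Ω}

/-- The average width of the orbit segment of length `T` from `x`. It is `0` when there is no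
admissible `Ω`, i.e. when the orbit segment closes up. -/
def AdaptedBasis.avgWidth (F : AdaptedBasis ι) (x : Nil ι) (T : ℝ) : ℝ≥0∞ :=
  ⨆ Ω ∈ F.admissible x T,
    ((ENNReal.ofReal T)⁻¹ * ∫⁻ s in Set.Icc 0 T, (widthFun Ω s)⁻¹)⁻¹

/-- The average width of `M` at the point `y`. -/
def AdaptedBasis.ptWidth (F : AdaptedBasis ι) (y : Nil ι) : ℝ≥0∞ :=
  ⨆ (x : Nil ι) (_ : ∃ t ∈ Set.Icc (0 : ℝ) 1, y = x.act (expG (t • F.X))), F.avgWidth x 1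

/-! ### Transverse Sobolev norms -/

variable (ι) in
/-- The Hilbert space `L²(M)`. -/
abbrev L2 : Type := Lp ℂ 2 (haar ι)

/-- The differential operator `Δ_Y = - ∑ Y_j²`. -/
def AdaptedBasis.lapY (F : AdaptedBasis ι) (f : Nil ι → ℂ) (x : Nil ι) : ℂ :=
  -∑ j, lieD (F.Y j) (lieD (F.Y j) f) x

/-- `R` is the inverse of (the closure of) the operator `I + Δ_Y`, initially defined on `C^∞(M)`:
`R` is bounded on `L²(M)` and `R ((I + Δ_Y) φ) = φ` for all `φ ∈ C^∞(M)`. -/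
def AdaptedBasis.IsResolvent (F : AdaptedBasis ι) (R : L2 ι →L[ℂ] L2 ι) : Prop :=
  ∀ φ : Nil ι → ℂ, Smooth φ → ∀ g : L2 ι,
    (g : Nil ι → ℂ) =ᵐ[haar ι] (fun x => φ x + F.lapY φ x) →
      (R g : Nil ι → ℂ) =ᵐ[haar ι] φ

/-- The bounded positive operator `(I + Δ_Y)⁻¹` on `L²(M)`; as `Δ_Y` is essentially self-adjoint
on `C^∞(M)`, it exists and is unique. -/
def AdaptedBasis.resolvent (F : AdaptedBasis ι) : L2 ι →L[ℂ] L2 ι :=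
  Classical.epsilon F.IsResolvent

/-- Powers `R^s` of a bounded positive operator on a Hilbert space (continuous functional calculus). -/
def opPow {H : Type*} [NormedAddCommGroup H] [InnerProductSpace ℂ H] [CompleteSpace H]
    (R : H →L[ℂ] H) (s : ℝ) : H →L[ℂ] H := R ^ s

/-- The operator `(I + Δ_Y)^{-σ/2}` on `L²(M)`. -/
def AdaptedBasis.negPow (F : AdaptedBasis ι) (σ : ℝ) : L2 ι →L[ℂ] L2 ι :=
  opPow F.resolvent (σ / 2)

/-- The transverse Sobolev norm `|f|_{F,σ} = ‖(I + Δ_Y)^{σ/2} f‖`: the norm of the (unique)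
`g ∈ L²(M)` with `f = (I + Δ_Y)^{-σ/2} g`, and `∞` when there is no such `g`. -/
def AdaptedBasis.tNorm (F : AdaptedBasis ι) (σ : ℝ) (f : Nil ι → ℂ) : ℝ≥0∞ :=
  ⨅ (g : L2 ι) (_ : (F.negPow σ g : Nil ι → ℂ) =ᵐ[haar ι] f), ‖g‖ₑ

/-- `f ∈ W^σ(M, F)`: the completion of `C^∞(M)` for the norm `|·|_{F,σ}`, which dominates the norm
of `L²(M)`, realised inside `L²(M)`. -/
def AdaptedBasis.MemW (F : AdaptedBasis ι) (σ : ℝ) (f : Nil ι → ℂ) : Prop :=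
  ∀ ε : ℝ≥0∞, 0 < ε → ∃ φ, Smooth φ ∧ F.tNorm σ (fun x => f x - φ x) < ε

/-- `v = Z u` in the sense of distributions, for `u, v ∈ L²(M)`. -/
def IsWeakDeriv (Z : LieAlg ι) (u v : Nil ι → ℂ) : Prop :=
  MemLp u 2 (haar ι) ∧ MemLp v 2 (haar ι) ∧
    ∀ φ, Smooth φ → ∫ x, u x * lieD Z φ x ∂(haar ι) = -∫ x, v x * φ x ∂(haar ι)

/-- The Birkhoff average `B^T_X(x)(f)` of a function. -/
def birkhoff (X : LieAlg ι) (x : Nil ι) (T : ℝ) (f : Nil ι → ℂ) : ℂ :=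
  (1 / T : ℂ) * ∫ t in (0 : ℝ)..T, f (x.act (expG (t • X)))

/-- The filter on `C^∞(M)` of the neighbourhoods of `f` for the norm `|·|_{F,σ}`. -/
def AdaptedBasis.smoothNhds (F : AdaptedBasis ι) (σ : ℝ) (f : Nil ι → ℂ) :
    Filter {φ : Nil ι → ℂ // Smooth φ} :=
  comap (fun φ => F.tNorm σ fun x => φ.1 x - f x) (𝓝 0)

/-- `b = B^T_X(x)(f)` for `f ∈ W^σ(M, F)`, where `B^T_X(x)` is extended by continuity from
`C^∞(M)` to `W^σ(M, F)`. -/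
def AdaptedBasis.HasBirkhoff (F : AdaptedBasis ι) (σ : ℝ) (x : Nil ι) (T : ℝ) (f : Nil ι → ℂ)
    (b : ℂ) : Prop :=
  Tendsto (fun φ => birkhoff F.X x T φ.1) (F.smoothNhds σ f) (𝓝 b)

end QuasiAbelian

end

noncomputable section

namespace QuasiAbelian

variable {n : ℕ} {ι : Fin n → ℕ}

/-! ### The one-parameter group `twist` -/

/-! The operator (I + Δ_Y)^{-σ/2} is an average over translates: it sends g to the expectation of
g(x exp(v·Y)), where τ is a Gamma variable of parameter σ/2 and, given τ, v is a centred Gaussian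
vector of covariance 2τ (`negPow_eq_avg`). This is read off on waves, the functions with a single
Fourier frequency on the torus fibres of M over the circle and a coefficient that vanishes near the
seam. There Y_j multiplies the coefficient by iξ_j(t), so a function of Δ_Y becomes multiplication
by that function of |ξ|², while averaging multiplies by the characteristic function of v, which is
(1 + |ξ|²)^{-σ/2} (`integral_subord_exp`). Waves span a dense subspace (`dense_span_waveSet`).

Hence, if f = (I + Δ_Y)^{-σ/2} g, the integral of f along an orbit segment is an integral of
g(φ_x(t, v)) over t and v. For an admissible Ω and a fixed shift v, the square of g(φ_x(t, s + v))
has integral at most ‖g‖² over Ω, since φ_x is injective and volume preserving there and translation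
by exp(v·Y) preserves the measure. Integrating over v against an integrable weight, which varies by
at most a constant factor under shifts in the cube, bounds the weighted integral of |Ω_t| |g(φ_x(t,
v))|² (`lintegral_weight_le`). Cauchy–Schwarz against the heat kernel at time τ then yields (∫
dt/|Ω_t|)^{1/2} ‖g‖ with a constant of order τ^{-a/4} as τ → 0. Against the Gamma density τ^{σ/2-1}
e^{-τ} this is integrable because σ > a/2 (`subordConst_ne_top`). The width is at most the volume of
the fibre, which gives `orbInt_le_of_admissible`, with a constant that depends only on a and σ.

Elements of W^σ are defined almost everywhere only, and orbits are null sets. The same estimate on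
[0,T] × cube, with finite covering multiplicity in place of injectivity, shows that orbit integrals
depend continuously on g in L², uniformly in x (`exists_orbInt_le`). They are therefore continuous
in x, and identities valid almost everywhere hold everywhere, because the measure has full support.

For the pointwise bound, a weak derivative along X gives u(x exp rX) = u(x) + ∫_0^r Xu almost
everywhere (`weak_flow`). Averaging over 0 ≤ r ≤ 1 expresses u by orbit integrals: this is the
continuous representative `contRep`, and the orbit estimate applies to it. The commutator terms play
no role in the bound. It only has to be shown that they lie in W^σ, which follows from the
boundedness of Z(I + Δ_Y)^{-1/2} for Z in the Abelian ideal and the fact that Z commutes with Δ_Y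
(`isWeakDeriv_rieszOp`). -/

theorem contDiff_choose (k : ℕ) : ContDiff ℝ ∞ fun t : ℝ => Ring.choose t k := by
  have : (fun t : ℝ => Ring.choose t k)
      = fun t : ℝ => ((k.factorial : ℝ)⁻¹) * (Polynomial.aeval t (descPochhammer ℤ k)) := by
    funext t
    rw [Ring.choose_eq_smul, Polynomial.aeval_eq_smeval]
    rfl
  rw [this]
  exact contDiff_const.mul (Polynomial.contDiff_aeval _ _)

theorem contDiff_twist_apply (p q : Idx ι) : ContDiff ℝ ∞ fun t : ℝ => twist ι t p q := by
  obtain ⟨m, p⟩ := p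
  obtain ⟨m', q⟩ := q
  simp only [twist, Matrix.blockDiagonal'_apply]
  split_ifs with h
  · subst h
    simp only [jordanFlow, Matrix.of_apply, cast_eq]
    split_ifs
    · exact contDiff_choose _
    · exact contDiff_const
  · exact contDiff_const

theorem continuous_twist : Continuous fun t : ℝ => twist ι t :=
  continuous_matrix fun p q => (contDiff_twist_apply p q).continuous

theorem continuous_twist_mulVec {T : Type*} [TopologicalSpace T] {f : T → ℝ}
    {g : T → Idx ι → ℝ} (hf : Continuous f) (hg : Continuous g) :
    Continuous fun x => (twist ι (f x)).mulVec (g x) :=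
  (continuous_twist.comp hf).matrix_mulVec hg

/-- Grading the coordinates by their position inside a Jordan block, all blocks together, makes the
matrix block triangular with identity diagonal blocks. Unimodularity is what makes Lebesgue measure
invariant under left translations of G. -/
theorem det_twist (t : ℝ) : (twist ι t).det = 1 := by
  have hentry : ∀ p q : Idx ι, (p.2 : ℕ) ≤ q.2 → twist ι t p q = if p = q then 1 else 0 := by
    rintro ⟨m, p⟩ ⟨m', q⟩ hpq
    simp only [twist, Matrix.blockDiagonal'_apply]
    split_ifs with h h' h'
    · cases h'
      simp [jordanFlow]
    · subst h
      have hne : p ≠ q := fun h => h' (by rw [h])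
      have hlt : ¬ q ≤ p := fun h => hne (le_antisymm hpq h)
      simp [jordanFlow, hlt]
    · cases h'
      exact absurd rfl h
    · rfl
  have hb : (twist ι t).BlockTriangular fun p : Idx ι => OrderDual.toDual (p.2 : ℕ) := by
    intro p q hpq
    have hpq' : (p.2 : ℕ) < q.2 := hpq
    rw [hentry p q hpq'.le, if_neg]
    rintro rfl
    exact lt_irrefl _ hpq'
  rw [hb.det]
  refine Finset.prod_eq_one fun k _ => ?_
  have : (twist ι t).toSquareBlock (fun p : Idx ι => OrderDual.toDual (p.2 : ℕ)) k = 1 := by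
    ext ⟨p, hp⟩ ⟨q, hq⟩
    have hpq : (p.2 : ℕ) = q.2 := OrderDual.toDual.injective (hp.trans hq.symm)
    simp only [Matrix.toSquareBlock_def, Matrix.of_apply, Matrix.one_apply, Subtype.mk.injEq]
    exact hentry p q hpq.le
  rw [this, Matrix.det_one]

theorem twist_mulVec_mulVec (s t : ℝ) (v : Idx ι → ℝ) :
    (twist ι s).mulVec ((twist ι t).mulVec v) = (twist ι (s + t)).mulVec v := by
  rw [twist_add, Matrix.mulVec_mulVec]

/-! ### The group law and the exponential -/

theorem Grp.of_mul_of (s t : ℝ) (v w : Idx ι → ℝ) :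
    Grp.of s v * Grp.of t w = Grp.of (s + t) (v + (twist ι s).mulVec w) := rfl

theorem Grp.one_eq : (1 : Grp ι) = Grp.of 0 0 := rfl

@[simp] theorem Grp.of_fst (s : ℝ) (v : Idx ι → ℝ) : (Grp.of s v).1 = s := rfl

@[simp] theorem Grp.of_snd (s : ℝ) (v : Idx ι → ℝ) : (Grp.of s v).2 = v := rfl

/-- The component in `ℝ^a` of the one-parameter subgroup `r ↦ exp (r Z)`. -/
def expVec (Z : LieAlg ι) (r : ℝ) : Idx ι → ℝ :=
  ∫ ρ in (0 : ℝ)..r, (twist ι (ρ * Z.1)).mulVec Z.2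

theorem continuous_expVec_integrand (Z : LieAlg ι) :
    Continuous fun ρ : ℝ => (twist ι (ρ * Z.1)).mulVec Z.2 := by
  exact continuous_twist_mulVec (by fun_prop) continuous_const

theorem expG_smul (r : ℝ) (Z : LieAlg ι) : expG (r • Z) = Grp.of (r * Z.1) (expVec Z r) := by
  have h1 : (r • Z).1 = r * Z.1 := rfl
  have h2 : (r • Z).2 = r • Z.2 := rfl
  have h := intervalIntegral.smul_integral_comp_mul_right
    (fun ρ : ℝ => (twist ι (ρ * Z.1)).mulVec Z.2) r (a := 0) (b := 1)
  rw [zero_mul, one_mul] at h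
  rw [expG, h1, h2, expVec, ← h, ← intervalIntegral.integral_smul]
  simp only [Matrix.mulVec_smul, mul_assoc]

theorem expVec_zero (Z : LieAlg ι) : expVec Z 0 = 0 := by simp [expVec]

theorem hasDerivAt_expVec (Z : LieAlg ι) (r : ℝ) :
    HasDerivAt (expVec Z) ((twist ι (r * Z.1)).mulVec Z.2) r :=
  intervalIntegral.integral_hasDerivAt_right
    ((continuous_expVec_integrand Z).intervalIntegrable _ _)
    ((continuous_expVec_integrand Z).stronglyMeasurableAtFilter _ _)
    (continuous_expVec_integrand Z).continuousAt

theorem continuous_expVec (Z : LieAlg ι) : Continuous (expVec Z) :=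
  continuous_iff_continuousAt.2 fun r => (hasDerivAt_expVec Z r).continuousAt

/-- The cocycle identity behind exp((r+s)Z) = exp(rZ) exp(sZ): the part of the integral beyond r is
a translate of the integral up to s, with h(rZ.1) pulled out as a constant linear map. -/
theorem expVec_add (Z : LieAlg ι) (r s : ℝ) :
    expVec Z (r + s) = expVec Z r + (twist ι (r * Z.1)).mulVec (expVec Z s) := by
  have hc := continuous_expVec_integrand Z
  have h1 : expVec Z (r + s) = expVec Z r
      + ∫ ρ in r..(r + s), (twist ι (ρ * Z.1)).mulVec Z.2 :=
    (intervalIntegral.integral_add_adjacent_intervals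
      (hc.intervalIntegrable _ _) (hc.intervalIntegrable _ _)).symm
  have h2 := (Matrix.mulVecLin (twist ι (r * Z.1))).toContinuousLinearMap.intervalIntegral_comp_comm
    (hc.intervalIntegrable (μ := volume) 0 s)
  simp only [LinearMap.coe_toContinuousLinearMap', Matrix.mulVecLin_apply] at h2
  rw [h1, expVec, expVec, ← h2]
  congr 1
  have h3 := intervalIntegral.integral_comp_add_left
    (fun ρ : ℝ => (twist ι (ρ * Z.1)).mulVec Z.2) r (a := 0) (b := s)
  rw [add_zero] at h3
  rw [← h3]
  congr 1
  funext ρ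
  rw [twist_mulVec_mulVec, add_mul]

theorem expG_add_smul (Z : LieAlg ι) (r s : ℝ) :
    expG ((r + s) • Z) = expG (r • Z) * expG (s • Z) := by
  rw [expG_smul, expG_smul, expG_smul, Grp.of_mul_of, expVec_add, add_mul]

theorem expG_zero_smul (Z : LieAlg ι) : expG ((0 : ℝ) • Z) = 1 := by
  rw [expG_smul, expVec_zero, zero_mul, Grp.one_eq]

theorem expG_ideal {Z : LieAlg ι} (hZ : Z.1 = 0) : expG Z = Grp.of 0 Z.2 := by
  refine Prod.ext hZ ?_
  simp [expG, hZ, twist_zero]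

instance : IsTopologicalGroup (Grp ι) where
  continuous_mul := by
    have : Continuous fun p : (ℝ × (Idx ι → ℝ)) × (ℝ × (Idx ι → ℝ)) =>
        (p.1.1 + p.2.1, p.1.2 + (twist ι p.1.1).mulVec p.2.2) :=
      (by fun_prop : Continuous fun p : (ℝ × (Idx ι → ℝ)) × (ℝ × (Idx ι → ℝ)) =>
        p.1.1 + p.2.1).prodMk ((by fun_prop : Continuous fun p : (ℝ × (Idx ι → ℝ)) ×
          (ℝ × (Idx ι → ℝ)) => p.1.2).add (continuous_twist_mulVec (by fun_prop) (by fun_prop)))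
    exact this
  continuous_inv := by
    have : Continuous fun p : ℝ × (Idx ι → ℝ) => (-p.1, -((twist ι (-p.1)).mulVec p.2)) :=
      (by fun_prop : Continuous fun p : ℝ × (Idx ι → ℝ) => -p.1).prodMk
        (continuous_twist_mulVec (by fun_prop) (by fun_prop)).neg
    exact this

instance : BorelSpace (Grp ι) := inferInstanceAs (BorelSpace (ℝ × (Idx ι → ℝ)))

instance : SecondCountableTopology (Grp ι) :=
  inferInstanceAs (SecondCountableTopology (ℝ × (Idx ι → ℝ)))

instance : T2Space (Grp ι) := inferInstanceAs (T2Space (ℝ × (Idx ι → ℝ)))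

theorem Grp.continuous_of : Continuous fun p : ℝ × (Idx ι → ℝ) => Grp.of p.1 p.2 :=
  continuous_id

theorem continuous_expG_smul (Z : LieAlg ι) : Continuous fun r : ℝ => expG (r • Z) := by
  simp only [expG_smul]
  exact Grp.continuous_of.comp
    (Continuous.prodMk (continuous_id.mul continuous_const) (continuous_expVec Z))

/-! ### The action on `M` -/

theorem Nil.act_mk (g k : Grp ι) : (Nil.mk g).act k = Nil.mk (g * k) := rfl

theorem Nil.mk_surjective : Function.Surjective (Nil.mk : Grp ι → Nil ι) :=
  Quotient.mk_surjective (s := QuotientGroup.rightRel (lattice ι))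

theorem Nil.act_mul (x : Nil ι) (g k : Grp ι) : x.act (g * k) = (x.act g).act k := by
  obtain ⟨p, rfl⟩ := Nil.mk_surjective x
  rw [Nil.act_mk, Nil.act_mk, Nil.act_mk, mul_assoc]

theorem Nil.act_one (x : Nil ι) : x.act 1 = x := by
  obtain ⟨p, rfl⟩ := Nil.mk_surjective x
  rw [Nil.act_mk, mul_one]

theorem Nil.mk_eq_mk {g k : Grp ι} : Nil.mk g = Nil.mk k ↔ ∃ γ ∈ lattice ι, γ * g = k := by
  refine (Quotient.eq (r := QuotientGroup.rightRel (lattice ι))).trans ?_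
  rw [QuotientGroup.rightRel_apply]
  constructor
  · intro h
    exact ⟨_, h, by group⟩
  · rintro ⟨γ, hγ, rfl⟩
    simpa using hγ

theorem Nil.mk_mul_left {γ : Grp ι} (hγ : γ ∈ lattice ι) (g : Grp ι) :
    Nil.mk (γ * g) = Nil.mk g :=
  (Nil.mk_eq_mk.2 ⟨γ, hγ, rfl⟩).symm

theorem Nil.continuous_mk : Continuous (Nil.mk : Grp ι → Nil ι) := continuous_coinduced_rng

theorem Nil.measurable_mk : Measurable (Nil.mk : Grp ι → Nil ι) :=
  fun _ hs => hs

theorem Nil.continuous_iff {E : Type*} [TopologicalSpace E] {f : Nil ι → E} :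
    Continuous f ↔ Continuous fun g => f (Nil.mk g) :=
  ⟨fun h => h.comp Nil.continuous_mk, fun h => continuous_coinduced_dom.2 h⟩

theorem Nil.measurable_iff {E : Type*} [MeasurableSpace E] {f : Nil ι → E} :
    Measurable f ↔ Measurable fun g => f (Nil.mk g) :=
  ⟨fun h => h.comp Nil.measurable_mk, fun h _ hs => h hs⟩

theorem Nil.measurable_of_continuous {E : Type*} [TopologicalSpace E] [MeasurableSpace E]
    [BorelSpace E] {f : Nil ι → E} (hf : Continuous f) : Measurable f :=
  Nil.measurable_iff.2 (Nil.continuous_iff.1 hf).measurable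

/-- The representative of a point of `M` in the fundamental domain `[0,1) × [0,1)^a`. -/
def redG (g : Grp ι) : Grp ι :=
  Grp.of (Int.fract g.1) fun j => Int.fract ((twist ι (-(⌊g.1⌋ : ℝ))).mulVec g.2 j)

/-- Multiplying by (k, v) shifts the floor of the first coordinate by k. After untwisting by that
floor the vector changes only by an integer vector, since h(ℤ) preserves ℤ^a, and fractional parts
do not see it. -/
theorem redG_lattice_mul {γ : Grp ι} (hγ : γ ∈ lattice ι) (g : Grp ι) :
    redG (γ * g) = redG g := by
  obtain ⟨k, v, rfl⟩ := hγ
  refine Prod.ext ?_ ?_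
  · change Int.fract ((k : ℝ) + g.1) = Int.fract g.1
    simp
  · funext j
    change Int.fract ((twist ι (-(⌊(k : ℝ) + g.1⌋ : ℝ))).mulVec
      ((fun j => (v j : ℝ)) + (twist ι (k : ℝ)).mulVec g.2) j)
      = Int.fract ((twist ι (-(⌊g.1⌋ : ℝ))).mulVec g.2 j)
    obtain ⟨w, hw⟩ := twist_int ι (-⌊(k : ℝ) + g.1⌋) v
    rw [Int.cast_neg] at hw
    rw [Matrix.mulVec_add, twist_mulVec_mulVec, hw, Int.floor_intCast_add]
    have : (-((k + ⌊g.1⌋ : ℤ) : ℝ) + k) = -(⌊g.1⌋ : ℝ) := by push_cast; ring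
    rw [this, Pi.add_apply, Int.fract_intCast_add]

theorem mk_redG (g : Grp ι) : Nil.mk (redG g) = Nil.mk g := by
  symm
  rw [Nil.mk_eq_mk]
  refine ⟨Grp.of ((-⌊g.1⌋ : ℤ) : ℝ)
    (fun j => ((-⌊(twist ι (-(⌊g.1⌋ : ℝ))).mulVec g.2 j⌋ : ℤ) : ℝ)), ⟨_, _, rfl⟩, ?_⟩
  refine Prod.ext ?_ ?_
  · change ((-⌊g.1⌋ : ℤ) : ℝ) + g.1 = Int.fract g.1
    rw [Int.fract]; push_cast; ring
  · funext j
    change ((-⌊(twist ι (-(⌊g.1⌋ : ℝ))).mulVec g.2 j⌋ : ℤ) : ℝ)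
      + (twist ι ((-⌊g.1⌋ : ℤ) : ℝ)).mulVec g.2 j = Int.fract _
    rw [Int.fract]; push_cast; ring

/-- The section of `G → M` with values in the fundamental domain. -/
def Nil.rep (x : Nil ι) : Grp ι :=
  Quotient.lift (s := QuotientGroup.rightRel (lattice ι)) redG (by
    intro g k h
    have h' : Nil.mk g = Nil.mk k := Quotient.sound h
    obtain ⟨γ, hγ, rfl⟩ := Nil.mk_eq_mk.1 h'
    exact (redG_lattice_mul hγ g).symm) x

theorem Nil.rep_mk (g : Grp ι) : (Nil.mk g).rep = redG g := rfl

theorem Nil.mk_rep (x : Nil ι) : Nil.mk x.rep = x := by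
  obtain ⟨g, rfl⟩ := Nil.mk_surjective x
  rw [Nil.rep_mk, mk_redG]

theorem Nil.measurable_rep : Measurable (Nil.rep : Nil ι → Grp ι) := by
  rw [Nil.measurable_iff]
  have h1 : Measurable fun p : ℝ × (Idx ι → ℝ) => ((-(⌊p.1⌋ : ℝ) : ℝ), p.2) := by fun_prop
  have h3 : Continuous fun p : ℝ × (Idx ι → ℝ) => (twist ι p.1).mulVec p.2 :=
    continuous_twist_mulVec (by fun_prop) (by fun_prop)
  have h2 : Measurable fun p : ℝ × (Idx ι → ℝ) => (Int.fract p.1,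
      fun j => Int.fract ((twist ι (-(⌊p.1⌋ : ℝ))).mulVec p.2 j)) := by
    refine Measurable.prodMk (by fun_prop) (measurable_pi_iff.2 fun j => ?_)
    exact ((measurable_pi_apply j).comp (h3.measurable.comp h1)).fract
  exact h2

/-- Joint measurability does not come directly from the quotient σ-algebra on M, so the action is
factored through the measurable section `Nil.rep`. -/
theorem Nil.measurable_act : Measurable fun p : Nil ι × Grp ι => p.1.act p.2 := by
  have : (fun p : Nil ι × Grp ι => p.1.act p.2) = fun p => Nil.mk (p.1.rep * p.2) := by
    funext p
    rw [← Nil.act_mk, Nil.mk_rep]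
  rw [this]
  exact Nil.measurable_mk.comp
    ((Nil.measurable_rep.comp measurable_fst).mul measurable_snd)

theorem Nil.continuous_act_right (x : Nil ι) : Continuous fun k : Grp ι => x.act k := by
  obtain ⟨g, rfl⟩ := Nil.mk_surjective x
  exact Nil.continuous_mk.comp (continuous_const_mul g)

theorem Nil.continuous_act_left (k : Grp ι) : Continuous fun x : Nil ι => x.act k :=
  Nil.continuous_iff.2 (Nil.continuous_mk.comp (continuous_mul_const k))

/-! ### Lebesgue measure on `G` -/

/-- Fubini: the map lies over t ↦ t₀ + τt, which scales length by |τ|, and is affine of determinant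
d on each fibre. One statement serves left translations, right translations and the charts. -/
theorem measurePreserving_skewAffine {J : Type*} [Fintype J] [DecidableEq J] (t₀ τ d : ℝ)
    (hτd : |τ * d| = 1) (α : ℝ → J → ℝ) (hα : Continuous α) (A : ℝ → Matrix J J ℝ)
    (hA : Continuous A) (hd : ∀ t, (A t).det = d) :
    MeasurePreserving (fun p : ℝ × (J → ℝ) => (t₀ + τ * p.1, α p.1 + (A p.1).mulVec p.2))
      volume volume := by
  have hne : τ * d ≠ 0 := by
    intro h; simp [h] at hτd
  have hτ : τ ≠ 0 := left_ne_zero_of_mul hne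
  have hd0 : d ≠ 0 := right_ne_zero_of_mul hne
  have h1 : MeasurePreserving (fun t : ℝ => t₀ + τ * t) volume
      (ENNReal.ofReal |τ⁻¹| • volume) := by
    refine ⟨by fun_prop, ?_⟩
    have : (fun t : ℝ => t₀ + τ * t) = (fun t => t₀ + t) ∘ fun t => τ * t := rfl
    rw [this, ← Measure.map_map (measurable_const_add _) (measurable_const_mul _),
      Real.map_volume_mul_left hτ, Measure.map_smul, map_add_left_eq_self]
  have h2 := h1.skew_product (μc := (volume : Measure (J → ℝ)))
    (g := fun t v => α t + (A t).mulVec v) (μd := ENNReal.ofReal |d⁻¹| • volume)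
    (by
      have : Continuous fun p : ℝ × (J → ℝ) => α p.1 + (A p.1).mulVec p.2 :=
        (hα.comp continuous_fst).add ((hA.comp continuous_fst).matrix_mulVec continuous_snd)
      exact this.measurable)
    (Eventually.of_forall fun t => by
      have h3 := Real.map_matrix_volume_pi_eq_smul_volume_pi (M := A t) (by rw [hd]; exact hd0)
      have h4 : (fun v => α t + (A t).mulVec v)
          = (fun v => α t + v) ∘ (Matrix.toLin' (A t)) := by
        funext v; simp
      rw [h4, ← Measure.map_map (measurable_const_add _)
        (LinearMap.continuous_of_finiteDimensional _).measurable, h3, Measure.map_smul,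
        map_add_left_eq_self, hd])
  have h5 : (ENNReal.ofReal |τ⁻¹| • (volume : Measure ℝ)).prod
      (ENNReal.ofReal |d⁻¹| • (volume : Measure (J → ℝ))) = volume := by
    rw [Measure.prod_smul_left, Measure.prod_smul_right, smul_smul, ← ENNReal.ofReal_mul
      (abs_nonneg _), ← abs_mul, ← mul_inv, abs_inv, hτd, inv_one, ENNReal.ofReal_one, one_smul]
    rfl
  rw [h5] at h2
  exact h2

theorem injective_skewAffine {J : Type*} [Fintype J] [DecidableEq J] {τ d : ℝ}
    (hτ : τ ≠ 0) (hd0 : d ≠ 0) (α : ℝ → J → ℝ) (A : ℝ → Matrix J J ℝ)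
    (hd : ∀ t, (A t).det = d) :
    Function.Injective (fun p : ℝ × (J → ℝ) => (τ * p.1, α p.1 + (A p.1).mulVec p.2)) := by
  rintro ⟨t, v⟩ ⟨t', v'⟩ h
  simp only [Prod.mk.injEq, mul_eq_mul_left_iff, hτ, or_false] at h
  obtain ⟨rfl, h⟩ := h
  have hu : IsUnit (A t) := (Matrix.isUnit_iff_isUnit_det _).2 (by rw [hd]; exact hd0.isUnit)
  exact Prod.ext rfl (Matrix.mulVec_injective_iff_isUnit.2 hu (add_left_cancel h))

variable (ι) in
/-- Lebesgue measure on `G`, in its global coordinates. -/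
def vol : Measure (Grp ι) := (volume : Measure (ℝ × (Idx ι → ℝ)))

theorem measurePreserving_skewAffine_grp {f : ℝ × (Idx ι → ℝ) → ℝ × (Idx ι → ℝ)}
    (hf : MeasurePreserving f volume volume) {g : Grp ι → Grp ι} (h : ∀ k : Grp ι, g k = f k) :
    MeasurePreserving g (vol ι) (vol ι) := by
  have : g = f := funext h
  rw [this]
  exact hf

theorem measurePreserving_mul_left (g : Grp ι) :
    MeasurePreserving (fun k : Grp ι => g * k) (vol ι) (vol ι) :=
  measurePreserving_skewAffine_grp (measurePreserving_skewAffine (J := Idx ι) g.1 1 1 (by simp)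
    (fun _ => g.2) continuous_const (fun _ => twist ι g.1) continuous_const
    (fun _ => det_twist _)) fun k => by rw [one_mul]; rfl

theorem measurePreserving_mul_right (g : Grp ι) :
    MeasurePreserving (fun k : Grp ι => k * g) (vol ι) (vol ι) :=
  measurePreserving_skewAffine_grp (measurePreserving_skewAffine (J := Idx ι) g.1 1 1 (by simp)
    (fun t => (twist ι t).mulVec g.2) (continuous_twist_mulVec continuous_id continuous_const)
    (fun _ => 1) continuous_const (fun _ => Matrix.det_one)) fun k => by
      rw [one_mul, Matrix.one_mulVec, add_comm, add_comm _ k.2]; rfl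

/-! ### The fundamental domain -/

instance : Countable (lattice ι) := by
  refine Function.Surjective.countable (α := ℤ × (Idx ι → ℤ))
    (f := fun p => ⟨Grp.of (p.1 : ℝ) fun j => (p.2 j : ℝ), p.1, p.2, rfl⟩) ?_
  rintro ⟨_, k, v, rfl⟩
  exact ⟨(k, v), rfl⟩

variable (ι) in
/-- The fundamental domain `[0,1) × [0,1)^a`. -/
def box : Set (Grp ι) := (Set.Ico (0 : ℝ) 1 ×ˢ Set.univ.pi fun _ => Set.Ico (0 : ℝ) 1 :
  Set (ℝ × (Idx ι → ℝ)))

theorem mem_box {g : Grp ι} :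
    g ∈ box ι ↔ g.1 ∈ Set.Ico (0 : ℝ) 1 ∧ ∀ j, g.2 j ∈ Set.Ico (0 : ℝ) 1 := by
  change g.1 ∈ Set.Ico (0 : ℝ) 1 ∧ g.2 ∈ Set.univ.pi _ ↔ _
  simp only [Set.mem_univ_pi]

theorem measurableSet_box : MeasurableSet (box ι) := by
  have : MeasurableSet (Set.Ico (0 : ℝ) 1 ×ˢ Set.univ.pi fun _ => Set.Ico (0 : ℝ) 1 :
    Set (ℝ × (Idx ι → ℝ))) :=
    measurableSet_Ico.prod (MeasurableSet.univ_pi fun _ => measurableSet_Ico)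
  exact this

theorem redG_mem_box (g : Grp ι) : redG g ∈ box ι :=
  mem_box.2 ⟨⟨Int.fract_nonneg _, Int.fract_lt_one _⟩,
    fun _ => ⟨Int.fract_nonneg _, Int.fract_lt_one _⟩⟩

theorem redG_of_mem_box {g : Grp ι} (hg : g ∈ box ι) : redG g = g := by
  obtain ⟨h1, h2⟩ := mem_box.1 hg
  have hf : ⌊g.1⌋ = 0 := Int.floor_eq_zero_iff.2 h1
  refine Prod.ext ?_ ?_
  · exact Int.fract_eq_self.2 h1
  · funext j
    change Int.fract ((twist ι (-(⌊g.1⌋ : ℝ))).mulVec g.2 j) = g.2 j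
    rw [hf, Int.cast_zero, neg_zero, twist_zero, Matrix.one_mulVec]
    exact Int.fract_eq_self.2 (h2 j)

theorem Nil.rep_mk_of_mem_box {g : Grp ι} (hg : g ∈ box ι) : (Nil.mk g).rep = g :=
  redG_of_mem_box hg

theorem haar_eq : haar ι = Measure.map Nil.mk ((vol ι).restrict (box ι)) := rfl

theorem vol_box : vol ι (box ι) = 1 := by
  have : (volume : Measure (ℝ × (Idx ι → ℝ)))
    (Set.Ico (0 : ℝ) 1 ×ˢ Set.univ.pi fun _ => Set.Ico (0 : ℝ) 1) = 1 := by
    rw [Measure.volume_eq_prod, Measure.prod_prod, volume_pi, Measure.pi_pi]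
    simp
  exact this

instance : IsProbabilityMeasure (haar ι) := by
  rw [haar_eq]
  have : IsProbabilityMeasure ((vol ι).restrict (box ι)) := ⟨by simp [vol_box]⟩
  exact Measure.isProbabilityMeasure_map Nil.measurable_mk.aemeasurable

theorem lintegral_haar {f : Nil ι → ℝ≥0∞} (hf : Measurable f) :
    ∫⁻ x, f x ∂haar ι = ∫⁻ g in box ι, f (Nil.mk g) ∂vol ι := by
  rw [haar_eq, lintegral_map hf Nil.measurable_mk]

instance : SMulInvariantMeasure (lattice ι) (Grp ι) (vol ι) :=
  ⟨fun γ _ hs => (measurePreserving_mul_left (γ : Grp ι)).measure_preimage hs.nullMeasurableSet⟩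

instance : MeasurableConstSMul (lattice ι) (Grp ι) :=
  ⟨fun γ => (measurePreserving_mul_left (γ : Grp ι)).measurable⟩

theorem existsUnique_lattice_smul_mem_box (g : Grp ι) : ∃! γ : lattice ι, γ • g ∈ box ι := by
  obtain ⟨γ, hγ, h⟩ := Nil.mk_eq_mk.1 (mk_redG g).symm
  refine ⟨⟨γ, hγ⟩, ?_, ?_⟩
  · change γ * g ∈ box ι
    rw [h]
    exact redG_mem_box g
  · rintro ⟨γ', hγ'⟩ h'
    have h' : γ' * g ∈ box ι := h'
    have := redG_of_mem_box h'
    rw [redG_lattice_mul hγ', ← h] at this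
    exact Subtype.ext (mul_right_cancel this.symm)

theorem isFundamentalDomain_box : IsFundamentalDomain (lattice ι) (box ι) (vol ι) :=
  IsFundamentalDomain.mk' measurableSet_box.nullMeasurableSet existsUnique_lattice_smul_mem_box

theorem Nil.mk_smul (γ : lattice ι) (g : Grp ι) : Nil.mk (γ • g) = Nil.mk g :=
  Nil.mk_mul_left γ.2 g

/-- Left and right multiplications commute, so the right translate of the box is again a fundamental
domain for Γ, and a Γ-invariant function has the same integral over any two of them. -/
theorem measurePreserving_act (k : Grp ι) :
    MeasurePreserving (fun x : Nil ι => x.act k) (haar ι) (haar ι) := by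
  have hm : Measurable fun x : Nil ι => x.act k :=
    Nil.measurable_act.comp (measurable_id.prodMk measurable_const)
  refine ⟨hm, Measure.ext_of_lintegral _ fun f hf => ?_⟩
  rw [lintegral_map hf hm, lintegral_haar (f := fun x : Nil ι => f (x.act k)) (hf.comp hm),
    lintegral_haar hf]
  have hmp := measurePreserving_mul_right (ι := ι) k
  have hemb : MeasurableEmbedding fun g : Grp ι => g * k :=
    (Homeomorph.mulRight k).measurableEmbedding
  have h1 : ∫⁻ g in box ι, f ((Nil.mk g).act k) ∂vol ι
      = ∫⁻ g in (fun g : Grp ι => g * k) '' box ι, f (Nil.mk g) ∂vol ι :=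
    hmp.setLIntegral_comp_emb hemb (fun g => f (Nil.mk g)) _
  rw [h1]
  have hmem : ∀ g : Grp ι, g ∈ (fun g : Grp ι => g * k) '' box ι ↔ g * k⁻¹ ∈ box ι := by
    intro g
    constructor
    · rintro ⟨p, hp, rfl⟩
      simpa using hp
    · intro h
      exact ⟨_, h, by simp⟩
  refine IsFundamentalDomain.setLIntegral_eq (G := lattice ι) (IsFundamentalDomain.mk'
    (hemb.measurableSet_image.2 measurableSet_box).nullMeasurableSet fun g => ?_)
    isFundamentalDomain_box _ fun γ g => by rw [Nil.mk_smul]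
  simp only [hmem, smul_mul_assoc]
  exact existsUnique_lattice_smul_mem_box (g * k⁻¹)

theorem lintegral_act {f : Nil ι → ℝ≥0∞} (hf : Measurable f) (k : Grp ι) :
    ∫⁻ x, f (x.act k) ∂haar ι = ∫⁻ x, f x ∂haar ι :=
  (measurePreserving_act k).lintegral_comp hf

-- Cut K along the Γ-translates of the box and move every piece back into the box. Injectivity on K
-- makes the moved pieces disjoint.
open scoped Pointwise in
theorem setLIntegral_mk_le {f : Nil ι → ℝ≥0∞} (hf : Measurable f) {K : Set (Grp ι)}
    (hK : MeasurableSet K) (hinj : Set.InjOn Nil.mk K) :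
    ∫⁻ g in K, f (Nil.mk g) ∂vol ι ≤ ∫⁻ x, f x ∂haar ι := by
  rw [isFundamentalDomain_box.setLIntegral_eq_tsum', lintegral_haar hf]
  simp only [Nil.mk_smul]
  have hms : ∀ γ : lattice ι, MeasurableSet (γ • K ∩ box ι) := fun γ =>
    (hK.const_smul γ).inter measurableSet_box
  rw [← lintegral_iUnion hms]
  · exact lintegral_mono_set (Set.iUnion_subset fun γ => Set.inter_subset_right)
  · intro γ γ' hne
    refine Set.disjoint_left.2 ?_
    rintro g ⟨⟨p, hp, rfl⟩, -⟩ ⟨⟨p', hp', h⟩, -⟩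
    have h : γ' • p' = γ • p := h
    have : p' = p := hinj hp' hp (by rw [← Nil.mk_smul γ' p', h, Nil.mk_smul])
    subst this
    exact hne (Subtype.ext (mul_right_cancel h)).symm

/-- Γ meets the open unit cube V only in 1, and continuity of q'q⁻¹ gives a neighbourhood U of p
with UU⁻¹ ⊆ V. Two points of U in one coset thus differ by a lattice element of V. -/
theorem exists_nhds_injOn_mk (p : Grp ι) : ∃ U, IsOpen U ∧ p ∈ U ∧ Set.InjOn Nil.mk U := by
  set V : Set (Grp ι) := ({g : ℝ × (Idx ι → ℝ) | |g.1| < 1 ∧ ∀ j, |g.2 j| < 1} :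
    Set (ℝ × (Idx ι → ℝ))) with hV
  have hVo : IsOpen V := by
    have : IsOpen {g : ℝ × (Idx ι → ℝ) | |g.1| < 1 ∧ ∀ j, |g.2 j| < 1} := by
      have h : {g : ℝ × (Idx ι → ℝ) | |g.1| < 1 ∧ ∀ j, |g.2 j| < 1}
          = {g | |g.1| < 1} ∩ ⋂ j, {g | |g.2 j| < 1} := by
        ext g
        simp
      rw [h]
      exact (isOpen_lt continuous_fst.abs continuous_const).inter
        (isOpen_iInter_of_finite fun j => isOpen_lt
          ((continuous_apply j).comp continuous_snd).abs continuous_const)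
    exact this
  have hdisc : ∀ γ ∈ lattice ι, γ ∈ V → γ = 1 := by
    rintro _ ⟨k, v, rfl⟩ ⟨h1, h2⟩
    have hk : k = 0 := by
      have h1 : |(k : ℝ)| < 1 := h1
      rw [← Int.cast_abs] at h1
      exact Int.abs_lt_one_iff.1 (by exact_mod_cast h1)
    have hv : v = 0 := by
      funext j
      have h2 : |(v j : ℝ)| < 1 := h2 j
      rw [← Int.cast_abs] at h2
      exact Int.abs_lt_one_iff.1 (by exact_mod_cast h2)
    subst hk hv
    refine Prod.ext ?_ ?_
    · exact Int.cast_zero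
    · funext j
      exact Int.cast_zero
  have hc : Continuous fun q : Grp ι × Grp ι => q.1 * q.2⁻¹ :=
    continuous_fst.mul continuous_snd.inv
  have hpp : (p, p) ∈ (fun q : Grp ι × Grp ι => q.1 * q.2⁻¹) ⁻¹' V := by
    change p * p⁻¹ ∈ V
    rw [mul_inv_cancel]
    constructor
    · change |(0 : ℝ)| < 1
      simp
    · intro j
      change |(0 : ℝ)| < 1
      simp
  obtain ⟨U₁, U₂, h1, h2, hp1, hp2, hsub⟩ := isOpen_prod_iff.1 (hVo.preimage hc) p p hpp
  refine ⟨U₁ ∩ U₂, h1.inter h2, ⟨hp1, hp2⟩, ?_⟩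
  intro q hq q' hq' h
  obtain ⟨γ, hγ, rfl⟩ := Nil.mk_eq_mk.1 h
  have : γ * q * q⁻¹ ∈ V := hsub (Set.mk_mem_prod hq'.1 hq.2)
  rw [mul_inv_cancel_right] at this
  rw [hdisc γ hγ this, one_mul]

theorem exists_setLIntegral_mk_le {K : Set (Grp ι)} (hK : IsCompact K) :
    ∃ N : ℝ≥0, ∀ f : Nil ι → ℝ≥0∞, Measurable f →
      ∫⁻ g in K, f (Nil.mk g) ∂vol ι ≤ N * ∫⁻ x, f x ∂haar ι := by
  refine hK.induction_on (p := fun K => ∃ N : ℝ≥0, ∀ f : Nil ι → ℝ≥0∞, Measurable f →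
      ∫⁻ g in K, f (Nil.mk g) ∂vol ι ≤ N * ∫⁻ x, f x ∂haar ι) ?_ ?_ ?_ ?_
  · exact ⟨0, fun f _ => by simp⟩
  · rintro s t hst ⟨N, hN⟩
    exact ⟨N, fun f hf => (lintegral_mono_set hst).trans (hN f hf)⟩
  · rintro s t ⟨N, hN⟩ ⟨N', hN'⟩
    refine ⟨N + N', fun f hf => (lintegral_union_le _ _ _).trans ?_⟩
    rw [ENNReal.coe_add, add_mul]
    exact add_le_add (hN f hf) (hN' f hf)
  · intro p _
    obtain ⟨U, hU, hpU, hinj⟩ := exists_nhds_injOn_mk p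
    refine ⟨U, mem_nhdsWithin_of_mem_nhds (hU.mem_nhds hpU), 1, fun f hf => ?_⟩
    rw [ENNReal.coe_one, one_mul]
    exact setLIntegral_mk_le hf hU.measurableSet hinj

/-! ### The charts `φ_x` -/

namespace AdaptedBasis

variable (F : AdaptedBasis ι)

/-- The matrix with columns `Y_j`. -/
def mat : Matrix (Idx ι) (Idx ι) ℝ := Matrix.of fun i j => (F.Y j).2 i

theorem sum_smul_Y (s : Idx ι → ℝ) : ∑ j, s j • F.Y j = (0, F.mat.mulVec s) := by
  refine Prod.ext ?_ ?_
  · rw [Prod.fst_sum]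
    exact Finset.sum_eq_zero fun j _ => by simp [F.Y_mem j]
  · funext i
    rw [Prod.snd_sum, Finset.sum_apply]
    simp [Matrix.mulVec, dotProduct, mat, mul_comm]

/-- `exp(s · Y)`. -/
def expY (s : Idx ι → ℝ) : Grp ι := Grp.of 0 (F.mat.mulVec s)

theorem expG_sum_smul_Y (s : Idx ι → ℝ) : expG (∑ j, s j • F.Y j) = F.expY s := by
  rw [sum_smul_Y, expG_ideal rfl]
  rfl

theorem expY_add (s s' : Idx ι → ℝ) : F.expY (s + s') = F.expY s * F.expY s' := by
  rw [expY, expY, expY, Grp.of_mul_of, twist_zero, Matrix.one_mulVec, Matrix.mulVec_add, add_zero]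

theorem continuous_expY : Continuous F.expY :=
  Grp.continuous_of.comp (continuous_const.prodMk (continuous_const.matrix_mulVec continuous_id))

/-- The chart `(t, s) ↦ exp(tX) exp(s · Y)` of `G`. -/
def chart (p : ℝ × (Idx ι → ℝ)) : Grp ι := expG (p.1 • F.X) * F.expY p.2

theorem continuous_chart : Continuous F.chart :=
  ((continuous_expG_smul F.X).comp continuous_fst).mul (F.continuous_expY.comp continuous_snd)

theorem phi_eq (x : Nil ι) (p : ℝ × (Idx ι → ℝ)) : F.phi x p = x.act (F.chart p) := by
  rw [phi, expG_sum_smul_Y, chart, Nil.act_mul]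

theorem phi_add (x : Nil ι) (t : ℝ) (s s' : Idx ι → ℝ) :
    F.phi x (t, s + s') = (F.phi x (t, s)).act (F.expY s') := by
  rw [phi_eq, phi_eq, chart, chart, expY_add, ← mul_assoc, Nil.act_mul]

theorem phi_eq_act (x : Nil ι) (t : ℝ) (s : Idx ι → ℝ) :
    F.phi x (t, s) = (x.act (expG (t • F.X))).act (F.expY s) := by
  rw [phi, expG_sum_smul_Y]

theorem chart_apply (p : ℝ × (Idx ι → ℝ)) : F.chart p = Grp.of (F.X.1 * p.1)
    (expVec F.X p.1 + (twist ι (p.1 * F.X.1) * F.mat).mulVec p.2) := by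
  rw [chart, expG_smul, expY, Grp.of_mul_of, add_zero, Matrix.mulVec_mulVec, mul_comm p.1]

/-- The Y_j have no ξ-component, so the matrix is block triangular once X is placed last. The
resulting product is also the Jacobian of `chart`, which is why normalised bases give
volume-preserving charts. -/
theorem volForm_eq : volForm F.X F.Y = F.X.1 * F.mat.det := by
  have h : (Matrix.of fun p q : Option (Idx ι) =>
      q.elim (p.elim F.X F.Y).1 (p.elim F.X F.Y).2)
      = Matrix.reindex (Equiv.optionEquivSumPUnit.{0} (Idx ι)).symm
          (Equiv.optionEquivSumPUnit.{0} (Idx ι)).symm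
          (Matrix.fromBlocks F.mat.transpose 0 (Matrix.of fun _ j => F.X.2 j)
            (Matrix.of fun (_ : PUnit.{1}) (_ : PUnit.{1}) => F.X.1)) := by
    ext p q
    rcases p with _ | p <;> rcases q with _ | q
    · simp
    · simp
    · simp [F.Y_mem]
    · simp [mat]
  rw [volForm, h, Matrix.det_reindex_self, Matrix.det_fromBlocks_zero₁₂, Matrix.det_transpose,
    mul_comm]
  simp

variable {F}

theorem Normalised.mul_det (hF : F.Normalised) : F.X.1 * F.mat.det = 1 :=
  F.volForm_eq.symm.trans hF

theorem Normalised.measurePreserving_chart (hF : F.Normalised) :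
    MeasurePreserving F.chart volume (vol ι) := by
  have h := measurePreserving_skewAffine (J := Idx ι) 0 F.X.1 F.mat.det
    (by rw [hF.mul_det, abs_one]) (expVec F.X) (continuous_expVec _)
    (fun t => twist ι (t * F.X.1) * F.mat)
    ((continuous_twist.comp (by fun_prop)).matrix_mul continuous_const)
    (fun t => by rw [Matrix.det_mul, det_twist, one_mul])
  have h2 : F.chart = fun p => Grp.of (0 + F.X.1 * p.1)
      (expVec F.X p.1 + (twist ι (p.1 * F.X.1) * F.mat).mulVec p.2) := by
    funext p
    rw [F.chart_apply, zero_add]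
  rw [h2]
  exact h

theorem Normalised.injective_chart (hF : F.Normalised) : Function.Injective F.chart := by
  have hne : F.X.1 * F.mat.det ≠ 0 := by rw [hF.mul_det]; exact one_ne_zero
  have h := injective_skewAffine (J := Idx ι) (left_ne_zero_of_mul hne)
    (right_ne_zero_of_mul hne) (expVec F.X) (fun t => twist ι (t * F.X.1) * F.mat)
    (fun t => by rw [Matrix.det_mul, det_twist, one_mul])
  have h2 : F.chart = fun p => Grp.of (F.X.1 * p.1)
    (expVec F.X p.1 + (twist ι (p.1 * F.X.1) * F.mat).mulVec p.2) := funext F.chart_apply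
  rw [h2]
  exact h

instance : PolishSpace (Grp ι) := inferInstanceAs (PolishSpace (ℝ × (Idx ι → ℝ)))

theorem Normalised.measurableEmbedding_chart (hF : F.Normalised) :
    MeasurableEmbedding F.chart :=
  F.continuous_chart.measurableEmbedding hF.injective_chart

theorem Normalised.setLIntegral_phi (hF : F.Normalised) (f : Nil ι → ℝ≥0∞)
    (S : Set (ℝ × (Idx ι → ℝ))) (g : Grp ι) :
    ∫⁻ p in S, f (F.phi (Nil.mk g) p)
      = ∫⁻ k in (fun p => g * F.chart p) '' S, f (Nil.mk k) ∂vol ι := by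
  simp only [phi_eq, Nil.act_mk]
  exact ((measurePreserving_mul_left g).comp hF.measurePreserving_chart).setLIntegral_comp_emb
    ((Homeomorph.mulLeft g).measurableEmbedding.comp hF.measurableEmbedding_chart)
    (fun k => f (Nil.mk k)) S

/-- An embedded tube around an orbit sees each point of M at most once, with the right volume. This
is how admissibility of Ω enters the estimates. -/
theorem Normalised.setLIntegral_phi_le (hF : F.Normalised) {f : Nil ι → ℝ≥0∞}
    (hf : Measurable f) {S : Set (ℝ × (Idx ι → ℝ))} (hS : MeasurableSet S) (x : Nil ι)
    (hinj : Set.InjOn (F.phi x) S) :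
    ∫⁻ p in S, f (F.phi x p) ≤ ∫⁻ y, f y ∂haar ι := by
  obtain ⟨g, rfl⟩ := Nil.mk_surjective x
  rw [hF.setLIntegral_phi]
  refine setLIntegral_mk_le hf ?_ ?_
  · exact ((Homeomorph.mulLeft g).measurableEmbedding.comp
      hF.measurableEmbedding_chart).measurableSet_image.2 hS
  · rintro _ ⟨p, hp, rfl⟩ _ ⟨q, hq, rfl⟩ h
    have : p = q := hinj hp hq (by rw [phi_eq, phi_eq]; exact h)
    rw [this]

/-- Every x has a representative in the compact unit box, so the lifted images of S for all x lie in
one compact subset of G. Its covering multiplicity serves as N, independently of x. -/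
theorem Normalised.exists_setLIntegral_phi_le (hF : F.Normalised)
    {S : Set (ℝ × (Idx ι → ℝ))} (hS : IsCompact S) :
    ∃ N : ℝ≥0, ∀ (f : Nil ι → ℝ≥0∞), Measurable f → ∀ x : Nil ι,
      ∫⁻ p in S, f (F.phi x p) ≤ N * ∫⁻ y, f y ∂haar ι := by
  have hB : IsCompact ({g : Grp ι | g ∈ (Set.Icc (0 : ℝ) 1 ×ˢ Set.univ.pi fun _ =>
      Set.Icc (0 : ℝ) 1 : Set (ℝ × (Idx ι → ℝ)))}) := by
    have : IsCompact (Set.Icc (0 : ℝ) 1 ×ˢ Set.univ.pi fun _ => Set.Icc (0 : ℝ) 1 :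
      Set (ℝ × (Idx ι → ℝ))) := isCompact_Icc.prod (isCompact_univ_pi fun _ => isCompact_Icc)
    exact this
  have hK := (hB.prod hS).image (f := fun q : Grp ι × (ℝ × (Idx ι → ℝ)) => q.1 * F.chart q.2)
    (continuous_fst.mul (F.continuous_chart.comp continuous_snd))
  obtain ⟨N, hN⟩ := exists_setLIntegral_mk_le hK
  refine ⟨N, fun f hf x => ?_⟩
  rw [← Nil.mk_rep x, hF.setLIntegral_phi]
  refine (lintegral_mono_set ?_).trans (hN f hf)
  rintro _ ⟨p, hp, rfl⟩
  refine ⟨(x.rep, p), ⟨?_, hp⟩, rfl⟩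
  obtain ⟨g, rfl⟩ := Nil.mk_surjective x
  obtain ⟨h1, h2⟩ := mem_box.1 (redG_mem_box g)
  exact ⟨Set.Ico_subset_Icc_self h1, fun j _ => Set.Ico_subset_Icc_self (h2 j)⟩

end AdaptedBasis

/-! ### Smooth functions on `M` -/

instance : CompactSpace (Nil ι) := by
  have hB : IsCompact ({g : Grp ι | g ∈ (Set.Icc (0 : ℝ) 1 ×ˢ Set.univ.pi fun _ =>
      Set.Icc (0 : ℝ) 1 : Set (ℝ × (Idx ι → ℝ)))}) := by
    have : IsCompact (Set.Icc (0 : ℝ) 1 ×ˢ Set.univ.pi fun _ => Set.Icc (0 : ℝ) 1 :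
      Set (ℝ × (Idx ι → ℝ))) := isCompact_Icc.prod (isCompact_univ_pi fun _ => isCompact_Icc)
    exact this
  refine ⟨(hB.image Nil.continuous_mk).of_isClosed_subset isClosed_univ fun x _ => ?_⟩
  refine ⟨x.rep, ?_, x.mk_rep⟩
  obtain ⟨g, rfl⟩ := Nil.mk_surjective x
  obtain ⟨h1, h2⟩ := mem_box.1 (redG_mem_box g)
  exact ⟨Set.Ico_subset_Icc_self h1, fun j _ => Set.Ico_subset_Icc_self (h2 j)⟩

theorem exists_bound_of_continuous {f : Nil ι → ℂ} (hf : Continuous f) : ∃ C, ∀ x, ‖f x‖ ≤ C := by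
  obtain ⟨C, hC⟩ := isCompact_univ.exists_bound_of_continuousOn hf.continuousOn
  exact ⟨C, fun x => hC x (Set.mem_univ x)⟩

/-- The lift of a function on `M` to the coordinates of `G`. -/
def lift (f : Nil ι → ℂ) (p : ℝ × (Idx ι → ℝ)) : ℂ := f (Nil.mk (Grp.of p.1 p.2))

theorem smooth_iff {f : Nil ι → ℂ} : Smooth f ↔ ContDiff ℝ ∞ (lift f) := Iff.rfl

namespace Smooth

variable {f g : Nil ι → ℂ}

theorem continuous (hf : Smooth f) : Continuous f :=
  Nil.continuous_iff.2 (ContDiff.continuous hf)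

theorem measurable (hf : Smooth f) : Measurable f := Nil.measurable_of_continuous hf.continuous

theorem memLp (hf : Smooth f) (p : ℝ≥0∞) : MemLp f p (haar ι) := by
  obtain ⟨C, hC⟩ := exists_bound_of_continuous hf.continuous
  exact MemLp.of_bound hf.measurable.aestronglyMeasurable C (Eventually.of_forall hC)

theorem integrable (hf : Smooth f) : Integrable f (haar ι) := memLp_one_iff_integrable.1 (hf.memLp 1)

protected theorem add (hf : Smooth f) (hg : Smooth g) : Smooth fun x => f x + g x :=
  ContDiff.add hf hg

protected theorem sub (hf : Smooth f) (hg : Smooth g) : Smooth fun x => f x - g x :=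
  ContDiff.sub hf hg

protected theorem neg (hf : Smooth f) : Smooth fun x => - f x :=
  ContDiff.neg hf

protected theorem mul (hf : Smooth f) (hg : Smooth g) : Smooth fun x => f x * g x :=
  ContDiff.mul hf hg

protected theorem const (c : ℂ) : Smooth fun _ : Nil ι => c := contDiff_const

protected theorem conj (hf : Smooth f) : Smooth fun x => (starRingEnd ℂ) (f x) :=
  Complex.conjCLE.contDiff.comp hf

protected theorem sum {κ : Type*} {s : Finset κ} {f : κ → Nil ι → ℂ}
    (hf : ∀ k ∈ s, Smooth (f k)) : Smooth fun x => ∑ k ∈ s, f k x :=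
  ContDiff.sum hf

/-- In the global coordinates the left-invariant field of Z is (Z.1, h(t) Z.2). Its smooth
dependence on t gives the smoothness of Zf. -/
theorem hasDerivAt_zero (hf : Smooth f) (Z : LieAlg ι) (g : Grp ι) :
    HasDerivAt (fun r : ℝ => f ((Nil.mk g).act (expG (r • Z))))
      (fderiv ℝ (lift f) (g.1, g.2) (Z.1, (twist ι g.1).mulVec Z.2)) 0 := by
  have h1 : HasDerivAt (fun r : ℝ => (g.1 + r * Z.1, g.2 + (twist ι g.1).mulVec (expVec Z r)))
      (Z.1, (twist ι g.1).mulVec Z.2) 0 := by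
    refine HasDerivAt.prodMk ?_ ?_
    · simpa using ((hasDerivAt_id (0 : ℝ)).mul_const Z.1).const_add g.1
    · have h2 := hasDerivAt_expVec Z 0
      rw [zero_mul, twist_zero, Matrix.one_mulVec] at h2
      have h3 := ((Matrix.mulVecLin (twist ι g.1)).toContinuousLinearMap.hasFDerivAt
        (x := expVec Z 0)).comp_hasDerivAt (0 : ℝ) h2
      exact h3.const_add g.2
  have h2 : HasFDerivAt (lift f) (fderiv ℝ (lift f) (g.1, g.2))
      (g.1 + 0 * Z.1, g.2 + (twist ι g.1).mulVec (expVec Z 0)) := by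
    rw [zero_mul, expVec_zero, Matrix.mulVec_zero, add_zero, add_zero]
    exact ((smooth_iff.1 hf).differentiable (by simp) _).hasFDerivAt
  have h3 := h2.comp_hasDerivAt (0 : ℝ) h1
  have h4 : (fun r : ℝ => f ((Nil.mk g).act (expG (r • Z)))) = lift f ∘
      fun r : ℝ => (g.1 + r * Z.1, g.2 + (twist ι g.1).mulVec (expVec Z r)) := by
    funext r
    rw [Nil.act_mk, expG_smul]
    rfl
  rw [h4]
  exact h3

theorem lieD_mk (hf : Smooth f) (Z : LieAlg ι) (g : Grp ι) : lieD Z f (Nil.mk g)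
    = fderiv ℝ (lift f) (g.1, g.2) (Z.1, (twist ι g.1).mulVec Z.2) :=
  (hf.hasDerivAt_zero Z g).deriv

theorem hasDerivAt_zero' (hf : Smooth f) (Z : LieAlg ι) (x : Nil ι) :
    HasDerivAt (fun r : ℝ => f (x.act (expG (r • Z)))) (lieD Z f x) 0 := by
  obtain ⟨g, rfl⟩ := Nil.mk_surjective x
  rw [hf.lieD_mk]
  exact hf.hasDerivAt_zero Z g

theorem hasDerivAt (hf : Smooth f) (Z : LieAlg ι) (x : Nil ι) (r : ℝ) :
    HasDerivAt (fun r : ℝ => f (x.act (expG (r • Z)))) (lieD Z f (x.act (expG (r • Z)))) r := by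
  have h1 := hf.hasDerivAt_zero' Z (x.act (expG (r • Z)))
  rw [← sub_self r] at h1
  have h2 := h1.comp_sub_const r r
  simp only [← Nil.act_mul, ← expG_add_smul, add_sub_cancel] at h2
  exact h2

protected theorem lieD (hf : Smooth f) (Z : LieAlg ι) : Smooth (lieD Z f) := by
  have h : lift (lieD Z f) = fun p : ℝ × (Idx ι → ℝ) =>
      fderiv ℝ (lift f) p (Z.1, (twist ι p.1).mulVec Z.2) := by
    funext p
    exact hf.lieD_mk Z (Grp.of p.1 p.2)
  rw [smooth_iff, h]
  refine ContDiff.clm_apply ((smooth_iff.1 hf).fderiv_right (by simp)) ?_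
  refine contDiff_const.prodMk ?_
  rw [contDiff_pi]
  intro j
  simp only [Matrix.mulVec, dotProduct]
  exact ContDiff.sum fun k _ => ((contDiff_twist_apply j k).comp contDiff_fst).mul contDiff_const

theorem lieD_add (hf : Smooth f) (hg : Smooth g) (Z : LieAlg ι) (x : Nil ι) :
    QuasiAbelian.lieD Z (fun x => f x + g x) x = lieD Z f x + lieD Z g x :=
  ((hf.hasDerivAt_zero' Z x).add (hg.hasDerivAt_zero' Z x)).deriv

theorem lieD_mul (hf : Smooth f) (hg : Smooth g) (Z : LieAlg ι) (x : Nil ι) :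
    QuasiAbelian.lieD Z (fun x => f x * g x) x = lieD Z f x * g x + f x * lieD Z g x := by
  have := ((hf.hasDerivAt_zero' Z x).mul (hg.hasDerivAt_zero' Z x)).deriv
  rw [expG_zero_smul, Nil.act_one] at this
  exact this

theorem lieD_const_mul (hf : Smooth f) (c : ℂ) (Z : LieAlg ι) (x : Nil ι) :
    QuasiAbelian.lieD Z (fun x => c * f x) x = c * lieD Z f x :=
  ((hf.hasDerivAt_zero' Z x).const_mul c).deriv

theorem lieD_conj (hf : Smooth f) (Z : LieAlg ι) (x : Nil ι) :
    QuasiAbelian.lieD Z (fun x => (starRingEnd ℂ) (f x)) x = (starRingEnd ℂ) (lieD Z f x) := by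
  have := (Complex.conjCLE.toContinuousLinearMap.hasFDerivAt.comp_hasDerivAt (0 : ℝ)
    (hf.hasDerivAt_zero' Z x)).deriv
  exact this

theorem lieD_sum_smul {κ : Type*} (s : Finset κ) (hf : Smooth f) (c : κ → ℝ) (Z : κ → LieAlg ι)
    (x : Nil ι) :
    QuasiAbelian.lieD (∑ k ∈ s, c k • Z k) f x = ∑ k ∈ s, (c k : ℂ) * QuasiAbelian.lieD (Z k) f x := by
  obtain ⟨g, rfl⟩ := Nil.mk_surjective x
  simp only [hf.lieD_mk]
  have : ((∑ k ∈ s, c k • Z k).1, (twist ι g.1).mulVec (∑ k ∈ s, c k • Z k).2)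
      = ∑ k ∈ s, c k • ((Z k).1, (twist ι g.1).mulVec (Z k).2) := by
    refine Prod.ext ?_ ?_
    · simp [Prod.fst_sum]
    · simp only [Prod.snd_sum, Prod.smul_snd, Matrix.mulVec_sum, Matrix.mulVec_smul]
  rw [this, map_sum]
  exact Finset.sum_congr rfl fun k _ => by rw [map_smul, Complex.real_smul]

protected theorem act (hf : Smooth f) (k : Grp ι) : Smooth fun x => f (x.act k) := by
  have h : lift (fun x : Nil ι => f (x.act k)) = lift f ∘ fun p : ℝ × (Idx ι → ℝ) =>
      (p.1 + k.1, p.2 + (twist ι p.1).mulVec k.2) := rfl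
  rw [smooth_iff, h]
  refine ContDiff.comp hf ?_
  refine (contDiff_fst.add contDiff_const).prodMk (contDiff_snd.add ?_)
  rw [contDiff_pi]
  intro j
  simp only [Matrix.mulVec, dotProduct]
  exact ContDiff.sum fun k _ => ((contDiff_twist_apply j k).comp contDiff_fst).mul contDiff_const

end Smooth

theorem lieD_act (Z : LieAlg ι) (t : ℝ) (f : Nil ι → ℂ) (x : Nil ι) :
    lieD Z (fun x => f (x.act (expG (t • Z)))) x = lieD Z f (x.act (expG (t • Z))) := by
  unfold lieD
  congr 1
  funext r
  change f ((x.act (expG (r • Z))).act (expG (t • Z))) = _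
  rw [← Nil.act_mul, ← Nil.act_mul, ← expG_add_smul, ← expG_add_smul, add_comm]

/-! ### Integration by parts -/

theorem integral_act {E : Type*} [NormedAddCommGroup E] [NormedSpace ℝ E] {f : Nil ι → E}
    (hf : AEStronglyMeasurable f (haar ι)) (k : Grp ι) :
    ∫ x, f (x.act k) ∂haar ι = ∫ x, f x ∂haar ι := by
  have h := measurePreserving_act (ι := ι) k
  rw [← h.map_eq] at hf
  rw [← integral_map h.measurable.aemeasurable hf, h.map_eq]

theorem measurable_act_expG (Z : LieAlg ι) :
    Measurable fun p : Nil ι × ℝ => p.1.act (expG (p.2 • Z)) :=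
  Nil.measurable_act.comp (measurable_fst.prodMk
    ((continuous_expG_smul Z).measurable.comp measurable_snd))

theorem Smooth.act_sub {f : Nil ι → ℂ} (hf : Smooth f) (Z : LieAlg ι) (x : Nil ι) (r : ℝ) :
    f (x.act (expG (r • Z))) - f x = ∫ t in (0 : ℝ)..r, lieD Z f (x.act (expG (t • Z))) := by
  have hc : Continuous fun t : ℝ => lieD Z f (x.act (expG (t • Z))) :=
    (hf.lieD Z).continuous.comp
      ((Nil.continuous_act_right x).comp (continuous_expG_smul Z))
  rw [intervalIntegral.integral_eq_sub_of_hasDerivAt (fun t _ => hf.hasDerivAt Z x t)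
    (hc.intervalIntegrable _ _), expG_zero_smul, Nil.act_one]

/-- The increment f(x exp Z) − f(x) has mean zero by invariance. It is also the integral of Zf along
the flow for unit time, and each time slice contributes the same mean ∫ Zf. -/
theorem Smooth.integral_lieD {f : Nil ι → ℂ} (hf : Smooth f) (Z : LieAlg ι) :
    ∫ x, lieD Z f x ∂haar ι = 0 := by
  obtain ⟨C, hC⟩ := exists_bound_of_continuous (hf.lieD Z).continuous
  have h1 : ∫ x, (f (x.act (expG ((1 : ℝ) • Z))) - f x) ∂haar ι = 0 := by
    rw [integral_sub (hf.act _).integrable hf.integrable,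
      integral_act hf.measurable.aestronglyMeasurable, sub_self]
  have h2 : Integrable (Function.uncurry fun (x : Nil ι) (t : ℝ) =>
      lieD Z f (x.act (expG (t • Z)))) ((haar ι).prod (volume.restrict (Set.Ioc 0 1))) :=
    Integrable.of_bound ((hf.lieD Z).measurable.comp (measurable_act_expG Z)).aestronglyMeasurable
      C (Eventually.of_forall fun p => hC _)
  simp only [hf.act_sub, intervalIntegral.integral_of_le zero_le_one] at h1
  rw [integral_integral_swap h2] at h1
  simp only [integral_act (hf.lieD Z).measurable.aestronglyMeasurable] at h1
  simpa using h1

theorem Smooth.integral_lieD_mul {f g : Nil ι → ℂ} (hf : Smooth f) (hg : Smooth g)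
    (Z : LieAlg ι) :
    ∫ x, lieD Z f x * g x ∂haar ι = -∫ x, f x * lieD Z g x ∂haar ι := by
  have h := (hf.mul hg).integral_lieD Z
  simp only [hf.lieD_mul hg] at h
  rw [integral_add ((hf.lieD Z).mul hg).integrable (hf.mul (hg.lieD Z)).integrable] at h
  exact eq_neg_of_add_eq_zero_left h

/-! ### Waves: functions with a single frequency along the fibres of `M → ℤ \ ℝ` -/

/-- A smooth function on `ℝ` that is supported inside `(0, 1)`. -/
def IsCoeff (c : ℝ → ℂ) : Prop :=
  ContDiff ℝ ∞ c ∧ ∃ ε > 0, ∀ t, (t < ε ∨ 1 - ε < t) → c t = 0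

theorem IsCoeff.mul {c : ℝ → ℂ} (hc : IsCoeff c) {d : ℝ → ℂ} (hd : ContDiff ℝ ∞ d) :
    IsCoeff fun t => c t * d t := by
  obtain ⟨h1, ε, hε, h2⟩ := hc
  exact ⟨h1.mul hd, ε, hε, fun t ht => by simp only [h2 t ht, zero_mul]⟩

/-- The angle `2π m · v`. -/
def ang (m : Idx ι → ℤ) (v : Idx ι → ℝ) : ℝ := 2 * Real.pi * ∑ j, m j * v j

theorem ang_add (m : Idx ι → ℤ) (v w : Idx ι → ℝ) : ang m (v + w) = ang m v + ang m w := by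
  simp only [ang, Pi.add_apply, mul_add, Finset.sum_add_distrib]

theorem ang_smul (m : Idx ι → ℤ) (r : ℝ) (v : Idx ι → ℝ) : ang m (r • v) = r * ang m v := by
  simp only [ang, Pi.smul_apply, smul_eq_mul]
  rw [show ∑ j, (m j : ℝ) * (r * v j) = r * ∑ j, (m j : ℝ) * v j by
    rw [Finset.mul_sum]; exact Finset.sum_congr rfl fun j _ => by ring]
  ring

theorem contDiff_ang (m : Idx ι → ℤ) : ContDiff ℝ ∞ (ang m) := by
  unfold ang
  exact contDiff_const.mul (ContDiff.sum fun j _ => contDiff_const.mul (contDiff_apply ℝ ℝ j))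

theorem contDiff_ang_twist (m : Idx ι → ℤ) (y : Idx ι → ℝ) :
    ContDiff ℝ ∞ fun t : ℝ => ang m ((twist ι t).mulVec y) := by
  refine (contDiff_ang m).comp ?_
  rw [contDiff_pi]
  intro j
  simp only [Matrix.mulVec, dotProduct]
  exact ContDiff.sum fun k _ => (contDiff_twist_apply j k).mul contDiff_const

theorem exp_ang_fract (m : Idx ι → ℤ) (v : Idx ι → ℝ) :
    Complex.exp (ang m (fun j => Int.fract (v j)) * Complex.I)
      = Complex.exp (ang m v * Complex.I) := by
  rw [Complex.exp_eq_exp_iff_exists_int]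
  refine ⟨-∑ j, m j * ⌊v j⌋, ?_⟩
  have : ang m (fun j => Int.fract (v j)) = ang m v + (-∑ j, m j * ⌊v j⌋ : ℤ) * (2 * Real.pi) := by
    simp only [ang, Int.fract, mul_sub, Finset.sum_sub_distrib]
    push_cast
    ring
  rw [this]
  push_cast
  ring

/-- The function on `M` with coefficient `c` and frequency `m`. -/
def wave (m : Idx ι → ℤ) (c : ℝ → ℂ) (x : Nil ι) : ℂ :=
  c x.rep.1 * Complex.exp (ang m x.rep.2 * Complex.I)

theorem wave_mk (m : Idx ι → ℤ) (c : ℝ → ℂ) (g : Grp ι) :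
    wave m c (Nil.mk g) = c (Int.fract g.1)
      * Complex.exp (ang m ((twist ι (-(⌊g.1⌋ : ℝ))).mulVec g.2) * Complex.I) := by
  rw [wave, Nil.rep_mk, redG, Grp.of_fst, Grp.of_snd, exp_ang_fract]

/-- The formula for a wave jumps only where the floor of the base coordinate does, and there the
coefficient vanishes on both sides. -/
theorem IsCoeff.smooth_wave {c : ℝ → ℂ} (hc : IsCoeff c) (m : Idx ι → ℤ) : Smooth (wave m c) := by
  obtain ⟨h1, ε, hε, h2⟩ := hc
  rw [smooth_iff, contDiff_iff_contDiffAt]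
  intro p₀
  set k : ℤ := ⌊p₀.1⌋ with hk
  have h3 : ContDiff ℝ ∞ fun p : ℝ × (Idx ι → ℝ) => c (p.1 - k)
      * Complex.exp (ang m ((twist ι (-(k : ℝ))).mulVec p.2) * Complex.I) := by
    refine (h1.comp (contDiff_fst.sub contDiff_const)).mul (Complex.contDiff_exp.comp
      (ContDiff.mul (Complex.ofRealCLM.contDiff.comp ((contDiff_ang m).comp ?_)) contDiff_const))
    exact (Matrix.mulVecLin (twist ι (-(k : ℝ)))).toContinuousLinearMap.contDiff.comp contDiff_snd
  refine h3.contDiffAt.congr_of_eventuallyEq ?_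
  -- Reaching back by min ε 1 keeps the floor equal to k or k − 1. In the second case the wave and
  -- its candidate smooth extension are both zero.
  have hU : {p : ℝ × (Idx ι → ℝ) | p.1 ∈ Set.Ioo (k - min ε 1) ((k : ℝ) + 1)} ∈ 𝓝 p₀ := by
    refine (isOpen_Ioo.preimage continuous_fst).mem_nhds ⟨?_, Int.lt_floor_add_one _⟩
    have : (k : ℝ) ≤ p₀.1 := Int.floor_le _
    have : 0 < min ε 1 := lt_min hε one_pos
    linarith
  filter_upwards [hU] with p hp
  rw [lift, wave_mk, Grp.of_fst, Grp.of_snd]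
  have hp1 := hp.1
  have hp2 := hp.2
  rcases le_or_gt (k : ℝ) p.1 with h | h
  · have hf : ⌊p.1⌋ = k := Int.floor_eq_iff.2 ⟨h, hp.2⟩
    rw [Int.fract, hf]
  · have hε' : (k : ℝ) - ε < p.1 :=
      lt_of_le_of_lt (sub_le_sub_left (min_le_left _ _) _) hp1
    have h1' : (k : ℝ) - 1 < p.1 :=
      lt_of_le_of_lt (sub_le_sub_left (min_le_right _ _) _) hp1
    have hf : ⌊p.1⌋ = k - 1 := Int.floor_eq_iff.2 ⟨by push_cast; linarith, by push_cast; linarith⟩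
    rw [h2 (Int.fract p.1) (Or.inr (by rw [Int.fract, hf]; push_cast; linarith)),
      h2 (p.1 - k) (Or.inl (by linarith)), zero_mul, zero_mul]

/-- Translations along the ideal multiply a wave by a phase that depends only on the base
coordinate. Both Δ_Y and the Gaussian averages are diagonalised by this. -/
theorem wave_act_ideal (m : Idx ι → ℤ) (c : ℝ → ℂ) (y : Idx ι → ℝ) (x : Nil ι) :
    wave m c (x.act (Grp.of 0 y)) = wave m c x
      * Complex.exp (ang m ((twist ι x.rep.1).mulVec y) * Complex.I) := by
  obtain ⟨g, rfl⟩ := Nil.mk_surjective x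
  rw [Nil.act_mk, wave_mk, wave_mk, Nil.rep_mk]
  have h1 : (g * Grp.of 0 y).1 = g.1 := add_zero _
  have h2 : (g * Grp.of 0 y).2 = g.2 + (twist ι g.1).mulVec y := rfl
  have h3 : -(⌊g.1⌋ : ℝ) + g.1 = Int.fract g.1 := by rw [Int.fract]; ring
  rw [h1, h2, Matrix.mulVec_add, twist_mulVec_mulVec, ang_add, h3, redG, Grp.of_fst]
  push_cast
  rw [add_mul, Complex.exp_add, mul_assoc]

theorem wave_mul (m : Idx ι → ℤ) (c d : ℝ → ℂ) (x : Nil ι) :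
    wave m c x * d x.rep.1 = wave m (fun t => c t * d t) x := by
  simp only [wave]; ring

theorem lieD_wave (m : Idx ι → ℤ) (c : ℝ → ℂ) {Z : LieAlg ι} (hZ : Z.1 = 0) (x : Nil ι) :
    lieD Z (wave m c) x
      = wave m (fun t => c t * (ang m ((twist ι t).mulVec Z.2) * Complex.I)) x := by
  have h : ∀ r : ℝ, wave m c (x.act (expG (r • Z))) = wave m c x
      * Complex.exp ((r : ℂ) * (ang m ((twist ι x.rep.1).mulVec Z.2) * Complex.I)) := by
    intro r
    have h1 : (r • Z).1 = 0 := by rw [Prod.smul_fst, hZ, smul_zero]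
    rw [expG_ideal h1, wave_act_ideal, Prod.smul_snd, Matrix.mulVec_smul, ang_smul]
    push_cast
    rw [mul_assoc]
  unfold lieD
  simp only [h]
  rw [← wave_mul m c (fun t => ang m ((twist ι t).mulVec Z.2) * Complex.I)]
  have h2 : HasDerivAt (fun r : ℝ => (r : ℂ) * (ang m ((twist ι x.rep.1).mulVec Z.2) * Complex.I))
      (1 * (ang m ((twist ι x.rep.1).mulVec Z.2) * Complex.I)) 0 :=
    (Complex.ofRealCLM.hasDerivAt (x := (0 : ℝ))).mul_const _
  have h3 := (h2.cexp.const_mul (wave m c x)).deriv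
  rw [h3]
  simp

/-! ### Density of the waves -/

attribute [local instance] instMeasureSpaceUnitAddCircle in
/-- A square-integrable function on a unit cube with vanishing Fourier coefficients vanishes. -/
theorem ae_eq_zero_of_fourier {d : Type*} [Fintype d] {H : (d → ℝ) → ℂ}
    (hH : MemLp H 2 (volume.restrict (Set.univ.pi fun _ => Set.Ico (0 : ℝ) 1)))
    (h0 : ∀ m : d → ℤ, ∫ x in Set.univ.pi fun _ => Set.Ico (0 : ℝ) 1,
      Complex.exp (-(2 * Real.pi * ∑ j, m j * x j : ℝ) * Complex.I) * H x = 0) :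
    H =ᵐ[volume.restrict (Set.univ.pi fun _ => Set.Ico (0 : ℝ) 1)] 0 := by
  set C : Set (d → ℝ) := {x | ∀ i, x i ∈ Set.Ioc ((0 : d → ℝ) i) ((0 : d → ℝ) i + 1)} with hC
  have hCm : MeasurableSet C := MeasurableSet.univ_pi' fun i => measurableSet_Ioc
  have hCpi : C = Set.univ.pi fun _ => Set.Ioc (0 : ℝ) 1 := by
    ext x
    simp [hC]
  -- The torus is parametrised by (0,1]^d and the fundamental domain is built on [0,1)^d; the two
  -- cubes differ by a null set.
  have hres : (volume : Measure (d → ℝ)).restrict (Set.univ.pi fun _ => Set.Ico (0 : ℝ) 1)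
      = volume.restrict C := by
    rw [hCpi]
    exact Measure.restrict_congr_set (Measure.univ_pi_Ico_ae_eq_Icc.trans
      Measure.univ_pi_Ioc_ae_eq_Icc.symm)
  rw [hres] at hH h0 ⊢
  set P : UnitAddTorus d → (d → ℝ) := fun θ => (UnitAddTorus.measurableEquivPiIoc 0 θ).1 with hP
  have hPm : MeasurePreserving P volume (volume.restrict C) := by
    have h1 : MeasurePreserving (Subtype.val : C → d → ℝ) (Measure.comap Subtype.val volume)
        (volume.restrict C) := ⟨measurable_subtype_coe, map_comap_subtype_coe hCm _⟩
    exact h1.comp (UnitAddTorus.measurePreserving_equivPiIoc 0)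
  have hPc : ∀ x ∈ C, P (fun i => (x i : UnitAddCircle)) = x := by
    intro x hx
    have := (UnitAddTorus.measurableEquivPiIoc (0 : d → ℝ)).apply_symm_apply ⟨x, hx⟩
    rw [UnitAddTorus.coe_symm_measurableEquivPiIoc_apply] at this
    exact congrArg Subtype.val this
  have hf : MemLp (H ∘ P) 2 volume := hH.comp_measurePreserving hPm
  have hcoef : ∀ m : d → ℤ, UnitAddTorus.mFourierCoeff (hf.toLp (H ∘ P)) m = 0 := by
    intro m
    have h1 : UnitAddTorus.mFourierCoeff (hf.toLp (H ∘ P)) m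
        = UnitAddTorus.mFourierCoeff (H ∘ P) m := by
      refine integral_congr_ae ?_
      filter_upwards [hf.coeFn_toLp] with θ hθ
      rw [hθ]
    rw [h1, UnitAddTorus.mFourierCoeff_eq_integral _ _ 0, ← h0 m]
    refine setIntegral_congr_fun hCm fun x hx => ?_
    simp only [Function.comp_apply, hPc x hx, smul_eq_mul]
    congr 1
    simp only [UnitAddTorus.mFourier, ContinuousMap.coe_mk, fourier_coe_apply, Pi.neg_apply]
    rw [← Complex.exp_sum]
    congr 1
    push_cast
    rw [Finset.mul_sum, ← Finset.sum_neg_distrib, Finset.sum_mul]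
    exact Finset.sum_congr rfl fun j _ => by ring
  have hzero : hf.toLp (H ∘ P) = 0 := by
    have := UnitAddTorus.hasSum_mFourier_series_L2 (hf.toLp (H ∘ P))
    simp only [hcoef, zero_smul] at this
    exact this.unique hasSum_zero
  have h2 : eLpNorm (H ∘ P) 2 volume = 0 := by
    rw [eLpNorm_eq_zero_iff hf.1 (by simp)]
    exact hf.coeFn_toLp.symm.trans ((Lp.ext_iff.1 hzero).trans (Lp.coeFn_zero _ _ _))
  rw [eLpNorm_comp_measurePreserving hH.1 hPm, eLpNorm_eq_zero_iff hH.1 (by simp)] at h2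
  exact h2

/-- The map `ℝ × ℝ^a → M` in terms of a single vector of coordinates. -/
def cubeMap (x : Unit ⊕ Idx ι → ℝ) : Nil ι :=
  Nil.mk (Grp.of (x (Sum.inl ())) fun j => x (Sum.inr j))

theorem measurePreserving_cubeMap : MeasurePreserving (cubeMap (ι := ι))
    (volume.restrict (Set.univ.pi fun _ => Set.Ico (0 : ℝ) 1)) (haar ι) := by
  have h1 : MeasurePreserving (fun x : Unit ⊕ Idx ι → ℝ =>
      ((x (Sum.inl ()), fun j => x (Sum.inr j)) : ℝ × (Idx ι → ℝ))) volume volume := by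
    have h2 := volume_measurePreserving_sumPiEquivProdPi fun _ : Unit ⊕ Idx ι => ℝ
    have h3 := (volume_preserving_funUnique Unit ℝ).prod
      (MeasurePreserving.id (volume : Measure (Idx ι → ℝ)))
    exact h3.comp h2
  have hb : MeasurableSet (Set.Ico (0 : ℝ) 1 ×ˢ Set.univ.pi fun _ => Set.Ico (0 : ℝ) 1 :
    Set (ℝ × (Idx ι → ℝ))) :=
    measurableSet_Ico.prod (MeasurableSet.univ_pi fun _ => measurableSet_Ico)
  have h4 := h1.restrict_preimage hb
  have h5 : (fun x : Unit ⊕ Idx ι → ℝ =>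
      ((x (Sum.inl ()), fun j => x (Sum.inr j)) : ℝ × (Idx ι → ℝ))) ⁻¹'
        (Set.Ico (0 : ℝ) 1 ×ˢ Set.univ.pi fun _ => Set.Ico (0 : ℝ) 1)
      = Set.univ.pi fun _ => Set.Ico (0 : ℝ) 1 := by
    ext x
    simp only [Set.mem_preimage, Set.mem_prod, Set.mem_univ_pi]
    exact ⟨fun h j => j.rec (fun _ => h.1) h.2, fun h => ⟨h _, fun j => h _⟩⟩
  rw [h5] at h4
  have h6 : MeasurePreserving (fun p : ℝ × (Idx ι → ℝ) => Nil.mk (Grp.of p.1 p.2))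
      (volume.restrict (Set.Ico (0 : ℝ) 1 ×ˢ Set.univ.pi fun _ => Set.Ico (0 : ℝ) 1))
      (haar ι) := ⟨Nil.measurable_mk, rfl⟩
  exact h6.comp h4

theorem wave_cubeMap (m : Idx ι → ℤ) (c : ℝ → ℂ) {x : Unit ⊕ Idx ι → ℝ}
    (hx : x ∈ Set.univ.pi fun _ => Set.Ico (0 : ℝ) 1) :
    wave m c (cubeMap x) = c (x (Sum.inl ()))
      * Complex.exp (ang m (fun j => x (Sum.inr j)) * Complex.I) := by
  have : (Grp.of (x (Sum.inl ())) fun j => x (Sum.inr j)) ∈ box ι :=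
    mem_box.2 ⟨hx _ trivial, fun j => hx _ trivial⟩
  rw [wave, cubeMap, Nil.rep_mk_of_mem_box this]
  rfl

/-- A smooth function that is positive exactly on `(ε, 1 - ε)`. -/
def bump (ε t : ℝ) : ℝ := expNegInvGlue (t - ε) * expNegInvGlue (1 - ε - t)

theorem contDiff_bump (ε : ℝ) : ContDiff ℝ ∞ (bump ε) :=
  (expNegInvGlue.contDiff.comp (contDiff_id.sub contDiff_const)).mul
    (expNegInvGlue.contDiff.comp (contDiff_const.sub contDiff_id))

theorem isCoeff_bump {ε : ℝ} (hε : 0 < ε) : IsCoeff fun t => (bump ε t : ℂ) := by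
  refine ⟨Complex.ofRealCLM.contDiff.comp (contDiff_bump ε), ε, hε, fun t ht => ?_⟩
  simp only [bump]
  rcases ht with h | h
  · rw [expNegInvGlue.zero_of_nonpos (by linarith), zero_mul, Complex.ofReal_zero]
  · rw [expNegInvGlue.zero_of_nonpos (x := 1 - ε - t) (by linarith), mul_zero,
      Complex.ofReal_zero]

theorem bump_pos {ε t : ℝ} (h1 : ε < t) (h2 : t < 1 - ε) : 0 < bump ε t :=
  mul_pos (expNegInvGlue.pos_of_pos (by linarith)) (expNegInvGlue.pos_of_pos (by linarith))

/-- A bump times a character of the base variable is an allowed coefficient. Orthogonality to all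
such waves makes every Fourier coefficient of bump · h on the (a+1)-dimensional cube vanish, so h
vanishes where the bump is positive; then ε runs through 1/(k+1). -/
theorem ae_eq_zero_of_wave {h : Nil ι → ℂ} (hh : MemLp h 2 (haar ι))
    (h0 : ∀ m c, IsCoeff c → ∫ x, (starRingEnd ℂ) (wave m c x) * h x ∂haar ι = 0) :
    h =ᵐ[haar ι] 0 := by
  have hΘ := measurePreserving_cubeMap (ι := ι)
  set C : Set (Unit ⊕ Idx ι → ℝ) := Set.univ.pi fun _ => Set.Ico (0 : ℝ) 1 with hC
  have hCm : MeasurableSet C := MeasurableSet.univ_pi fun i => measurableSet_Ico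
  have hhC : MemLp (h ∘ cubeMap) 2 (volume.restrict C) := hh.comp_measurePreserving hΘ
  have key : ∀ ε : ℝ, 0 < ε → ∀ᵐ x ∂volume.restrict C,
      (bump ε (x (Sum.inl ())) : ℂ) * h (cubeMap x) = 0 := by
    intro ε hε
    refine ae_eq_zero_of_fourier (H := fun x => (bump ε (x (Sum.inl ())) : ℂ) * h (cubeMap x))
      ?_ fun m => ?_
    · have hb : Continuous fun x : Unit ⊕ Idx ι → ℝ => (bump ε (x (Sum.inl ())) : ℂ) :=
        Complex.continuous_ofReal.comp ((contDiff_bump ε).continuous.comp (continuous_apply _))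
      obtain ⟨K, hK⟩ := (isCompact_Icc (a := (0 : ℝ)) (b := 1)).exists_bound_of_continuousOn
        (contDiff_bump ε).continuous.continuousOn
      refine (hhC.const_mul (K : ℂ)).mono (hb.aestronglyMeasurable.mul hhC.1) ?_
      filter_upwards [ae_restrict_mem hCm] with x hx
      have h1 := hK (x (Sum.inl ())) (Set.Ico_subset_Icc_self (hx _ trivial))
      have h2 : 0 ≤ K := (norm_nonneg _).trans h1
      simp only [norm_mul, Function.comp_apply, Complex.norm_real]
      exact mul_le_mul_of_nonneg_right (h1.trans (le_abs_self K)) (norm_nonneg _)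
    · have hc : IsCoeff fun t => (bump ε t : ℂ)
          * Complex.exp ((2 * Real.pi * (m (Sum.inl ()) * t) : ℝ) * Complex.I) := by
        refine (isCoeff_bump hε).mul ?_
        exact Complex.contDiff_exp.comp (ContDiff.mul (Complex.ofRealCLM.contDiff.comp
          (contDiff_const.mul (contDiff_const.mul contDiff_id))) contDiff_const)
      have h1 := h0 (fun j => m (Sum.inr j)) _ hc
      have hsm := hc.smooth_wave fun j => m (Sum.inr j)
      rw [← hΘ.map_eq, integral_map hΘ.measurable.aemeasurable] at h1
      · rw [← h1]
        refine setIntegral_congr_fun hCm fun x hx => ?_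
        simp only [wave_cubeMap _ _ hx, map_mul, Complex.conj_ofReal, ← Complex.exp_conj,
          Complex.conj_I]
        rw [mul_assoc (bump ε (x (Sum.inl ())) : ℂ), ← Complex.exp_add, ← mul_assoc,
          mul_comm (Complex.exp _)]
        congr 3
        simp only [ang, Fintype.sum_sum_type, Finset.univ_unique, Finset.sum_singleton]
        push_cast
        rw [mul_add]
        simp only [PUnit.default_eq_unit]
        ring
      · rw [hΘ.map_eq]
        exact hsm.conj.measurable.aestronglyMeasurable.mul hh.1
  have hne : ∀ᵐ x ∂volume.restrict C, x (Sum.inl ()) ≠ 0 := by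
    refine ae_restrict_of_ae ?_
    have := Measure.pi_hyperplane (fun _ : Unit ⊕ Idx ι => (volume : Measure ℝ)) (Sum.inl ()) 0
    rw [ae_iff]
    simp only [not_not]
    exact this
  have h3 : h ∘ cubeMap =ᵐ[volume.restrict C] 0 := by
    have hall := ae_all_iff.2 fun k : ℕ => key (1 / ((k : ℝ) + 1)) (by positivity)
    filter_upwards [hall, hne, ae_restrict_mem hCm] with x hx hx0 hxC
    have ht := hxC (Sum.inl ()) trivial
    have hpos : 0 < min (x (Sum.inl ())) (1 - x (Sum.inl ())) :=
      lt_min (lt_of_le_of_ne ht.1 (Ne.symm hx0)) (sub_pos.2 ht.2)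
    obtain ⟨k, hk⟩ := exists_nat_one_div_lt hpos
    have hb := bump_pos (hk.trans_le (min_le_left _ _))
      (by linarith [hk.trans_le (min_le_right _ _)] :
        x (Sum.inl ()) < 1 - 1 / ((k : ℝ) + 1))
    have h4 := hx k
    rw [mul_eq_zero] at h4
    exact h4.resolve_left (by exact_mod_cast hb.ne')
  have h5 : eLpNorm (h ∘ cubeMap) 2 (volume.restrict C) = 0 :=
    (eLpNorm_eq_zero_iff hhC.1 (by simp)).2 h3
  rw [eLpNorm_comp_measurePreserving hh.1 hΘ, eLpNorm_eq_zero_iff hh.1 (by simp)] at h5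
  exact h5

/-- The class in `L²(M)` of a smooth function. -/
def Smooth.toL2 {f : Nil ι → ℂ} (hf : Smooth f) : L2 ι := (hf.memLp 2).toLp f

theorem Smooth.coeFn_toL2 {f : Nil ι → ℂ} (hf : Smooth f) : hf.toL2 =ᵐ[haar ι] f :=
  (hf.memLp 2).coeFn_toLp

variable (ι) in
/-- The waves as elements of `L²(M)`. -/
def waveSet : Set (L2 ι) := {g | ∃ m c, ∃ hc : IsCoeff c, g = (hc.smooth_wave m).toL2}

theorem inner_toL2 {f : Nil ι → ℂ} (hf : Smooth f) (g : L2 ι) :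
    inner ℂ hf.toL2 g = ∫ x, (starRingEnd ℂ) (f x) * g x ∂haar ι := by
  rw [MeasureTheory.L2.inner_def]
  refine integral_congr_ae ?_
  filter_upwards [hf.coeFn_toL2] with x hx
  rw [RCLike.inner_apply, hx, mul_comm]

theorem dense_span_waveSet : (Submodule.span ℂ (waveSet ι)).topologicalClosure = ⊤ := by
  rw [Submodule.topologicalClosure_eq_top_iff, Submodule.eq_bot_iff]
  intro h hh
  rw [Lp.eq_zero_iff_ae_eq_zero]
  refine ae_eq_zero_of_wave (Lp.memLp h) fun m c hc => ?_
  rw [← inner_toL2 (hc.smooth_wave m) h]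
  exact hh _ (Submodule.subset_span ⟨m, c, hc, rfl⟩)

/-- Induction principle for closed subspaces of `L²(M)`. -/
theorem mem_of_wave (K : Submodule ℂ (L2 ι)) (hK : IsClosed (K : Set (L2 ι)))
    (h : waveSet ι ⊆ K) (g : L2 ι) : g ∈ K := by
  have h1 : (Submodule.span ℂ (waveSet ι)).topologicalClosure ≤ K :=
    Submodule.topologicalClosure_minimal _ (Submodule.span_le.2 h) hK
  rw [dense_span_waveSet] at h1
  exact h1 trivial

/-! ### The operator `I + Δ_Y` and its inverse -/

variable (ι) in
/-- The space `C^∞(M)`. -/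
def smoothSub : Submodule ℂ (Nil ι → ℂ) where
  carrier := {f | Smooth f}
  add_mem' hf hg := hf.add hg
  zero_mem' := Smooth.const 0
  smul_mem' c _ hf := (Smooth.const c).mul hf

theorem toL2_eq_iff {f : Nil ι → ℂ} (hf : Smooth f) {g : L2 ι} :
    g = hf.toL2 ↔ g =ᵐ[haar ι] f :=
  ⟨fun h => h ▸ hf.coeFn_toL2, fun h => Lp.ext (h.trans hf.coeFn_toL2.symm)⟩

theorem toL2_congr {f g : Nil ι → ℂ} (hf : Smooth f) (hg : Smooth g) (h : f = g) :
    hf.toL2 = hg.toL2 := by subst h; rfl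

theorem Smooth.toL2_add {f g : Nil ι → ℂ} (hf : Smooth f) (hg : Smooth g) :
    (hf.add hg).toL2 = hf.toL2 + hg.toL2 := rfl

theorem Smooth.toL2_sub {f g : Nil ι → ℂ} (hf : Smooth f) (hg : Smooth g) :
    (hf.sub hg).toL2 = hf.toL2 - hg.toL2 := rfl

theorem Smooth.toL2_const_mul {f : Nil ι → ℂ} (hf : Smooth f) (c : ℂ) :
    ((Smooth.const c).mul hf).toL2 = c • hf.toL2 := rfl

theorem norm_toL2_le {f g : Nil ι → ℂ} (hf : Smooth f) (hg : Smooth g) {C : ℝ}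
    (h : ∀ x, ‖f x‖ ≤ C * ‖g x‖) : ‖hf.toL2‖ ≤ C * ‖hg.toL2‖ := by
  refine Lp.norm_le_mul_norm_of_ae_le_mul ?_
  filter_upwards [hf.coeFn_toL2, hg.coeFn_toL2] with x h1 h2
  rw [h1, h2]
  exact h x

/-! ### Powers of a positive contraction through polynomials. -/

section OpPow

variable {H : Type*} [NormedAddCommGroup H] [InnerProductSpace ℂ H] [CompleteSpace H]

/-- The spectrum lies in [0,1], and the continuous functional calculus is bounded by the supremum
there. -/
theorem norm_opPow_sub_aeval_le {R : H →L[ℂ] H} (hR : 0 ≤ R) (hR1 : ‖R‖ ≤ 1) {s ε : ℝ}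
    (hs : 0 < s) {p : Polynomial ℝ} (hp : ∀ x ∈ Set.Icc (0 : ℝ) 1, |p.eval x - x ^ s| < ε) :
    ‖opPow R s - Polynomial.aeval R p‖ ≤ ε := by
  have hsp : spectrum ℝ R ⊆ Set.Icc 0 1 := by
    intro x hx
    refine ⟨spectrum_nonneg_of_nonneg hR hx, ?_⟩
    have h := spectrum.norm_le_norm_mul_of_mem hx
    have h1 : ‖(1 : H →L[ℂ] H)‖ ≤ 1 := ContinuousLinearMap.norm_id_le
    calc x ≤ ‖x‖ := Real.le_norm_self x
      _ ≤ ‖R‖ * ‖(1 : H →L[ℂ] H)‖ := h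
      _ ≤ 1 * 1 := mul_le_mul hR1 h1 (norm_nonneg _) zero_le_one
      _ = 1 := one_mul 1
  have hcont : ContinuousOn (fun x : ℝ => x ^ s) (spectrum ℝ R) :=
    (Real.continuous_rpow_const hs.le).continuousOn
  have hsa : IsSelfAdjoint R := hR.isSelfAdjoint
  have hε : 0 ≤ ε := (abs_nonneg _).trans (hp 0 (by simp)).le
  have h1 : opPow R s = cfc (fun x : ℝ => x ^ s) R := by
    rw [opPow, CFC.rpow_eq_cfc_real]
  have h2 : Polynomial.aeval R p = cfc (fun x : ℝ => p.eval x) R :=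
    (cfc_polynomial p R hsa).symm
  rw [h1, h2, ← cfc_sub _ _ R hcont (Polynomial.continuous p).continuousOn]
  refine norm_cfc_le hε fun x hx => ?_
  rw [norm_sub_rev]
  exact (hp x (hsp hx)).le

theorem isSelfAdjoint_opPow (R : H →L[ℂ] H) (s : ℝ) : IsSelfAdjoint (opPow R s) :=
  (CFC.rpow_nonneg (a := R) (y := s)).isSelfAdjoint

end OpPow

/-! ### The operator I + Δ_Y on smooth functions, its inverse, and its negative powers on waves. -/

namespace AdaptedBasis

variable (F : AdaptedBasis ι)

/-- The operator `I + Δ_Y`. -/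
def opA (f : Nil ι → ℂ) (x : Nil ι) : ℂ := f x + F.lapY f x

theorem smooth_lapY {f : Nil ι → ℂ} (hf : Smooth f) : Smooth (F.lapY f) :=
  Smooth.neg (Smooth.sum fun j _ => (hf.lieD (F.Y j)).lieD (F.Y j))

theorem smooth_opA {f : Nil ι → ℂ} (hf : Smooth f) : Smooth (F.opA f) :=
  hf.add (F.smooth_lapY hf)

theorem lieD_add_fun {f g : Nil ι → ℂ} (hf : Smooth f) (hg : Smooth g) (Z : LieAlg ι) :
    lieD Z (fun x => f x + g x) = fun x => lieD Z f x + lieD Z g x :=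
  funext fun x => hf.lieD_add hg Z x

theorem lieD_const_mul_fun {f : Nil ι → ℂ} (hf : Smooth f) (c : ℂ) (Z : LieAlg ι) :
    lieD Z (fun x => c * f x) = fun x => c * lieD Z f x :=
  funext fun x => hf.lieD_const_mul c Z x

theorem opA_add {f g : Nil ι → ℂ} (hf : Smooth f) (hg : Smooth g) :
    F.opA (fun x => f x + g x) = fun x => F.opA f x + F.opA g x := by
  funext x
  simp only [opA, lapY, lieD_add_fun hf hg, lieD_add_fun (hf.lieD _) (hg.lieD _),
    Finset.sum_add_distrib]
  ring

theorem opA_const_mul {f : Nil ι → ℂ} (hf : Smooth f) (c : ℂ) :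
    F.opA (fun x => c * f x) = fun x => c * F.opA f x := by
  funext x
  simp only [opA, lapY, lieD_const_mul_fun hf, lieD_const_mul_fun (hf.lieD _),
    ← Finset.mul_sum]
  ring

/-- Each Y_j is antisymmetric by invariance of the measure. The identity yields both the positivity
of I + Δ_Y and its lower bound 1. -/
theorem inner_opA {f g : Nil ι → ℂ} (hf : Smooth f) (hg : Smooth g) :
    inner ℂ hf.toL2 (F.smooth_opA hg).toL2 = inner ℂ hf.toL2 hg.toL2
      + ∑ j, inner ℂ (hf.lieD (F.Y j)).toL2 (hg.lieD (F.Y j)).toL2 := by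
  have hi : ∀ {u v : Nil ι → ℂ} (hu : Smooth u) (hv : Smooth v),
      inner ℂ hu.toL2 hv.toL2 = ∫ x, (starRingEnd ℂ) (u x) * v x ∂haar ι := by
    intro u v hu hv
    rw [inner_toL2]
    refine integral_congr_ae ?_
    filter_upwards [hv.coeFn_toL2] with x hx
    rw [hx]
  simp only [hi]
  have h1 : ∀ j, ∫ x, (starRingEnd ℂ) (lieD (F.Y j) f x) * lieD (F.Y j) g x ∂haar ι
      = -∫ x, (starRingEnd ℂ) (f x) * lieD (F.Y j) (lieD (F.Y j) g) x ∂haar ι := by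
    intro j
    rw [← hf.conj.integral_lieD_mul (hg.lieD (F.Y j))]
    simp only [hf.lieD_conj]
  simp only [h1, opA, lapY, mul_add, mul_neg, Finset.mul_sum, Finset.sum_neg_distrib]
  have h2 : ∀ j ∈ Finset.univ, Integrable (fun x => (starRingEnd ℂ) (f x)
      * lieD (F.Y j) (lieD (F.Y j) g) x) (haar ι) :=
    fun j _ => (hf.conj.mul ((hg.lieD (F.Y j)).lieD (F.Y j))).integrable
  have h3 := integral_add (hf.conj.mul hg).integrable (integrable_finsetSum _ h2).neg
  simp only [Pi.neg_apply] at h3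
  rw [h3, integral_neg, integral_finsetSum _ h2]

theorem re_inner_opA {f : Nil ι → ℂ} (hf : Smooth f) :
    inner ℂ hf.toL2 (F.smooth_opA hf).toL2
      = ((‖hf.toL2‖ ^ 2 + ∑ j, ‖(hf.lieD (F.Y j)).toL2‖ ^ 2 : ℝ) : ℂ) := by
  rw [F.inner_opA hf hf]
  simp only [inner_self_eq_norm_sq_to_K]
  push_cast
  rfl

theorem norm_le_norm_opA {f : Nil ι → ℂ} (hf : Smooth f) :
    ‖hf.toL2‖ ≤ ‖(F.smooth_opA hf).toL2‖ := by
  have h1 : ‖hf.toL2‖ ^ 2 ≤ ‖hf.toL2‖ * ‖(F.smooth_opA hf).toL2‖ := by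
    refine le_trans ?_ (norm_inner_le_norm (𝕜 := ℂ) _ _)
    rw [F.re_inner_opA hf, Complex.norm_real, Real.norm_eq_abs]
    refine le_trans ?_ (le_abs_self _)
    exact le_add_of_nonneg_right (Finset.sum_nonneg fun j _ => sq_nonneg _)
  by_contra h
  push Not at h
  have h0 : 0 < ‖hf.toL2‖ := (norm_nonneg _).trans_lt h
  nlinarith

/-- The symbol of `I + Δ_Y` on waves. -/
def symb (m : Idx ι → ℤ) (t : ℝ) : ℝ := 1 + ∑ j, ang m ((twist ι t).mulVec (F.Y j).2) ^ 2

theorem one_le_symb (m : Idx ι → ℤ) (t : ℝ) : 1 ≤ F.symb m t :=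
  le_add_of_nonneg_right (Finset.sum_nonneg fun _ _ => sq_nonneg _)

theorem symb_pos (m : Idx ι → ℤ) (t : ℝ) : 0 < F.symb m t := one_pos.trans_le (F.one_le_symb m t)

theorem contDiff_symb (m : Idx ι → ℤ) : ContDiff ℝ ∞ (F.symb m) :=
  contDiff_const.add (ContDiff.sum fun _ _ => (contDiff_ang_twist m _).pow 2)

theorem contDiff_symb_rpow (m : Idx ι → ℤ) (s : ℝ) :
    ContDiff ℝ ∞ fun t => ((F.symb m t ^ s : ℝ) : ℂ) :=
  Complex.ofRealCLM.contDiff.comp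
    ((F.contDiff_symb m).rpow_const_of_ne fun t => (F.symb_pos m t).ne')

/-- The effect of `(I + Δ_Y)^s` on the coefficient of a wave. -/
def mulSymb (m : Idx ι → ℤ) (s : ℝ) (c : ℝ → ℂ) (t : ℝ) : ℂ := c t * ((F.symb m t ^ s : ℝ) : ℂ)

theorem _root_.QuasiAbelian.IsCoeff.mulSymb {c : ℝ → ℂ} (hc : IsCoeff c) (m : Idx ι → ℤ) (s : ℝ) :
    IsCoeff (F.mulSymb m s c) := hc.mul (F.contDiff_symb_rpow m s)

theorem mulSymb_mulSymb (m : Idx ι → ℤ) (s s' : ℝ) (c : ℝ → ℂ) :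
    F.mulSymb m s (F.mulSymb m s' c) = F.mulSymb m (s + s') c := by
  funext t
  simp only [mulSymb, Real.rpow_add (F.symb_pos m t)]
  push_cast
  ring

theorem mulSymb_zero (m : Idx ι → ℤ) (c : ℝ → ℂ) : F.mulSymb m 0 c = c := by
  funext t
  simp [mulSymb]

theorem opA_wave (m : Idx ι → ℤ) (c : ℝ → ℂ) :
    F.opA (wave m c) = wave m (F.mulSymb m 1 c) := by
  have h : ∀ j (c : ℝ → ℂ), lieD (F.Y j) (wave m c)
      = wave m (fun t => c t * (ang m ((twist ι t).mulVec (F.Y j).2) * Complex.I)) :=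
    fun j c => funext fun x => lieD_wave m c (F.Y_mem j) x
  funext x
  simp only [opA, lapY, h, wave, mulSymb, symb, Real.rpow_one]
  push_cast
  simp only [mul_add, add_mul, mul_one, Finset.mul_sum, Finset.sum_mul, ← Finset.sum_neg_distrib]
  congr 1
  refine Finset.sum_congr rfl fun j _ => ?_
  linear_combination (-(c x.rep.1 * (ang m ((twist ι x.rep.1).mulVec (F.Y j).2) : ℂ) ^ 2
    * Complex.exp (ang m x.rep.2 * Complex.I))) * Complex.I_sq

/-- `I + Δ_Y` as a linear map on `C^∞(M)`. -/
def opALin : smoothSub ι →ₗ[ℂ] L2 ι where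
  toFun f := (F.smooth_opA f.2).toL2
  map_add' f g := (toL2_congr _ _ (F.opA_add f.2 g.2)).trans
    ((F.smooth_opA f.2).toL2_add (F.smooth_opA g.2))
  map_smul' c f := (toL2_congr (F.smooth_opA (c • f).2) ((Smooth.const c).mul (F.smooth_opA f.2))
    (F.opA_const_mul f.2 c)).trans ((F.smooth_opA f.2).toL2_const_mul c)

variable (ι) in
/-- The inclusion of `C^∞(M)` in `L²(M)`. -/
def inclLin : smoothSub ι →ₗ[ℂ] L2 ι where
  toFun f := Smooth.toL2 f.2
  map_add' _ _ := rfl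
  map_smul' _ _ := rfl

/-- The symbol is smooth and at least 1, so dividing a coefficient by it gives a coefficient again.
Density of the waves then makes the range of I + Δ_Y dense, which stands in for essential
self-adjointness. -/
theorem waveSet_subset_range_opALin : waveSet ι ⊆ Set.range F.opALin := by
  rintro _ ⟨m, c, hc, rfl⟩
  refine ⟨⟨wave m (F.mulSymb m (-1) c), (hc.mulSymb F m (-1)).smooth_wave m⟩, ?_⟩
  refine toL2_congr (F.smooth_opA ((hc.mulSymb F m (-1)).smooth_wave m)) _ ?_
  rw [opA_wave, mulSymb_mulSymb, add_neg_cancel, mulSymb_zero]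

theorem denseRange_of_waveSet {E : Type*} [AddCommGroup E] [Module ℂ E] (e : E →ₗ[ℂ] L2 ι)
    (h : waveSet ι ⊆ Set.range e) : DenseRange e := by
  intro g
  have := mem_of_wave (LinearMap.range e).topologicalClosure
    (Submodule.isClosed_topologicalClosure _)
    (Set.Subset.trans (fun g hg => h hg) subset_closure) g
  exact this

/-- `resolvent` is chosen by epsilon, so existence has to be shown: (I + Δ_Y)φ ↦ φ is a contraction
on a dense subspace by `norm_le_norm_opA` and extends to L². -/
theorem isResolvent_resolvent : F.IsResolvent F.resolvent := by
  refine Classical.epsilon_spec (p := F.IsResolvent)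
    ⟨(inclLin ι).extendOfNorm F.opALin, fun φ hφ g hg => ?_⟩
  have h1 : g = F.opALin ⟨φ, hφ⟩ := (toL2_eq_iff (F.smooth_opA hφ)).2 hg
  rw [h1, LinearMap.extendOfNorm_eq (denseRange_of_waveSet _ F.waveSet_subset_range_opALin)
    ⟨1, fun f => by rw [one_mul]; exact F.norm_le_norm_opA f.2⟩]
  exact hφ.coeFn_toL2

theorem resolvent_opA {f : Nil ι → ℂ} (hf : Smooth f) :
    F.resolvent (F.smooth_opA hf).toL2 = hf.toL2 :=
  (toL2_eq_iff hf).2 (F.isResolvent_resolvent f hf _ (F.smooth_opA hf).coeFn_toL2)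

theorem induction_opA {p : L2 ι → Prop} (hp : IsClosed {g | p g})
    (h : ∀ (f : Nil ι → ℂ) (hf : Smooth f), p (F.smooth_opA hf).toL2) (g : L2 ι) : p g :=
  (denseRange_of_waveSet _ F.waveSet_subset_range_opALin).induction_on g hp fun f => h f.1 f.2

/-- It suffices to test on the dense range of I + Δ_Y, where the quadratic form is ‖f‖² + ∑ ‖Y_j
f‖². -/
theorem resolvent_nonneg : 0 ≤ F.resolvent := by
  rw [ContinuousLinearMap.nonneg_iff_isPositive, ContinuousLinearMap.isPositive_iff_complex]
  refine F.induction_opA ?_ fun f hf => ?_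
  · have hc : Continuous fun g : L2 ι => inner ℂ (F.resolvent g) g :=
      F.resolvent.continuous.inner continuous_id
    exact (isClosed_eq (Complex.continuous_ofReal.comp (Complex.continuous_re.comp hc)) hc).inter
      (isClosed_le continuous_const (Complex.continuous_re.comp hc))
  · rw [F.resolvent_opA hf, F.re_inner_opA hf]
    refine ⟨rfl, ?_⟩
    rw [RCLike.re_to_complex, Complex.ofReal_re]
    positivity

theorem norm_resolvent_le : ‖F.resolvent‖ ≤ 1 := by
  refine ContinuousLinearMap.opNorm_le_bound _ zero_le_one ?_
  refine F.induction_opA (isClosed_le (by fun_prop) (by fun_prop)) fun f hf => ?_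
  rw [F.resolvent_opA hf, one_mul]
  exact F.norm_le_norm_opA hf

theorem resolvent_wave {m : Idx ι → ℤ} {c : ℝ → ℂ} (hc : IsCoeff c) :
    F.resolvent (hc.smooth_wave m).toL2 = ((hc.mulSymb F m (-1)).smooth_wave m).toL2 := by
  have hc' := (hc.mulSymb F m (-1)).smooth_wave m
  rw [← F.resolvent_opA hc']
  congr 1
  refine toL2_congr _ (F.smooth_opA hc') ?_
  rw [opA_wave, mulSymb_mulSymb, add_neg_cancel, mulSymb_zero]

/-- The effect of a function of the resolvent on the coefficient of a wave. -/
def mulPoly (m : Idx ι → ℤ) (p : Polynomial ℝ) (c : ℝ → ℂ) (t : ℝ) : ℂ :=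
  c t * ((p.eval (F.symb m t ^ (-1 : ℝ)) : ℝ) : ℂ)

theorem _root_.QuasiAbelian.IsCoeff.mulPoly {c : ℝ → ℂ} (hc : IsCoeff c) (m : Idx ι → ℤ)
    (p : Polynomial ℝ) : IsCoeff (F.mulPoly m p c) := by
  refine hc.mul (Complex.ofRealCLM.contDiff.comp ?_)
  have := (Polynomial.contDiff_aeval (𝕜 := ℝ) p ∞).comp
    ((F.contDiff_symb m).rpow_const_of_ne (p := (-1 : ℝ)) fun t => (F.symb_pos m t).ne')
  simpa only [Polynomial.coe_aeval_eq_eval] using! this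

theorem aeval_resolvent_wave (p : Polynomial ℝ) {m : Idx ι → ℤ} {c : ℝ → ℂ} (hc : IsCoeff c) :
    (Polynomial.aeval F.resolvent p) (hc.smooth_wave m).toL2
      = ((hc.mulPoly F m p).smooth_wave m).toL2 := by
  have hpow : ∀ k : ℕ, ∀ {c : ℝ → ℂ} (hc : IsCoeff c), (F.resolvent ^ k) (hc.smooth_wave m).toL2
      = ((hc.mulPoly F m (Polynomial.X ^ k)).smooth_wave m).toL2 := by
    intro k
    induction k with
    | zero =>
      intro c hc
      rw [pow_zero, one_apply_eq_self]
      refine toL2_congr _ _ ?_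
      congr 1
      funext t
      simp [mulPoly]
    | succ k ih =>
      intro c hc
      rw [pow_succ, mul_apply_eq_comp, F.resolvent_wave hc, ih (hc.mulSymb F m (-1))]
      refine toL2_congr _ _ ?_
      congr 1
      funext t
      simp only [mulPoly, mulSymb, Polynomial.eval_pow, Polynomial.eval_X, pow_succ,
        Polynomial.eval_mul]
      push_cast
      ring
  induction p using Polynomial.induction_on' with
  | add p q hp hq =>
    rw [map_add, add_apply, hp, hq, ← Smooth.toL2_add]
    refine toL2_congr _ _ ?_
    funext x
    simp only [wave, mulPoly, Polynomial.eval_add]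
    push_cast
    ring
  | monomial k r =>
    rw [Polynomial.aeval_monomial, mul_apply_eq_comp, hpow k hc,
      Algebra.algebraMap_eq_smul_one, smul_apply,
      one_apply_eq_self]
    have h1 : ∀ g : L2 ι, (r • g : L2 ι) = (r : ℂ) • g := fun g => (Complex.coe_smul r g).symm
    rw [h1, ← Smooth.toL2_const_mul]
    refine toL2_congr _ _ ?_
    funext x
    simp only [wave, mulPoly, Polynomial.eval_monomial, Polynomial.eval_pow, Polynomial.eval_X]
    push_cast
    ring

/-- For a polynomial in the resolvent the action on a wave is explicit. The power x^{σ/2} is a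
uniform limit of polynomials on [0,1], where the inverse of the symbol takes its values. -/
theorem negPow_wave {σ : ℝ} (hσ : 0 < σ) {m : Idx ι → ℤ} {c : ℝ → ℂ} (hc : IsCoeff c) :
    F.negPow σ (hc.smooth_wave m).toL2
      = ((hc.mulSymb F m (-(σ / 2))).smooth_wave m).toL2 := by
  set w := (hc.smooth_wave m).toL2 with hw
  set w' := ((hc.mulSymb F m (-(σ / 2))).smooth_wave m).toL2 with hw'
  have hs : 0 < σ / 2 := by positivity
  have hcont : ContinuousOn (fun x : ℝ => x ^ (σ / 2)) (Set.Icc 0 1) :=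
    (Real.continuous_rpow_const hs.le).continuousOn
  have key : ∀ ε : ℝ, 0 < ε → ‖F.negPow σ w - w'‖ ≤ ε * ‖w‖ + ε * ‖w‖ := by
    intro ε hε
    obtain ⟨p, hp⟩ := exists_polynomial_near_of_continuousOn 0 1 _ hcont ε hε
    have h3 : ‖F.negPow σ - Polynomial.aeval F.resolvent p‖ ≤ ε :=
      norm_opPow_sub_aeval_le F.resolvent_nonneg F.norm_resolvent_le hs hp
    have h4 : ‖(Polynomial.aeval F.resolvent p) w - w'‖ ≤ ε * ‖w‖ := by
      rw [hw, F.aeval_resolvent_wave p hc, hw', ← Smooth.toL2_sub]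
      refine norm_toL2_le _ _ fun x => ?_
      have h5 : wave m (F.mulPoly m p c) x - wave m (F.mulSymb m (-(σ / 2)) c) x
          = ((p.eval (F.symb m x.rep.1 ^ (-1 : ℝ)) - F.symb m x.rep.1 ^ (-(σ / 2)) : ℝ) : ℂ)
            * wave m c x := by
        simp only [wave, mulPoly, mulSymb]
        push_cast
        ring
      rw [h5, norm_mul, Complex.norm_real]
      refine mul_le_mul_of_nonneg_right ?_ (norm_nonneg _)
      have h6 := hp (F.symb m x.rep.1 ^ (-1 : ℝ)) ⟨Real.rpow_nonneg (F.symb_pos m _).le _,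
        Real.rpow_le_one_of_one_le_of_nonpos (F.one_le_symb m _) (by norm_num)⟩
      rw [← Real.rpow_mul (F.symb_pos m _).le, neg_one_mul] at h6
      exact h6.le
    calc ‖F.negPow σ w - w'‖ = ‖(F.negPow σ - Polynomial.aeval F.resolvent p) w
          + ((Polynomial.aeval F.resolvent p) w - w')‖ := by
          rw [sub_apply]; abel_nf
      _ ≤ _ := norm_add_le _ _
      _ ≤ _ := add_le_add ((ContinuousLinearMap.le_opNorm _ _).trans
        (mul_le_mul_of_nonneg_right h3 (norm_nonneg _))) h4
  rw [← sub_eq_zero, ← norm_le_zero_iff]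
  refine le_of_forall_pos_le_add fun δ hδ => ?_
  -- The extra 1 in the denominator keeps the choice valid when w = 0.
  have h := key (δ / (2 * (‖w‖ + 1))) (by positivity)
  rw [zero_add]
  refine h.trans ?_
  rw [← two_mul, ← mul_assoc, mul_div_assoc', div_mul_eq_mul_div, div_le_iff₀ (by positivity)]
  nlinarith [norm_nonneg w]

theorem negPow_ext {A B : L2 ι →L[ℂ] L2 ι} (h : ∀ g ∈ waveSet ι, A g = B g) : A = B := by
  ext1 g
  exact mem_of_wave (LinearMap.eqLocus (A : L2 ι →ₗ[ℂ] L2 ι) (B : L2 ι →ₗ[ℂ] L2 ι))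
    (isClosed_eq A.continuous B.continuous) h g

theorem negPow_add {σ τ : ℝ} (hσ : 0 < σ) (hτ : 0 < τ) :
    F.negPow (σ + τ) = F.negPow σ * F.negPow τ := by
  refine negPow_ext ?_
  rintro _ ⟨m, c, hc, rfl⟩
  rw [mul_apply_eq_comp, F.negPow_wave hτ hc,
    F.negPow_wave hσ (hc.mulSymb F m _), F.negPow_wave (add_pos hσ hτ) hc]
  refine toL2_congr _ _ ?_
  rw [mulSymb_mulSymb]
  congr 2
  ring

theorem negPow_two : F.negPow 2 = F.resolvent := by
  refine negPow_ext ?_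
  rintro _ ⟨m, c, hc, rfl⟩
  rw [F.negPow_wave two_pos hc, F.resolvent_wave hc]
  refine toL2_congr _ _ ?_
  norm_num

theorem isSelfAdjoint_negPow (σ : ℝ) : IsSelfAdjoint (F.negPow σ) :=
  isSelfAdjoint_opPow _ _

end AdaptedBasis

/-! ### Gaussian vectors subordinated to a Gamma variable -/

section Subord

variable {J : Type*} [Fintype J]

/-- The heat kernel of `∑ ∂_j²` at time `τ`. -/
def heat (τ : ℝ) (v : J → ℝ) : ℝ :=
  ∏ j, ProbabilityTheory.gaussianPDFReal 0 (2 * τ).toNNReal (v j)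

theorem heat_nonneg (τ : ℝ) (v : J → ℝ) : 0 ≤ heat τ v :=
  Finset.prod_nonneg fun _ _ => ProbabilityTheory.gaussianPDFReal_nonneg _ _ _

theorem measurable_heat : Measurable fun p : ℝ × (J → ℝ) => heat p.1 p.2 := by
  refine Finset.measurable_prod _ fun j _ => ?_
  exact ProbabilityTheory.measurable_uncurry_gaussianPDFReal.comp
    (measurable_const.prodMk ((measurable_fst.const_mul 2).real_toNNReal.prodMk
      ((measurable_pi_apply j).comp measurable_snd)))

theorem integrable_heat (τ : ℝ) : Integrable fun v : J → ℝ => heat τ v :=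
  Integrable.fintype_prod fun _ => ProbabilityTheory.integrable_gaussianPDFReal _ _

theorem integral_heat {τ : ℝ} (hτ : 0 < τ) : ∫ v : J → ℝ, heat τ v = 1 := by
  have h0 : (2 * τ).toNNReal ≠ 0 := by simpa using hτ
  simp only [heat]
  rw [integral_fintype_prod_volume_eq_prod
    (fun (_ : J) x => ProbabilityTheory.gaussianPDFReal 0 (2 * τ).toNNReal x)]
  simp [ProbabilityTheory.integral_gaussianPDFReal_eq_one 0 h0]

/-- The coordinates are independent Gaussians of variance 2τ, so each contributes exp(−τξ_j²). -/
theorem integral_heat_mul_exp {τ : ℝ} (hτ : 0 < τ) (ξ : J → ℝ) :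
    ∫ v : J → ℝ, (heat τ v : ℂ) * Complex.exp ((∑ j, v j * ξ j : ℝ) * Complex.I)
      = (Real.exp (-(∑ j, ξ j ^ 2) * τ) : ℂ) := by
  have h0 : (2 * τ).toNNReal ≠ 0 := by simpa using hτ
  have h1 : ∀ v : J → ℝ, (heat τ v : ℂ) * Complex.exp ((∑ j, v j * ξ j : ℝ) * Complex.I)
      = ∏ j, (ProbabilityTheory.gaussianPDFReal 0 (2 * τ).toNNReal (v j) : ℂ)
          * Complex.exp (ξ j * v j * Complex.I) := by
    intro v
    rw [Finset.prod_mul_distrib, ← Complex.exp_sum, heat]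
    push_cast
    rw [Finset.sum_mul]
    simp only [mul_comm]
  simp only [h1]
  rw [integral_fintype_prod_volume_eq_prod (fun (j : J) (x : ℝ) =>
    (ProbabilityTheory.gaussianPDFReal 0 (2 * τ).toNNReal x : ℂ)
          * Complex.exp (ξ j * x * Complex.I))]
  have h2 : ∀ j, ∫ x : ℝ, (ProbabilityTheory.gaussianPDFReal 0 (2 * τ).toNNReal x : ℂ)
          * Complex.exp (ξ j * x * Complex.I) = Complex.exp (-(ξ j ^ 2) * τ : ℝ) := by
    intro j
    have h3 := ProbabilityTheory.charFun_gaussianReal (μ := 0) (v := (2 * τ).toNNReal) (ξ j)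
    rw [charFun_apply_real, ProbabilityTheory.integral_gaussianReal_eq_integral_smul h0] at h3
    simp only [Complex.real_smul] at h3
    rw [h3]
    congr 1
    have h4 : (((2 * τ).toNNReal : ℝ≥0) : ℂ) = ((2 * τ : ℝ) : ℂ) := by
      rw [← Real.coe_toNNReal (2 * τ) (by positivity)]
      simp
    rw [h4]
    push_cast
    ring
  simp only [h2]
  rw [← Complex.exp_sum, Complex.ofReal_exp, ← Finset.sum_neg_distrib, Finset.sum_mul]
  push_cast
  rfl

variable (J) in
/-- The law of `(τ, v)`, where `τ` has the Gamma distribution with parameter `s` and, given `τ`,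
`v` has the density `heat τ`. -/
def subord (s : ℝ) : Measure (ℝ × (J → ℝ)) :=
  ((ProbabilityTheory.gammaMeasure s 1).prod volume).withDensity
    fun p => ENNReal.ofReal (heat p.1 p.2)

theorem isProbabilityMeasure_gamma {s : ℝ} (hs : 0 < s) :
    IsProbabilityMeasure (ProbabilityTheory.gammaMeasure s 1) :=
  ProbabilityTheory.isProbabilityMeasure_gammaMeasure hs one_pos

theorem lintegral_gamma (s : ℝ) (f : ℝ → ℝ≥0∞) (hf : Measurable f) :
    ∫⁻ τ, f τ ∂ProbabilityTheory.gammaMeasure s 1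
      = ∫⁻ τ in Set.Ioi 0, ENNReal.ofReal (ProbabilityTheory.gammaPDFReal s 1 τ) * f τ := by
  have hm : Measurable fun τ => ENNReal.ofReal (ProbabilityTheory.gammaPDFReal s 1 τ) :=
    (ProbabilityTheory.measurable_gammaPDFReal s 1).ennreal_ofReal
  rw [ProbabilityTheory.gammaMeasure]
  change ∫⁻ τ, f τ ∂(volume.withDensity fun τ =>
    ENNReal.ofReal (ProbabilityTheory.gammaPDFReal s 1 τ)) = _
  rw [lintegral_withDensity_eq_lintegral_mul _ hm hf, ← lintegral_indicator measurableSet_Ioi]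
  refine lintegral_congr_ae ?_
  filter_upwards [(Set.countable_singleton (0 : ℝ)).ae_notMem volume] with τ hτ
  rcases lt_or_gt_of_ne hτ with h | h
  · rw [Set.indicator_of_notMem (by simpa using h.le), Pi.mul_apply,
      ProbabilityTheory.gammaPDFReal, if_neg (not_le.2 h), ENNReal.ofReal_zero, zero_mul]
  · rw [Set.indicator_of_mem (by simpa using h), Pi.mul_apply]

theorem ae_gamma_pos (s : ℝ) : ∀ᵐ τ ∂ProbabilityTheory.gammaMeasure s 1, 0 < τ := by
  have h := lintegral_gamma s (Set.indicator (Set.Iic 0) 1)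
    (measurable_one.indicator measurableSet_Iic)
  rw [lintegral_indicator measurableSet_Iic] at h
  simp only [Pi.one_apply, lintegral_one, Measure.restrict_apply MeasurableSet.univ,
    Set.univ_inter] at h
  rw [setLIntegral_congr_fun (g := fun _ => 0) measurableSet_Ioi, lintegral_zero] at h
  · refine (ae_iff).2 ?_
    simpa only [not_lt] using! h
  · intro τ hτ
    have : τ ∉ Set.Iic (0 : ℝ) := fun h => (not_le.2 (Set.mem_Ioi.1 hτ)) h
    simp [this]

/-- The Laplace transform of the Gamma law: the factor e^{-τ} of its density supplies the 1 in 1 +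
q. -/
theorem integral_gamma_exp {s q : ℝ} (hs : 0 < s) (hq : 0 ≤ q) :
    ∫ τ, Real.exp (-q * τ) ∂ProbabilityTheory.gammaMeasure s 1 = (1 + q) ^ (-s) := by
  have hm : Measurable (ProbabilityTheory.gammaPDF s 1) :=
    (ProbabilityTheory.measurable_gammaPDFReal s 1).ennreal_ofReal
  have hq' : 0 < 1 + q := by positivity
  have hΓ : Real.Gamma s ≠ 0 := (Real.Gamma_pos_of_pos hs).ne'
  rw [ProbabilityTheory.gammaMeasure, integral_withDensity_eq_integral_toReal_smul hm
    (Eventually.of_forall fun _ => ENNReal.ofReal_lt_top)]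
  have h1 : ∫ τ, (ProbabilityTheory.gammaPDF s 1 τ).toReal • Real.exp (-q * τ)
      = ∫ τ in Set.Ioi (0 : ℝ), (Real.Gamma s)⁻¹ * (τ ^ (s - 1) * Real.exp (-((1 + q) * τ))) := by
    rw [← integral_indicator measurableSet_Ioi]
    refine integral_congr_ae ?_
    filter_upwards [(Set.countable_singleton (0 : ℝ)).ae_notMem volume] with τ hτ
    rw [ProbabilityTheory.gammaPDF, ENNReal.toReal_ofReal
      (ProbabilityTheory.gammaPDFReal_nonneg hs one_pos τ), ProbabilityTheory.gammaPDFReal]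
    rcases lt_or_gt_of_ne hτ with h | h
    · rw [Set.indicator_of_notMem (by simpa using h.le), if_neg (not_le.2 h), zero_smul]
    · rw [Set.indicator_of_mem (by simpa using h), if_pos (le_of_lt h), smul_eq_mul,
        Real.one_rpow, one_div, mul_assoc, mul_assoc, ← Real.exp_add]
      congr 3
      ring
  rw [h1, integral_const_mul, Real.integral_rpow_mul_exp_neg_mul_Ioi hs hq', one_div,
    Real.inv_rpow hq'.le, Real.rpow_neg hq'.le]
  field_simp

theorem lintegral_subord (s : ℝ) {f : ℝ × (J → ℝ) → ℝ≥0∞} (hf : Measurable f) (hs : 0 < s) :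
    ∫⁻ p, f p ∂subord J s = ∫⁻ τ, (∫⁻ v, ENNReal.ofReal (heat τ v) * f (τ, v))
      ∂ProbabilityTheory.gammaMeasure s 1 := by
  have := isProbabilityMeasure_gamma hs
  have hm : Measurable fun p : ℝ × (J → ℝ) => ENNReal.ofReal (heat p.1 p.2) :=
    measurable_heat.ennreal_ofReal
  rw [subord, lintegral_withDensity_eq_lintegral_mul _ hm hf,
    lintegral_prod _ (hm.mul hf).aemeasurable]
  rfl

theorem isProbabilityMeasure_subord {s : ℝ} (hs : 0 < s) :
    IsProbabilityMeasure (subord J s) := by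
  have := isProbabilityMeasure_gamma hs
  refine ⟨?_⟩
  rw [← lintegral_one, lintegral_subord s measurable_const hs]
  have : ∀ᵐ τ ∂ProbabilityTheory.gammaMeasure s 1,
      ∫⁻ v : J → ℝ, ENNReal.ofReal (heat τ v) * 1 = 1 := by
    filter_upwards [ae_gamma_pos s] with τ hτ
    simp only [mul_one]
    rw [← ofReal_integral_eq_lintegral_ofReal (integrable_heat τ)
      (Eventually.of_forall fun v => heat_nonneg τ v), integral_heat hτ, ENNReal.ofReal_one]
  rw [lintegral_congr_ae this]
  simp

/-- Given τ, the Gaussian contributes exp(−|ξ|²τ), and the Laplace transform of the Gamma law turns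
this into the symbol of (I + Δ)^{-s}. -/
theorem integral_subord_exp {s : ℝ} (hs : 0 < s) (ξ : J → ℝ) :
    ∫ p, Complex.exp ((∑ j, p.2 j * ξ j : ℝ) * Complex.I) ∂subord J s
      = (((1 + ∑ j, ξ j ^ 2) ^ (-s) : ℝ) : ℂ) := by
  have := isProbabilityMeasure_gamma hs
  have := isProbabilityMeasure_subord (J := J) hs
  have hm : Measurable fun p : ℝ × (J → ℝ) => ENNReal.ofReal (heat p.1 p.2) :=
    measurable_heat.ennreal_ofReal
  have hi : Integrable (fun p : ℝ × (J → ℝ) =>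
      Complex.exp ((∑ j, p.2 j * ξ j : ℝ) * Complex.I)) (subord J s) := by
    refine Integrable.of_bound (C := 1) (Continuous.aestronglyMeasurable (by fun_prop)) ?_
    exact Eventually.of_forall fun p => (Complex.norm_exp_ofReal_mul_I _).le
  rw [subord, integrable_withDensity_iff_integrable_smul' hm
    (Eventually.of_forall fun _ => ENNReal.ofReal_lt_top)] at hi
  rw [subord, integral_withDensity_eq_integral_toReal_smul hm
    (Eventually.of_forall fun _ => ENNReal.ofReal_lt_top), integral_prod _ hi]
  have h1 : ∀ᵐ τ ∂ProbabilityTheory.gammaMeasure s 1,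
      ∫ v : J → ℝ, (ENNReal.ofReal (heat τ v)).toReal
        • Complex.exp ((∑ j, v j * ξ j : ℝ) * Complex.I)
      = ((Real.exp (-(∑ j, ξ j ^ 2) * τ) : ℝ) : ℂ) := by
    filter_upwards [ae_gamma_pos s] with τ hτ
    simp only [ENNReal.toReal_ofReal (heat_nonneg τ _), Complex.real_smul]
    exact integral_heat_mul_exp hτ ξ
  rw [integral_congr_ae h1, integral_complex_ofReal,
    integral_gamma_exp hs (Finset.sum_nonneg fun _ _ => sq_nonneg _)]

end Subord

/-! ### Negative powers of `I + Δ_Y` as averaging operators -/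

theorem measurable_coeFn (g : L2 ι) : Measurable g := (Lp.stronglyMeasurable g).measurable

theorem lintegral_enorm_le (g : L2 ι) : ∫⁻ x, ‖g x‖ₑ ∂haar ι ≤ ‖g‖ₑ := by
  rw [← eLpNorm_one_eq_lintegral_enorm, Lp.enorm_def]
  exact eLpNorm_le_eLpNorm_of_exponent_le one_le_two (Lp.aestronglyMeasurable g)

/-- Each slice is a translation, so random translates of a uniform point are uniform. Consequently
averages depend only on almost-everywhere classes. -/
theorem measurePreserving_act_prod {P : Type*} [MeasurableSpace P] (ν : Measure P)
    [IsProbabilityMeasure ν] {k : P → Grp ι} (hk : Measurable k) :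
    MeasurePreserving (fun z : Nil ι × P => z.1.act (k z.2)) ((haar ι).prod ν) (haar ι) := by
  have hm : Measurable fun z : Nil ι × P => z.1.act (k z.2) :=
    Nil.measurable_act.comp (measurable_fst.prodMk (hk.comp measurable_snd))
  refine ⟨hm, Measure.ext_of_lintegral _ fun f hf => ?_⟩
  rw [lintegral_map hf hm, lintegral_prod_symm (fun z : Nil ι × P => f (z.1.act (k z.2)))
    (hf.comp hm).aemeasurable]
  simp only [lintegral_act hf, lintegral_const, measure_univ, mul_one]

namespace AdaptedBasis

variable (F : AdaptedBasis ι)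

/-- The average of `g` over the translates by `exp (v · Y)`, where `v` is the second component of
`subord s`. -/
def avg (s : ℝ) (g : Nil ι → ℂ) (x : Nil ι) : ℂ :=
  ∫ p, g (x.act (F.expY p.2)) ∂subord (Idx ι) s

theorem measurable_expY_snd : Measurable fun p : ℝ × (Idx ι → ℝ) => F.expY p.2 :=
  F.continuous_expY.measurable.comp measurable_snd

theorem measurePreserving_act_expY {s : ℝ} (hs : 0 < s) :
    MeasurePreserving (fun z : Nil ι × (ℝ × (Idx ι → ℝ)) => z.1.act (F.expY z.2.2))
      ((haar ι).prod (subord (Idx ι) s)) (haar ι) :=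
  have := isProbabilityMeasure_subord (J := Idx ι) hs
  measurePreserving_act_prod _ F.measurable_expY_snd

theorem ang_mulVec_mat (m : Idx ι → ℤ) (t : ℝ) (v : Idx ι → ℝ) :
    ang m ((twist ι t).mulVec (F.mat.mulVec v))
      = ∑ j, v j * ang m ((twist ι t).mulVec (F.Y j).2) := by
  have h : F.mat.mulVec v = ∑ j, v j • (F.Y j).2 := by
    have := congrArg Prod.snd (F.sum_smul_Y v)
    rw [Prod.snd_sum] at this
    exact this.symm
  have hz : ang m (0 : Idx ι → ℝ) = 0 := by simp [ang]
  let A : (Idx ι → ℝ) →ₗ[ℝ] ℝ :=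
    { toFun := fun w => ang m ((twist ι t).mulVec w)
      map_add' := fun w w' => by rw [Matrix.mulVec_add, ang_add]
      map_smul' := fun r w => by rw [Matrix.mulVec_smul, ang_smul]; rfl }
  change A (F.mat.mulVec v) = ∑ j, v j * A (F.Y j).2
  rw [h, map_sum]
  simp only [map_smul, smul_eq_mul]

theorem avg_wave {s : ℝ} (hs : 0 < s) (m : Idx ι → ℤ) (c : ℝ → ℂ) :
    F.avg s (wave m c) = wave m (F.mulSymb m (-s) c) := by
  funext x
  simp only [avg, expY, wave_act_ideal, ang_mulVec_mat]
  rw [integral_const_mul, integral_subord_exp hs]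
  simp only [wave, mulSymb, symb]
  ring

theorem integrable_act_prod {s : ℝ} (hs : 0 < s) {g : Nil ι → ℂ} (hg : Integrable g (haar ι)) :
    Integrable (fun z : Nil ι × (ℝ × (Idx ι → ℝ)) => g (z.1.act (F.expY z.2.2)))
      ((haar ι).prod (subord (Idx ι) s)) :=
  (F.measurePreserving_act_expY hs).integrable_comp_of_integrable hg

theorem ae_integrable_act {s : ℝ} (hs : 0 < s) {g : Nil ι → ℂ} (hg : Integrable g (haar ι)) :
    ∀ᵐ x ∂haar ι, Integrable (fun p : ℝ × (Idx ι → ℝ) => g (x.act (F.expY p.2)))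
      (subord (Idx ι) s) :=
  have := isProbabilityMeasure_subord (J := Idx ι) hs
  (F.integrable_act_prod hs hg).prod_right_ae

theorem integrable_avg {s : ℝ} (hs : 0 < s) {g : Nil ι → ℂ} (hg : Integrable g (haar ι)) :
    Integrable (F.avg s g) (haar ι) :=
  have := isProbabilityMeasure_subord (J := Idx ι) hs
  (F.integrable_act_prod hs hg).integral_prod_left

theorem avg_congr {s : ℝ} (hs : 0 < s) {g g' : Nil ι → ℂ} (h : g =ᵐ[haar ι] g') :
    F.avg s g =ᵐ[haar ι] F.avg s g' := by
  have := isProbabilityMeasure_subord (J := Idx ι) hs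
  have h1 := (F.measurePreserving_act_expY hs).quasiMeasurePreserving.ae_eq_comp h
  filter_upwards [Measure.ae_ae_of_ae_prod h1] with x hx
  exact integral_congr_ae hx

theorem avg_add {s : ℝ} (hs : 0 < s) {g g' : Nil ι → ℂ} (hg : Integrable g (haar ι))
    (hg' : Integrable g' (haar ι)) :
    F.avg s (fun x => g x + g' x) =ᵐ[haar ι] fun x => F.avg s g x + F.avg s g' x := by
  filter_upwards [F.ae_integrable_act hs hg, F.ae_integrable_act hs hg'] with x h h'
  exact integral_add h h'

theorem avg_sub {s : ℝ} (hs : 0 < s) {g g' : Nil ι → ℂ} (hg : Integrable g (haar ι))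
    (hg' : Integrable g' (haar ι)) :
    F.avg s (fun x => g x - g' x) =ᵐ[haar ι] fun x => F.avg s g x - F.avg s g' x := by
  filter_upwards [F.ae_integrable_act hs hg, F.ae_integrable_act hs hg'] with x h h'
  exact integral_sub h h'

theorem lintegral_enorm_avg_le {s : ℝ} (hs : 0 < s) {g : Nil ι → ℂ} (hg : Measurable g) :
    ∫⁻ x, ‖F.avg s g x‖ₑ ∂haar ι ≤ ∫⁻ x, ‖g x‖ₑ ∂haar ι := by
  have := isProbabilityMeasure_subord (J := Idx ι) hs
  have hmp := F.measurePreserving_act_expY hs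
  calc ∫⁻ x, ‖F.avg s g x‖ₑ ∂haar ι
      ≤ ∫⁻ x, ∫⁻ p, ‖g (x.act (F.expY p.2))‖ₑ ∂subord (Idx ι) s ∂haar ι :=
        lintegral_mono fun x => enorm_integral_le_lintegral_enorm _
    _ = ∫⁻ z, ‖g (z.1.act (F.expY z.2.2))‖ₑ ∂((haar ι).prod (subord (Idx ι) s)) :=
        (lintegral_prod _ (hg.enorm.comp hmp.measurable).aemeasurable).symm
    _ = _ := hmp.lintegral_comp hg.enorm

theorem integrable_coeFn (g : L2 ι) : Integrable g (haar ι) :=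
  (Lp.memLp g).integrable one_le_two

/-- Both sides are multiplication by the same symbol on waves. Both are continuous from L² to L¹, so
the subspace where they agree is closed and contains the closed span of the waves. -/
theorem negPow_eq_avg {σ : ℝ} (hσ : 0 < σ) (g : L2 ι) :
    F.negPow σ g =ᵐ[haar ι] F.avg (σ / 2) g := by
  have hs : 0 < σ / 2 := by positivity
  let K : Submodule ℂ (L2 ι) :=
    { carrier := {g | F.negPow σ g =ᵐ[haar ι] F.avg (σ / 2) g}
      add_mem' := fun {g g'} hg hg' => by
        have h1 := F.avg_congr hs (Lp.coeFn_add g g')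
        have h2 := F.avg_add hs (integrable_coeFn g) (integrable_coeFn g')
        rw [Set.mem_ofPred_eq, map_add]
        filter_upwards [h1, h2, Lp.coeFn_add (F.negPow σ g) (F.negPow σ g'), hg, hg']
          with x h1 h2 h3 h4 h5
        rw [h3, Pi.add_apply, h4, h5, h1, ← h2]
        rfl
      zero_mem' := by
        rw [Set.mem_ofPred_eq, map_zero]
        filter_upwards [F.avg_congr hs (Lp.coeFn_zero ℂ 2 (haar ι)), Lp.coeFn_zero ℂ 2 (haar ι)]
          with x h1 h2
        rw [h1, h2]
        simp [avg]
      smul_mem' := fun c g hg => by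
        rw [Set.mem_ofPred_eq, map_smul]
        filter_upwards [F.avg_congr hs (Lp.coeFn_smul c g), Lp.coeFn_smul c (F.negPow σ g), hg]
          with x h1 h2 h3
        rw [h1, h2, Pi.smul_apply, h3]
        exact (integral_const_mul c _).symm }
  refine mem_of_wave K ?_ ?_ g
  · refine isClosed_of_closure_subset fun g hg => ?_
    obtain ⟨u, hu, hlim⟩ := mem_closure_iff_seq_limit.1 hg
    have key : ∀ n, ∫⁻ x, ‖F.negPow σ g x - F.avg (σ / 2) g x‖ₑ ∂haar ι
        ≤ ‖F.negPow σ (g - u n)‖ₑ + ‖g - u n‖ₑ := by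
      intro n
      have h1 := F.avg_congr hs (Lp.coeFn_sub g (u n))
      have h2 := F.avg_sub hs (integrable_coeFn g) (integrable_coeFn (u n))
      have h3 := Lp.coeFn_sub (F.negPow σ g) (F.negPow σ (u n))
      rw [← map_sub] at h3
      calc ∫⁻ x, ‖F.negPow σ g x - F.avg (σ / 2) g x‖ₑ ∂haar ι
          ≤ ∫⁻ x, ‖F.negPow σ (g - u n) x‖ₑ + ‖F.avg (σ / 2) (g - u n : L2 ι) x‖ₑ ∂haar ι := by
            refine lintegral_mono_ae ?_
            filter_upwards [h1, h2, h3, hu n] with x h1 h2 h3 h4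
            have h2' : F.avg (σ / 2) (⇑g - ⇑(u n)) x
              = F.avg (σ / 2) g x - F.avg (σ / 2) (u n) x := h2
            rw [h3, h1, h2', Pi.sub_apply, h4]
            refine le_trans (le_of_eq ?_) enorm_sub_le
            congr 1
            ring
        _ = _ := lintegral_add_left (measurable_coeFn _).enorm _
        _ ≤ _ := add_le_add (lintegral_enorm_le _)
            ((F.lintegral_enorm_avg_le hs (measurable_coeFn _)).trans (lintegral_enorm_le _))
    have h0 : Tendsto (fun n => ‖F.negPow σ (g - u n)‖ₑ + ‖g - u n‖ₑ) atTop (𝓝 0) := by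
      have hc : Continuous fun h : L2 ι => ‖F.negPow σ (g - h)‖ₑ + ‖g - h‖ₑ := by fun_prop
      have := (hc.tendsto g).comp hlim
      simpa using! this
    have h4 := le_antisymm (ge_of_tendsto' h0 key) zero_le
    have hm : AEMeasurable (fun x => ‖F.negPow σ g x - F.avg (σ / 2) g x‖ₑ) (haar ι) :=
      ((measurable_coeFn _).aestronglyMeasurable.sub
        (F.integrable_avg hs (integrable_coeFn g)).aestronglyMeasurable).enorm
    rw [lintegral_eq_zero_iff' hm] at h4
    filter_upwards [h4] with x hx
    simpa [sub_eq_zero] using! hx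
  · rintro _ ⟨m, c, hc, rfl⟩
    change F.negPow σ _ =ᵐ[haar ι] F.avg (σ / 2) _
    rw [F.negPow_wave hσ hc]
    refine ((hc.mulSymb F m (-(σ / 2))).smooth_wave m).coeFn_toL2.trans ?_
    rw [← F.avg_wave hs]
    exact F.avg_congr hs (hc.smooth_wave m).coeFn_toL2.symm

end AdaptedBasis

/-! ### Restriction of averages to orbits -/

/-- Cauchy–Schwarz applied to hW^{-1/2} and W^{1/2}Φ. -/
theorem lintegral_mul_le_weighted {α : Type*} [MeasurableSpace α] {μ : Measure α}
    {h Φ W : α → ℝ≥0∞} (hh : Measurable h) (hΦ : Measurable Φ) (hW : Measurable W)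
    (hW0 : ∀ᵐ x ∂μ, W x ≠ 0) (hW1 : ∀ᵐ x ∂μ, W x ≠ ⊤) :
    ∫⁻ x, h x * Φ x ∂μ
      ≤ (∫⁻ x, h x ^ 2 * (W x)⁻¹ ∂μ) ^ (1 / 2 : ℝ) * (∫⁻ x, W x * Φ x ^ 2 ∂μ) ^ (1 / 2 : ℝ) := by
  have hsq : ∀ u : ℝ≥0∞, (u ^ (1 / 2 : ℝ)) ^ (2 : ℝ) = u := fun u => by
    rw [← ENNReal.rpow_mul]; norm_num
  have h1 := ENNReal.lintegral_mul_le_Lp_mul_Lq μ (p := 2) (q := 2) Real.HolderConjugate.two_two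
    (f := fun x => h x * ((W x)⁻¹) ^ (1 / 2 : ℝ)) (g := fun x => (W x) ^ (1 / 2 : ℝ) * Φ x)
    (by fun_prop) (by fun_prop)
  refine le_trans (le_of_eq ?_) (h1.trans (le_of_eq ?_))
  · refine lintegral_congr_ae ?_
    filter_upwards [hW0, hW1] with x h0 h1
    have h2 : ((W x)⁻¹) ^ (1 / 2 : ℝ) * (W x) ^ (1 / 2 : ℝ) = 1 := by
      rw [← ENNReal.mul_rpow_of_nonneg _ _ (by norm_num), ENNReal.inv_mul_cancel h0 h1,
        ENNReal.one_rpow]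
    calc h x * Φ x = h x * (((W x)⁻¹) ^ (1 / 2 : ℝ) * (W x) ^ (1 / 2 : ℝ)) * Φ x := by
          rw [h2, mul_one]
      _ = _ := by simp only [Pi.mul_apply]; ring
  · simp only [ENNReal.mul_rpow_of_nonneg _ _ (zero_le_two : (0 : ℝ) ≤ 2), hsq,
      ENNReal.rpow_ofNat]

/-! ### Weighted Cauchy–Schwarz for heat kernels, and integration over the Gamma law. -/

section Weight

variable {J : Type*} [Fintype J]

/-- An integrable weight on `ℝ^J`. -/
def cauchyWeight (v : J → ℝ) : ℝ := ∏ j, (1 + v j ^ 2)⁻¹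

theorem cauchyWeight_pos (v : J → ℝ) : 0 < cauchyWeight v :=
  Finset.prod_pos fun _ _ => by positivity

theorem continuous_cauchyWeight : Continuous (cauchyWeight (J := J)) := by
  refine continuous_finsetProd _ fun j _ => Continuous.inv₀ (by fun_prop) fun v => ?_
  positivity

theorem lintegral_cauchyWeight :
    ∫⁻ v : J → ℝ, ENNReal.ofReal (cauchyWeight v)
      = ENNReal.ofReal Real.pi ^ Fintype.card J := by
  have h1 : Integrable (cauchyWeight (J := J)) :=
    Integrable.fintype_prod (f := fun (_ : J) (x : ℝ) => (1 + x ^ 2)⁻¹)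
      fun _ => integrable_inv_one_add_sq
  rw [← ofReal_integral_eq_lintegral_ofReal h1
    (Eventually.of_forall fun v => (cauchyWeight_pos v).le),
    ← ENNReal.ofReal_pow Real.pi_pos.le]
  simp only [cauchyWeight]
  rw [integral_fintype_prod_volume_eq_prod (fun (_ : J) (x : ℝ) => (1 + x ^ 2)⁻¹)]
  simp [integral_univ_inv_one_add_sq]

/-- In each coordinate 1 + (v − s)² ≤ 2(1 + v²) when |s| ≤ 1/2. Polynomial decay is what makes the
weight comparable to its shifts uniformly in v; a Gaussian weight would fail here. -/
theorem cauchyWeight_le (v : J → ℝ) {s : J → ℝ} (hs : s ∈ cube J) :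
    cauchyWeight v ≤ 2 ^ Fintype.card J * cauchyWeight (v - s) := by
  have h : (2 : ℝ) ^ Fintype.card J = ∏ _j : J, 2 := by simp
  rw [h, cauchyWeight, cauchyWeight, ← Finset.prod_mul_distrib]
  refine Finset.prod_le_prod (fun j _ => by positivity) fun j _ => ?_
  have h1 := abs_le.1 (hs j)
  rw [Pi.sub_apply, ← div_eq_mul_inv, inv_eq_one_div, div_le_div_iff₀ (by positivity)
    (by positivity)]
  nlinarith [sq_nonneg (v j + s j)]

/-- One factor of each Gaussian density is bounded by its maximum. The other is a probability
density, against which 1 + x² has mean 1 + 2τ. -/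
theorem lintegral_heat_sq_le {τ : ℝ} (hτ : 0 < τ) :
    ∫⁻ v : J → ℝ, ENNReal.ofReal (heat τ v) ^ 2 * (ENNReal.ofReal (cauchyWeight v))⁻¹
      ≤ ENNReal.ofReal (((√(2 * Real.pi * (2 * τ)))⁻¹ * (1 + 2 * τ)) ^ Fintype.card J) := by
  set G : ℝ := (√(2 * Real.pi * (2 * τ)))⁻¹ with hG
  have hG0 : 0 ≤ G := by positivity
  set w : ℝ≥0 := (2 * τ).toNNReal with hw
  have hw0 : w ≠ 0 := by simpa [hw] using hτ
  have hwr : (w : ℝ) = 2 * τ := Real.coe_toNNReal _ (by positivity)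
  let g : ℝ → ℝ := ProbabilityTheory.gaussianPDFReal 0 w
  have hgG : ∀ x, g x ≤ G := by
    intro x
    simp only [g, ProbabilityTheory.gaussianPDFReal, hwr]
    refine mul_le_of_le_one_right hG0 (Real.exp_le_one_iff.2 ?_)
    rw [neg_div]
    exact neg_nonpos.2 (by positivity)
  have hg0 : ∀ x, 0 ≤ g x := fun x => ProbabilityTheory.gaussianPDFReal_nonneg _ _ _
  have hint1 : Integrable (fun x : ℝ => 1 + x ^ 2) (ProbabilityTheory.gaussianReal 0 w) :=
    (integrable_const _).add (ProbabilityTheory.memLp_id_gaussianReal 2).integrable_sq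
  have hint : Integrable (fun x : ℝ => g x * (1 + x ^ 2)) := by
    rw [ProbabilityTheory.gaussianReal_of_var_ne_zero 0 hw0,
      integrable_withDensity_iff_integrable_smul' (ProbabilityTheory.measurable_gaussianPDF 0 w)
      (Eventually.of_forall fun _ => ProbabilityTheory.gaussianPDF_lt_top)] at hint1
    simpa only [ProbabilityTheory.toReal_gaussianPDF, smul_eq_mul] using! hint1
  have hval : ∫ x : ℝ, g x * (1 + x ^ 2) = 1 + 2 * τ := by
    have h1 := ProbabilityTheory.integral_gaussianReal_eq_integral_smul (μ := 0) hw0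
      (f := fun x : ℝ => 1 + x ^ 2)
    simp only [smul_eq_mul] at h1
    have h3 : Integrable (fun x : ℝ => x ^ 2) (ProbabilityTheory.gaussianReal 0 w) :=
      (ProbabilityTheory.memLp_id_gaussianReal 2).integrable_sq
    rw [← h1, integral_add (integrable_const _) h3]
    have h2 := ProbabilityTheory.variance_fun_id_gaussianReal (μ := 0) (v := w)
    rw [ProbabilityTheory.variance_of_integral_eq_zero (by fun_prop)
      (by simp)] at h2
    rw [h2]
    simp [hwr]
  have hpt : ∀ v : J → ℝ, ENNReal.ofReal (heat τ v) ^ 2 * (ENNReal.ofReal (cauchyWeight v))⁻¹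
      ≤ ENNReal.ofReal (∏ j, G * (g (v j) * (1 + v j ^ 2))) := by
    intro v
    rw [← ENNReal.ofReal_pow (heat_nonneg τ v), ← ENNReal.ofReal_inv_of_pos (cauchyWeight_pos v),
      ← ENNReal.ofReal_mul (sq_nonneg _)]
    refine ENNReal.ofReal_le_ofReal ?_
    rw [heat, cauchyWeight, ← Finset.prod_inv_distrib, ← Finset.prod_pow,
      ← Finset.prod_mul_distrib]
    refine Finset.prod_le_prod (fun j _ => by positivity) fun j _ => ?_
    rw [inv_inv, ← mul_assoc, sq]
    gcongr
    · exact hg0 _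
    · exact hgG _
  refine (lintegral_mono hpt).trans (le_of_eq ?_)
  rw [← ofReal_integral_eq_lintegral_ofReal]
  · rw [integral_fintype_prod_volume_eq_prod (fun (_ : J) (x : ℝ) => G * (g x * (1 + x ^ 2)))]
    simp only [integral_const_mul, hval, Finset.prod_const, Finset.card_univ]
  · exact Integrable.fintype_prod (f := fun (_ : J) (x : ℝ) => G * (g x * (1 + x ^ 2)))
      fun _ => hint.const_mul G
  · refine Eventually.of_forall fun v => Finset.prod_nonneg fun j _ => ?_
    exact mul_nonneg hG0 (mul_nonneg (hg0 _) (by positivity))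

/-- As the fibres lie in the cube, the weight at v times the fibre volume is at most 2^a times the
integral over the fibre of the weight at v − s. Replacing v by s + v turns the left side into a
weighted average over v of the quantities bounded by Q, and the total mass of the weight is π^a. -/
theorem lintegral_weight_le {S : Set (ℝ × (J → ℝ))} (hS : MeasurableSet S)
    (hcube : ∀ p ∈ S, p.2 ∈ cube J) {Ψ : ℝ × (J → ℝ) → ℝ≥0∞} (hΨ : Measurable Ψ)
    {I : Set ℝ} {Q : ℝ≥0∞}
    (hQ : ∀ v, ∫⁻ t in I, ∫⁻ s, S.indicator 1 (t, s) * Ψ (t, s + v) ^ 2 ≤ Q) :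
    ∫⁻ t in I, ∫⁻ v, ENNReal.ofReal (cauchyWeight v) * volume {s | (t, s) ∈ S} * Ψ (t, v) ^ 2
      ≤ 2 ^ Fintype.card J * (ENNReal.ofReal Real.pi ^ Fintype.card J * Q) := by
  set a := Fintype.card J
  set χ : ℝ × (J → ℝ) → ℝ≥0∞ := S.indicator 1 with hχ
  have hχm : Measurable χ := measurable_one.indicator hS
  set μ : (J → ℝ) → ℝ≥0∞ := fun v => ENNReal.ofReal (cauchyWeight v) with hμ
  have hμm : Measurable μ := continuous_cauchyWeight.measurable.ennreal_ofReal
  have h1 : ∀ t v, μ v * volume {s | (t, s) ∈ S} ≤ 2 ^ a * ∫⁻ s, χ (t, s) * μ (v - s) := by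
    intro t v
    have hSt : MeasurableSet {s | (t, s) ∈ S} := measurable_prodMk_left hS
    rw [← setLIntegral_const, ← lintegral_indicator hSt,
      ← lintegral_const_mul' _ _ (by finiteness)]
    refine lintegral_mono fun s => ?_
    by_cases hs : (t, s) ∈ S
    · have h2 : χ (t, s) = 1 := Set.indicator_of_mem hs _
      rw [Set.indicator_of_mem (s := {s | (t, s) ∈ S}) hs, h2, one_mul]
      have h3 := ENNReal.ofReal_le_ofReal (cauchyWeight_le v (hcube _ hs))
      rw [ENNReal.ofReal_mul (by positivity), ENNReal.ofReal_pow zero_le_two,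
        ENNReal.ofReal_ofNat] at h3
      exact h3
    · rw [Set.indicator_of_notMem (s := {s | (t, s) ∈ S}) hs]
      exact zero_le
  have h2 : ∀ t, ∫⁻ v, (∫⁻ s, χ (t, s) * μ (v - s)) * Ψ (t, v) ^ 2
      = ∫⁻ v, μ v * ∫⁻ s, χ (t, s) * Ψ (t, s + v) ^ 2 := by
    intro t
    calc ∫⁻ v, (∫⁻ s, χ (t, s) * μ (v - s)) * Ψ (t, v) ^ 2
        = ∫⁻ v, ∫⁻ s, χ (t, s) * μ (v - s) * Ψ (t, v) ^ 2 := by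
          refine lintegral_congr fun v => (lintegral_mul_const _ ?_).symm
          exact (hχm.comp measurable_prodMk_left).mul
            (hμm.comp (measurable_const.sub measurable_id))
      _ = ∫⁻ s, ∫⁻ v, χ (t, s) * μ (v - s) * Ψ (t, v) ^ 2 := by
          refine lintegral_lintegral_swap (Measurable.aemeasurable ?_)
          exact ((hχm.comp (measurable_const.prodMk measurable_snd)).mul
            (hμm.comp (measurable_fst.sub measurable_snd))).mul
            ((hΨ.comp (measurable_const.prodMk measurable_fst)).pow_const 2)
      _ = ∫⁻ s, ∫⁻ v, χ (t, s) * μ v * Ψ (t, s + v) ^ 2 := by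
          refine lintegral_congr fun s => ?_
          rw [← lintegral_add_left_eq_self _ s]
          simp only [add_sub_cancel_left]
      _ = ∫⁻ v, ∫⁻ s, χ (t, s) * μ v * Ψ (t, s + v) ^ 2 := by
          refine lintegral_lintegral_swap (Measurable.aemeasurable ?_)
          exact ((hχm.comp (measurable_const.prodMk measurable_fst)).mul
            (hμm.comp measurable_snd)).mul
            ((hΨ.comp (measurable_const.prodMk (measurable_fst.add measurable_snd))).pow_const 2)
      _ = _ := by
          refine lintegral_congr fun v => ?_
          rw [← lintegral_const_mul]
          · refine lintegral_congr fun s => by ring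
          · exact (hχm.comp measurable_prodMk_left).mul
              ((hΨ.comp (measurable_const.prodMk (measurable_id.add measurable_const))).pow_const 2)
  have hm2 : Measurable fun z : ℝ × (J → ℝ) => ∫⁻ s, χ (z.1, s) * Ψ (z.1, s + z.2) ^ 2 := by
    refine Measurable.lintegral_prod_right' (f := fun y : (ℝ × (J → ℝ)) × (J → ℝ) =>
      χ (y.1.1, y.2) * Ψ (y.1.1, y.2 + y.1.2) ^ 2) ?_
    exact (hχm.comp ((measurable_fst.comp measurable_fst).prodMk measurable_snd)).mul
      ((hΨ.comp ((measurable_fst.comp measurable_fst).prodMk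
        (measurable_snd.add (measurable_snd.comp measurable_fst)))).pow_const 2)
  calc ∫⁻ t in I, ∫⁻ v, μ v * volume {s | (t, s) ∈ S} * Ψ (t, v) ^ 2
      ≤ ∫⁻ t in I, ∫⁻ v, 2 ^ a * ((∫⁻ s, χ (t, s) * μ (v - s)) * Ψ (t, v) ^ 2) := by
        refine lintegral_mono fun t => lintegral_mono fun v => ?_
        rw [← mul_assoc]
        exact mul_le_mul_left (h1 t v) _
    _ = ∫⁻ t in I, 2 ^ a * ∫⁻ v, μ v * ∫⁻ s, χ (t, s) * Ψ (t, s + v) ^ 2 := by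
        refine lintegral_congr fun t => ?_
        rw [lintegral_const_mul' _ _ (by finiteness), h2]
    _ = 2 ^ a * ∫⁻ t in I, ∫⁻ v, μ v * ∫⁻ s, χ (t, s) * Ψ (t, s + v) ^ 2 :=
        lintegral_const_mul' _ _ (by finiteness)
    _ = 2 ^ a * ∫⁻ v, ∫⁻ t in I, μ v * ∫⁻ s, χ (t, s) * Ψ (t, s + v) ^ 2 := by
        rw [lintegral_lintegral_swap (Measurable.aemeasurable
          ((hμm.comp measurable_snd).mul hm2))]
    _ ≤ 2 ^ a * ∫⁻ v, μ v * Q := by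
        gcongr with v
        rw [lintegral_const_mul' _ _ ENNReal.ofReal_ne_top]
        gcongr
        exact hQ v
    _ = _ := by rw [lintegral_mul_const _ hμm, lintegral_cauchyWeight]

/-- The constant for averages over the heat kernel at time `τ`. -/
def heatConst (a : ℕ) (τ : ℝ) : ℝ :=
  √((2 * Real.pi * ((√(2 * Real.pi * (2 * τ)))⁻¹ * (1 + 2 * τ))) ^ a)

/-- Cauchy–Schwarz in (t, v) with the weight `cauchyWeight` v · V t: the heat kernel side separates
into a constant and ∫ 1/V, and the other side is `hB`. -/
theorem lintegral_heat_le_of_weight {Ψ : ℝ × (J → ℝ) → ℝ≥0∞} (hΨ : Measurable Ψ)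
    {I : Set ℝ} (hI : MeasurableSet I) {V : ℝ → ℝ≥0∞} (hVm : Measurable V)
    (hpos : ∀ t ∈ I, V t ≠ 0) (hVfin : ∀ t, V t ≠ ⊤) {Q : ℝ≥0∞}
    (hB : ∫⁻ t in I, ∫⁻ v, ENNReal.ofReal (cauchyWeight v) * V t * Ψ (t, v) ^ 2
      ≤ 2 ^ Fintype.card J * (ENNReal.ofReal Real.pi ^ Fintype.card J * Q))
    {τ : ℝ} (hτ : 0 < τ) :
    ∫⁻ t in I, ∫⁻ v, ENNReal.ofReal (heat τ v) * Ψ (t, v)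
      ≤ ENNReal.ofReal (heatConst (Fintype.card J) τ)
        * (Q * ∫⁻ t in I, (V t)⁻¹) ^ (1 / 2 : ℝ) := by
  set a := Fintype.card J
  have hh : Measurable fun v : J → ℝ => ENNReal.ofReal (heat τ v) :=
    (measurable_heat.comp measurable_prodMk_left).ennreal_ofReal
  have hμm : Measurable fun v : J → ℝ => ENNReal.ofReal (cauchyWeight v) :=
    continuous_cauchyWeight.measurable.ennreal_ofReal
  have hhm : Measurable fun z : ℝ × (J → ℝ) => ENNReal.ofReal (heat τ z.2) :=
    hh.comp measurable_snd
  have hWm : Measurable fun z : ℝ × (J → ℝ) => ENNReal.ofReal (cauchyWeight z.2) * V z.1 :=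
    (hμm.comp measurable_snd).mul (hVm.comp measurable_fst)
  have hI' : ∀ᵐ z ∂((volume.restrict I).prod (volume : Measure (J → ℝ))), z.1 ∈ I :=
    Measure.quasiMeasurePreserving_fst.ae (ae_restrict_mem hI)
  have hcs := lintegral_mul_le_weighted
    (μ := (volume.restrict I).prod (volume : Measure (J → ℝ))) hhm hΨ hWm
    (by
      filter_upwards [hI'] with z hz
      exact mul_ne_zero (by simpa using cauchyWeight_pos z.2) (hpos z.1 hz))
    (Eventually.of_forall fun z => ENNReal.mul_ne_top ENNReal.ofReal_ne_top (hVfin _))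
  have hm1 : Measurable fun z => ENNReal.ofReal (heat τ z.2) * Ψ z := hhm.mul hΨ
  have hm2 : Measurable fun z : ℝ × (J → ℝ) => ENNReal.ofReal (heat τ z.2) ^ 2
      * (ENNReal.ofReal (cauchyWeight z.2) * V z.1)⁻¹ := (hhm.pow_const 2).mul hWm.inv
  have hm3 : Measurable fun z => ENNReal.ofReal (cauchyWeight z.2) * V z.1 * Ψ z ^ 2 :=
    hWm.mul (hΨ.pow_const 2)
  rw [lintegral_prod _ hm1.aemeasurable, lintegral_prod _ hm2.aemeasurable,
    lintegral_prod _ hm3.aemeasurable] at hcs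
  refine hcs.trans ?_
  have hA : ∫⁻ t in I, ∫⁻ v : J → ℝ, ENNReal.ofReal (heat τ v) ^ 2
        * (ENNReal.ofReal (cauchyWeight v) * V t)⁻¹
      ≤ ENNReal.ofReal (((√(2 * Real.pi * (2 * τ)))⁻¹ * (1 + 2 * τ)) ^ a)
        * ∫⁻ t in I, (V t)⁻¹ := by
    have hVi : Measurable fun t => (V t)⁻¹ := hVm.inv
    rw [← lintegral_const_mul _ hVi]
    refine setLIntegral_mono' hI fun t ht => ?_
    have h1 : ∀ v : J → ℝ, ENNReal.ofReal (heat τ v) ^ 2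
        * (ENNReal.ofReal (cauchyWeight v) * V t)⁻¹
        = ENNReal.ofReal (heat τ v) ^ 2 * (ENNReal.ofReal (cauchyWeight v))⁻¹ * (V t)⁻¹ := by
      intro v
      rw [ENNReal.mul_inv (Or.inr (hVfin t)) (Or.inr (hpos t ht)), mul_assoc]
    simp only [h1]
    have hm4 : Measurable fun v : J → ℝ => ENNReal.ofReal (heat τ v) ^ 2
        * (ENNReal.ofReal (cauchyWeight v))⁻¹ := (hh.pow_const 2).mul hμm.inv
    rw [lintegral_mul_const _ hm4]
    exact mul_le_mul_left (lintegral_heat_sq_le hτ) _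
  rw [← ENNReal.mul_rpow_of_nonneg _ _ (by norm_num)]
  have hk : ENNReal.ofReal (heatConst a τ) = (2 ^ a * (ENNReal.ofReal Real.pi ^ a
      * ENNReal.ofReal (((√(2 * Real.pi * (2 * τ)))⁻¹ * (1 + 2 * τ)) ^ a))) ^ (1 / 2 : ℝ) := by
    rw [heatConst, Real.sqrt_eq_rpow, ← ENNReal.ofReal_rpow_of_nonneg (by positivity)
      (by norm_num), mul_pow, mul_pow, ENNReal.ofReal_mul (by positivity),
      ENNReal.ofReal_mul (by positivity), ENNReal.ofReal_pow zero_le_two,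
      ENNReal.ofReal_pow Real.pi_pos.le, ENNReal.ofReal_ofNat, mul_assoc]
  rw [hk, ← ENNReal.mul_rpow_of_nonneg _ _ (by norm_num)]
  refine ENNReal.rpow_le_rpow ((mul_le_mul' hA hB).trans (le_of_eq ?_)) (by norm_num)
  ring

theorem lintegral_heat_le {S : Set (ℝ × (J → ℝ))} (hS : MeasurableSet S)
    (hcube : ∀ p ∈ S, p.2 ∈ cube J) {Ψ : ℝ × (J → ℝ) → ℝ≥0∞} (hΨ : Measurable Ψ)
    {I : Set ℝ} (hI : MeasurableSet I) (hpos : ∀ t ∈ I, volume {s | (t, s) ∈ S} ≠ 0)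
    {Q : ℝ≥0∞} (hQ : ∀ v, ∫⁻ t in I, ∫⁻ s, S.indicator 1 (t, s) * Ψ (t, s + v) ^ 2 ≤ Q)
    {τ : ℝ} (hτ : 0 < τ) :
    ∫⁻ t in I, ∫⁻ v, ENNReal.ofReal (heat τ v) * Ψ (t, v)
      ≤ ENNReal.ofReal (heatConst (Fintype.card J) τ)
        * (Q * ∫⁻ t in I, (volume {s | (t, s) ∈ S})⁻¹) ^ (1 / 2 : ℝ) := by
  have hcubefin : volume (cube J) < ⊤ := by
    have : cube J ⊆ Metric.closedBall 0 (1 / 2) := fun s hs => by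
      rw [mem_closedBall_zero_iff, pi_norm_le_iff_of_nonneg (by norm_num)]
      exact hs
    exact (measure_mono this).trans_lt measure_closedBall_lt_top
  exact lintegral_heat_le_of_weight hΨ hI (measurable_measure_prodMk_left hS) hpos
    (fun t => ((measure_mono (fun s hs => hcube _ hs :
      {s | (t, s) ∈ S} ⊆ cube J)).trans_lt hcubefin).ne)
    (lintegral_weight_le hS hcube hΨ hQ) hτ

/-- The constant for averages over `subord`. -/
def subordConst (a : ℕ) (s : ℝ) : ℝ≥0∞ :=
  ∫⁻ τ, ENNReal.ofReal (heatConst a τ) ∂ProbabilityTheory.gammaMeasure s 1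

theorem measurable_heatConst (a : ℕ) : Measurable (heatConst a) := by
  unfold heatConst
  fun_prop

/-- Near τ = 0 the constant is of order τ^{-a/4}, integrable against τ^{s-1} because s > a/4. For
large τ its growth is dominated by e^{τ/2}, which the factor e^{-τ} absorbs. -/
theorem subordConst_ne_top {a : ℕ} {s : ℝ} (hs : (a : ℝ) / 4 < s) : subordConst a s ≠ ⊤ := by
  -- Chosen so that 1 + 2τ ≤ c e^{τ/(a+1)}, whose a-th power is at most c^a e^τ, the square of
  -- e^{τ/2} up to a constant. Using a + 1 instead of a also covers a = 0.
  set c : ℝ := 1 + 2 * (a + 1) with hc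
  set D : ℝ := (2 * Real.pi * c) ^ a with hD
  have hbound : ∀ τ : ℝ, 0 < τ →
      heatConst a τ ≤ √D * (τ ^ (-((a : ℝ) / 4)) * Real.exp (τ / 2)) := by
    intro τ hτ
    have h1 : (√(2 * Real.pi * (2 * τ)))⁻¹ ≤ τ ^ (-(1 / 2) : ℝ) := by
      rw [Real.rpow_neg hτ.le, ← Real.sqrt_eq_rpow]
      gcongr
      nlinarith [Real.pi_gt_three]
    have h2 : 1 + 2 * τ ≤ c * Real.exp (τ / (a + 1)) := by
      have h3 := Real.add_one_le_exp (τ / (a + 1))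
      have h4 : 1 ≤ Real.exp (τ / (a + 1)) := Real.one_le_exp (by positivity)
      have h5 : τ = (a + 1) * (τ / (a + 1)) := by field_simp
      have h6 : (a + 1) * (τ / (a + 1)) ≤ (a + 1) * Real.exp (τ / (a + 1)) := by
        gcongr
        linarith
      rw [hc]
      nlinarith
    rw [heatConst]
    refine Real.sqrt_le_iff.2 ⟨by positivity, ?_⟩
    calc (2 * Real.pi * ((√(2 * Real.pi * (2 * τ)))⁻¹ * (1 + 2 * τ))) ^ a
        ≤ (2 * Real.pi * (τ ^ (-(1 / 2) : ℝ) * (c * Real.exp (τ / (a + 1))))) ^ a := by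
          gcongr
      _ = D * ((τ ^ (-(1 / 2) : ℝ)) ^ a * Real.exp (τ / (a + 1)) ^ a) := by
          rw [hD]
          ring_nf
      _ ≤ D * ((τ ^ (-((a : ℝ) / 4))) ^ 2 * Real.exp (τ / 2) ^ 2) := by
          rw [← Real.rpow_natCast (τ ^ (-(1 / 2) : ℝ)) a, ← Real.rpow_mul hτ.le,
            ← Real.rpow_natCast (τ ^ (-((a : ℝ) / 4))) 2, ← Real.rpow_mul hτ.le,
            ← Real.exp_nat_mul, ← Real.exp_nat_mul]
          have h7 : (-(1 / 2) : ℝ) * a = -((a : ℝ) / 4) * (2 : ℕ) := by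
            push_cast
            ring
          have h8 : (a : ℝ) * (τ / (a + 1)) ≤ (2 : ℕ) * (τ / 2) := by
            rw [mul_div_assoc', div_le_iff₀ (by positivity)]
            push_cast
            nlinarith
          rw [h7]
          exact mul_le_mul_of_nonneg_left (mul_le_mul_of_nonneg_left (Real.exp_le_exp.2 h8)
            (by positivity)) (by positivity)
      _ = _ := by
          rw [mul_pow, mul_pow, Real.sq_sqrt (by positivity)]
  have hs0 : 0 < s := lt_of_le_of_lt (by positivity) hs
  rw [subordConst, lintegral_gamma s _ (measurable_heatConst a).ennreal_ofReal]
  have hi : IntegrableOn (fun τ : ℝ => (Real.Gamma s)⁻¹ * √D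
      * (τ ^ (s - a / 4 - 1) * Real.exp (-(1 / 2) * τ ^ (1 : ℝ)))) (Set.Ioi 0) :=
    (integrableOn_rpow_mul_exp_neg_mul_rpow (by linarith) one_pos (by norm_num)).const_mul _
  refine ((setLIntegral_mono' measurableSet_Ioi fun τ hτ => ?_).trans_lt
    hi.lintegral_lt_top).ne
  rw [← ENNReal.ofReal_mul (ProbabilityTheory.gammaPDFReal_nonneg hs0 one_pos τ)]
  refine ENNReal.ofReal_le_ofReal ?_
  have hτ' : 0 < τ := hτ
  have hΓ := Real.Gamma_pos_of_pos hs0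
  refine (mul_le_mul_of_nonneg_left (hbound τ hτ)
    (ProbabilityTheory.gammaPDFReal_nonneg hs0 one_pos τ)).trans (le_of_eq ?_)
  rw [ProbabilityTheory.gammaPDFReal, if_pos hτ'.le, Real.one_rpow, one_mul, Real.rpow_one,
    show s - a / 4 - 1 = (s - 1) + -((a : ℝ) / 4) by ring, Real.rpow_add hτ',
    show -(1 / 2) * τ = -τ + τ / 2 by ring, Real.exp_add]
  generalize τ ^ (s - 1) = x, τ ^ (-((a : ℝ) / 4)) = y, Real.exp (-τ) = z, Real.exp (τ / 2) = w
  ring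

/-- Cauchy–Schwarz has already been applied at each fixed τ, so only the resulting constants are
integrated against the Gamma law. -/
theorem lintegral_subord_le {S : Set (ℝ × (J → ℝ))} (hS : MeasurableSet S)
    (hcube : ∀ p ∈ S, p.2 ∈ cube J) {Ψ : ℝ × (J → ℝ) → ℝ≥0∞} (hΨ : Measurable Ψ)
    {I : Set ℝ} (hI : MeasurableSet I) (hpos : ∀ t ∈ I, volume {s | (t, s) ∈ S} ≠ 0)
    {Q : ℝ≥0∞} (hQ : ∀ v, ∫⁻ t in I, ∫⁻ s, S.indicator 1 (t, s) * Ψ (t, s + v) ^ 2 ≤ Q)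
    {s : ℝ} (hs : 0 < s) :
    ∫⁻ t in I, ∫⁻ p, Ψ (t, p.2) ∂subord J s
      ≤ subordConst (Fintype.card J) s
        * (Q * ∫⁻ t in I, (volume {s | (t, s) ∈ S})⁻¹) ^ (1 / 2 : ℝ) := by
  have := isProbabilityMeasure_gamma hs
  have h1 : ∀ t, ∫⁻ p, Ψ (t, p.2) ∂subord J s = ∫⁻ τ, (∫⁻ v, ENNReal.ofReal (heat τ v) * Ψ (t, v))
      ∂ProbabilityTheory.gammaMeasure s 1 := fun t =>
    lintegral_subord s (f := fun p => Ψ (t, p.2))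
      (hΨ.comp (measurable_const.prodMk measurable_snd)) hs
  simp only [h1]
  rw [lintegral_lintegral_swap]
  · rw [subordConst, ← lintegral_mul_const _ (measurable_heatConst _).ennreal_ofReal]
    refine lintegral_mono_ae ?_
    filter_upwards [ae_gamma_pos s] with τ hτ
    exact lintegral_heat_le hS hcube hΨ hI hpos hQ hτ
  · refine Measurable.aemeasurable ?_
    refine Measurable.lintegral_prod_right' (f := fun y : (ℝ × ℝ) × (J → ℝ) =>
      ENNReal.ofReal (heat y.1.2 y.2) * Ψ (y.1.1, y.2)) ?_
    exact (measurable_heat.comp ((measurable_snd.comp measurable_fst).prodMk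
      measurable_snd)).ennreal_ofReal.mul
      (hΨ.comp ((measurable_fst.comp measurable_fst).prodMk measurable_snd))

end Weight

/-! ### Widths and volumes; approximation by smooth functions. -/

theorem innerWidth_le {J : Type*} [Fintype J] [DecidableEq J] (O : Set (J → ℝ)) :
    innerWidth O ≤ volume O :=
  iSup_le fun _ => iSup_le fun _ => iSup_le fun _ => iSup_le fun h => measure_mono h

theorem measurableSet_cube {J : Type*} [Fintype J] : MeasurableSet (cube J) := by
  have : cube J = ⋂ j, {s | |s j| ≤ 1 / 2} := by
    ext s
    simp [cube]
  rw [this]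
  exact MeasurableSet.iInter fun j => measurableSet_le (by fun_prop) measurable_const

theorem cube_eq_closedBall {J : Type*} [Fintype J] : cube J = Metric.closedBall 0 (1 / 2) := by
  ext s
  rw [mem_closedBall_zero_iff, pi_norm_le_iff_of_nonneg (by norm_num)]
  rfl

theorem eLpNorm_two_sq (g : Nil ι → ℂ) :
    ∫⁻ x, ‖g x‖ₑ ^ 2 ∂haar ι = eLpNorm g 2 (haar ι) ^ 2 := by
  rw [eLpNorm_eq_lintegral_rpow_enorm_toReal two_ne_zero ENNReal.ofNat_ne_top,
    ← ENNReal.rpow_natCast (_ ^ _), ← ENNReal.rpow_mul]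
  simp

theorem denseRange_inclLin : DenseRange (AdaptedBasis.inclLin ι) := by
  refine AdaptedBasis.denseRange_of_waveSet _ ?_
  rintro _ ⟨m, c, hc, rfl⟩
  exact ⟨⟨wave m c, hc.smooth_wave m⟩, rfl⟩

theorem exists_smooth_near {g : Nil ι → ℂ} (hg : MemLp g 2 (haar ι)) {ε : ℝ≥0∞} (hε : 0 < ε) :
    ∃ f, Smooth f ∧ eLpNorm (fun x => g x - f x) 2 (haar ι) < ε := by
  have hopen : IsOpen {f : L2 ι | ‖hg.toLp g - f‖ₑ < ε} :=
    isOpen_lt (by fun_prop) continuous_const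
  obtain ⟨f, hf⟩ := denseRange_inclLin.exists_mem_open hopen
    ⟨hg.toLp g, by change ‖hg.toLp g - hg.toLp g‖ₑ < ε; simpa using hε⟩
  refine ⟨f.1, f.2, ?_⟩
  change ‖hg.toLp g - AdaptedBasis.inclLin ι f‖ₑ < ε at hf
  rw [Lp.enorm_def] at hf
  refine lt_of_le_of_lt (le_of_eq (eLpNorm_congr_ae ?_)) hf
  filter_upwards [Lp.coeFn_sub (hg.toLp g) (AdaptedBasis.inclLin ι f), hg.coeFn_toLp,
    Smooth.coeFn_toL2 f.2] with x h1 h2 h3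
  have h3' : (AdaptedBasis.inclLin ι f : Nil ι → ℂ) x = f.1 x := h3
  rw [h1, Pi.sub_apply, h2, h3']

/-- Smooth functions are dense in L², so the bound makes P g a uniform limit of continuous
functions. -/
theorem continuous_of_approx {P : (Nil ι → ℂ) → Nil ι → ℂ} {N : ℝ≥0}
    (hP : ∀ g g' : Nil ι → ℂ, Measurable g → MemLp g 2 (haar ι) → Measurable g' →
      MemLp g' 2 (haar ι) → ∀ x,
      ‖P g x - P g' x‖ₑ ≤ N * eLpNorm (fun x => g x - g' x) 2 (haar ι))
    (hs : ∀ f, Smooth f → Continuous (P f)) {g : Nil ι → ℂ} (hg : Measurable g)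
    (hg2 : MemLp g 2 (haar ι)) : Continuous (P g) := by
  refine continuous_of_uniform_approx_of_continuous fun V hV => ?_
  obtain ⟨ε, hε, hεV⟩ := mem_uniformity_edist.1 hV
  have hδ : 0 < ε / (N + 1) := ENNReal.div_pos hε.ne' (by finiteness)
  obtain ⟨f, hf, hfg⟩ := exists_smooth_near hg2 hδ
  refine ⟨P f, hs f hf, fun x => hεV ?_⟩
  rw [edist_eq_enorm_sub]
  refine (hP g f hg hg2 hf.measurable (hf.memLp 2) x).trans_lt ?_
  rw [ENNReal.lt_div_iff_mul_lt (Or.inl (by simp)) (Or.inl (by finiteness))] at hfg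
  refine lt_of_le_of_lt ?_ hfg
  rw [mul_comm]
  gcongr
  exact le_self_add

/-! ### Estimates for orbit integrals of averages. -/

namespace AdaptedBasis

variable (F : AdaptedBasis ι)

theorem measurable_phi (x : Nil ι) : Measurable (F.phi x) := by
  have : F.phi x = fun p => x.act (F.chart p) := funext fun p => F.phi_eq x p
  rw [this]
  exact Nil.measurable_act.comp (measurable_const.prodMk F.continuous_chart.measurable)

/-- The shifted chart φ_x(t, s + v) is φ_x(t, s) translated by exp(v·Y), and translations preserve
the measure. The bound for the unshifted chart therefore holds for every v with the same right-hand
side. -/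
theorem lintegral_phi_le {S : Set (ℝ × (Idx ι → ℝ))} (hS : MeasurableSet S)
    (hcube : ∀ p ∈ S, p.2 ∈ cube (Idx ι)) {x : Nil ι} {N : ℝ≥0∞}
    (hN : ∀ f : Nil ι → ℝ≥0∞, Measurable f → ∫⁻ p in S, f (F.phi x p) ≤ N * ∫⁻ y, f y ∂haar ι)
    {I : Set ℝ} (hI : MeasurableSet I) (hpos : ∀ t ∈ I, volume {s | (t, s) ∈ S} ≠ 0)
    {Φ : Nil ι → ℝ≥0∞} (hΦ : Measurable Φ) {s : ℝ} (hs : 0 < s) :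
    ∫⁻ t in I, ∫⁻ p, Φ (F.phi x (t, p.2)) ∂subord (Idx ι) s
      ≤ subordConst (Fintype.card (Idx ι)) s
        * ((N * ∫⁻ y, Φ y ^ 2 ∂haar ι) * ∫⁻ t in I, (volume {s | (t, s) ∈ S})⁻¹) ^ (1 / 2 : ℝ) := by
  refine lintegral_subord_le hS hcube (Ψ := fun p => Φ (F.phi x p))
    (hΦ.comp (F.measurable_phi x)) hI hpos (fun v => ?_) hs
  have hm : Measurable fun y : Nil ι => Φ (y.act (F.expY v)) ^ 2 :=
    (hΦ.comp (measurePreserving_act _).measurable).pow_const 2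
  have hm' : Measurable fun p : ℝ × (Idx ι → ℝ) => Φ ((F.phi x p).act (F.expY v)) ^ 2 :=
    hm.comp (F.measurable_phi x)
  calc ∫⁻ t in I, ∫⁻ s, S.indicator 1 (t, s) * Φ (F.phi x (t, s + v)) ^ 2
      ≤ ∫⁻ t, ∫⁻ s, S.indicator 1 (t, s) * Φ (F.phi x (t, s + v)) ^ 2 :=
        setLIntegral_le_lintegral _ _
    _ = ∫⁻ t, ∫⁻ s, S.indicator (fun p => Φ ((F.phi x p).act (F.expY v)) ^ 2) (t, s) := by
        refine lintegral_congr fun t => lintegral_congr fun s => ?_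
        rw [F.phi_add]
        by_cases h : (t, s) ∈ S
        · rw [Set.indicator_of_mem h, Set.indicator_of_mem h, Pi.one_apply, one_mul]
        · rw [Set.indicator_of_notMem h, Set.indicator_of_notMem h, zero_mul]
    _ = ∫⁻ p in S, Φ ((F.phi x p).act (F.expY v)) ^ 2 := by
        rw [← lintegral_indicator hS]
        exact (lintegral_prod _ (hm'.indicator hS).aemeasurable).symm
    _ ≤ N * ∫⁻ y, Φ (y.act (F.expY v)) ^ 2 ∂haar ι := hN _ hm
    _ = N * ∫⁻ y, Φ y ^ 2 ∂haar ι := by rw [lintegral_act (hΦ.pow_const 2)]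

/-- The integral of the averages of `|g|` along the orbit segment of length `T` from `x`. -/
def orbInt (s : ℝ) (g : Nil ι → ℂ) (x : Nil ι) (T : ℝ) : ℝ≥0∞ :=
  ∫⁻ t in Set.Icc 0 T, ∫⁻ p, ‖g (F.phi x (t, p.2))‖ₑ ∂subord (Idx ι) s

variable {F}

theorem orbInt_le_of_admissible (hF : F.Normalised) {s : ℝ} (hs : 0 < s) {g : Nil ι → ℂ}
    (hg : Measurable g) {x : Nil ι} {T : ℝ} {Ω : Set (ℝ × (Idx ι → ℝ))}
    (hΩ : Ω ∈ F.admissible x T) :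
    F.orbInt s g x T ≤ subordConst (Fintype.card (Idx ι)) s * (eLpNorm g 2 (haar ι)
      * (∫⁻ t in Set.Icc 0 T, (widthFun Ω t)⁻¹) ^ (1 / 2 : ℝ)) := by
  obtain ⟨hopen, h0, hcube, hinj⟩ := hΩ
  have h1 := F.lintegral_phi_le hopen.measurableSet hcube (x := x) (N := 1)
    (fun f hf => by
      rw [one_mul]
      exact hF.setLIntegral_phi_le hf hopen.measurableSet x hinj)
    (measurableSet_Icc (a := (0 : ℝ)) (b := T))
    (fun t ht => ((hopen.preimage (Continuous.prodMk_right t)).measure_pos volume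
      ⟨0, h0 t ht⟩).ne') hg.enorm hs
  refine h1.trans ?_
  rw [one_mul, eLpNorm_two_sq, ENNReal.mul_rpow_of_nonneg _ _ (by norm_num),
    ← ENNReal.rpow_ofNat, ← ENNReal.rpow_mul]
  norm_num only [ENNReal.rpow_one]
  gcongr with t
  exact innerWidth_le _

/-- The same estimate on [0,T] × cube, where φ_x may fail to be injective but has multiplicity
bounded uniformly in x. The constant may depend on the basis and on T: it serves only for finiteness
and continuity. -/
theorem exists_orbInt_le (hF : F.Normalised) {s : ℝ} (hs : (Fintype.card (Idx ι) : ℝ) / 4 < s)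
    (T : ℝ) : ∃ N : ℝ≥0, ∀ g : Nil ι → ℂ, Measurable g → ∀ x,
      F.orbInt s g x T ≤ N * eLpNorm g 2 (haar ι) := by
  have hs0 : 0 < s := lt_of_le_of_lt (by positivity) hs
  set S : Set (ℝ × (Idx ι → ℝ)) := Set.Icc 0 T ×ˢ cube (Idx ι) with hSdef
  have hS : MeasurableSet S := measurableSet_Icc.prod measurableSet_cube
  have hSc : IsCompact S := isCompact_Icc.prod
    (by rw [cube_eq_closedBall]; exact isCompact_closedBall _ _)
  obtain ⟨N, hN⟩ := hF.exists_setLIntegral_phi_le hSc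
  have hv : ∀ t ∈ Set.Icc 0 T, volume {s | (t, s) ∈ S} = volume (cube (Idx ι)) := by
    intro t ht
    congr 1
    ext v
    exact ⟨fun h => h.2, fun h => ⟨ht, h⟩⟩
  have hvpos : volume (cube (Idx ι)) ≠ 0 := by
    rw [cube_eq_closedBall]
    exact (Metric.measure_closedBall_pos volume _ (by norm_num)).ne'
  set M : ℝ≥0∞ := subordConst (Fintype.card (Idx ι)) s
    * (N * ∫⁻ t in Set.Icc 0 T, (volume {s | (t, s) ∈ S})⁻¹) ^ (1 / 2 : ℝ) with hM
  have hMfin : M ≠ ⊤ := by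
    refine ENNReal.mul_ne_top (subordConst_ne_top hs) (ENNReal.rpow_ne_top_of_nonneg
      (by norm_num) (ENNReal.mul_ne_top ENNReal.coe_ne_top ?_))
    rw [setLIntegral_congr_fun (g := fun _ => (volume (cube (Idx ι)))⁻¹) measurableSet_Icc
      fun t ht => by simp only [hv t ht], setLIntegral_const]
    exact ENNReal.mul_ne_top (ENNReal.inv_ne_top.2 hvpos) (by simp)
  refine ⟨M.toNNReal, fun g hg x => ?_⟩
  rw [ENNReal.coe_toNNReal hMfin]
  have h1 := F.lintegral_phi_le hS (fun p hp => hp.2) (x := x) (N := N)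
    (fun f hf => hN f hf x) (measurableSet_Icc (a := (0 : ℝ)) (b := T))
    (fun t ht => by rw [hv t ht]; exact hvpos) hg.enorm hs0
  refine h1.trans (le_of_eq ?_)
  rw [eLpNorm_two_sq, mul_right_comm, ENNReal.mul_rpow_of_nonneg _ (_ ^ 2) (by norm_num),
    ← ENNReal.rpow_ofNat, ← ENNReal.rpow_mul, hM]
  norm_num only [ENNReal.rpow_one]
  ring

variable (F)

/-- The integral of `avg s g` along the orbit segment of length `r` from `x`. -/
def orb (s : ℝ) (g : Nil ι → ℂ) (r : ℝ) (x : Nil ι) : ℂ :=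
  ∫ t in (0 : ℝ)..r, F.avg s g (x.act (expG (t • F.X)))

theorem avg_act (s : ℝ) (g : Nil ι → ℂ) (x : Nil ι) (t : ℝ) :
    F.avg s g (x.act (expG (t • F.X))) = ∫ p, g (F.phi x (t, p.2)) ∂subord (Idx ι) s := by
  simp only [avg, phi_eq_act]

variable {F}

theorem measurable_phi_snd {g : Nil ι → ℂ} (hg : Measurable g) (x : Nil ι) :
    Measurable fun z : ℝ × (ℝ × (Idx ι → ℝ)) => g (F.phi x (z.1, z.2.2)) :=
  hg.comp ((F.measurable_phi x).comp
    (measurable_fst.prodMk (measurable_snd.comp measurable_snd)))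

theorem stronglyMeasurable_avg_act {s : ℝ} (hs : 0 < s) {g : Nil ι → ℂ} (hg : Measurable g)
    (x : Nil ι) : StronglyMeasurable fun t : ℝ => F.avg s g (x.act (expG (t • F.X))) := by
  have := isProbabilityMeasure_subord (J := Idx ι) hs
  simp only [avg_act]
  exact (measurable_phi_snd hg x).stronglyMeasurable.integral_prod_right

theorem lintegral_enorm_avg_act_le (s : ℝ) (g : Nil ι → ℂ) (x : Nil ι) (T : ℝ) :
    ∫⁻ t in Set.Icc 0 T, ‖F.avg s g (x.act (expG (t • F.X)))‖ₑ ≤ F.orbInt s g x T := by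
  refine lintegral_mono fun t => ?_
  rw [avg_act]
  exact enorm_integral_le_lintegral_enorm _

theorem integrableOn_avg_act {s : ℝ} (hs : 0 < s) {g : Nil ι → ℂ} (hg : Measurable g)
    {x : Nil ι} {T : ℝ} (hfin : F.orbInt s g x T ≠ ⊤) :
    IntegrableOn (fun t : ℝ => F.avg s g (x.act (expG (t • F.X)))) (Set.Icc 0 T) :=
  ⟨(stronglyMeasurable_avg_act hs hg x).aestronglyMeasurable,
    (lintegral_enorm_avg_act_le s g x T).trans_lt hfin.lt_top⟩

theorem intervalIntegrable_avg_act {s : ℝ} (hs : 0 < s) {g : Nil ι → ℂ} (hg : Measurable g)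
    {x : Nil ι} {T : ℝ} (hfin : F.orbInt s g x T ≠ ⊤) {a b : ℝ} (ha : a ∈ Set.Icc 0 T)
    (hb : b ∈ Set.Icc 0 T) :
    IntervalIntegrable (fun t : ℝ => F.avg s g (x.act (expG (t • F.X)))) volume a b := by
  rw [intervalIntegrable_iff]
  refine (integrableOn_avg_act hs hg hfin).mono_set ?_
  exact Set.uIoc_subset_uIcc.trans (Set.uIcc_subset_Icc ha hb)

theorem enorm_intervalIntegral_le {f : ℝ → ℂ} {a b T : ℝ} (ha : a ∈ Set.Icc 0 T)
    (hb : b ∈ Set.Icc 0 T) :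
    ‖∫ t in a..b, f t‖ₑ ≤ ∫⁻ t in Set.Icc 0 T, ‖f t‖ₑ := by
  have h : ‖∫ t in a..b, f t‖ₑ = ‖∫ t in Set.uIoc a b, f t‖ₑ := by
    simp only [← ofReal_norm, intervalIntegral.norm_intervalIntegral_eq]
  rw [h]
  refine (enorm_integral_le_lintegral_enorm _).trans (lintegral_mono_set ?_)
  exact Set.uIoc_subset_uIcc.trans (Set.uIcc_subset_Icc ha hb)

theorem enorm_orb_le (s : ℝ) (g : Nil ι → ℂ) (x : Nil ι) {r T : ℝ} (hr : r ∈ Set.Icc 0 T) :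
    ‖F.orb s g r x‖ₑ ≤ F.orbInt s g x T :=
  (enorm_intervalIntegral_le ⟨le_rfl, hr.1.trans hr.2⟩ hr).trans
    (lintegral_enorm_avg_act_le s g x T)

theorem ae_integrable_phi {s : ℝ} {g : Nil ι → ℂ} (hs : 0 < s) (hg : Measurable g) {x : Nil ι}
    {T : ℝ} (hfin : F.orbInt s g x T ≠ ⊤) : ∀ᵐ t ∂(volume.restrict (Set.Icc 0 T)),
      Integrable (fun p : ℝ × (Idx ι → ℝ) => g (F.phi x (t, p.2))) (subord (Idx ι) s) := by
  have := isProbabilityMeasure_subord (J := Idx ι) hs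
  have hm : Measurable fun t : ℝ => ∫⁻ p, ‖g (F.phi x (t, p.2))‖ₑ ∂subord (Idx ι) s :=
    (measurable_phi_snd hg x).enorm.lintegral_prod_right'
  filter_upwards [ae_lt_top hm hfin] with t ht
  exact ⟨((measurable_phi_snd hg x).comp measurable_prodMk_left).aestronglyMeasurable, ht⟩

theorem orb_sub {s : ℝ} (hs : 0 < s) {g g' : Nil ι → ℂ} (hg : Measurable g)
    (hg' : Measurable g') {x : Nil ι} {T : ℝ} (hfin : F.orbInt s g x T ≠ ⊤)
    (hfin' : F.orbInt s g' x T ≠ ⊤) {r : ℝ} (hr : r ∈ Set.Icc 0 T) :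
    F.orb s g r x - F.orb s g' r x = F.orb s (fun y => g y - g' y) r x := by
  have h0 : (0 : ℝ) ∈ Set.Icc 0 T := ⟨le_rfl, hr.1.trans hr.2⟩
  rw [orb, orb, ← intervalIntegral.integral_sub (intervalIntegrable_avg_act hs hg hfin h0 hr)
    (intervalIntegrable_avg_act hs hg' hfin' h0 hr), orb]
  refine intervalIntegral.integral_congr_ae_restrict ?_
  have hsub : Set.uIoc 0 r ⊆ Set.Icc 0 T := Set.uIoc_subset_uIcc.trans (Set.uIcc_subset_Icc h0 hr)
  filter_upwards [ae_restrict_of_ae_restrict_of_subset hsub (ae_integrable_phi hs hg hfin),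
    ae_restrict_of_ae_restrict_of_subset hsub (ae_integrable_phi hs hg' hfin')] with t h h'
  simp only [avg_act]
  exact (integral_sub h h').symm

theorem continuous_avg {s : ℝ} (hs : 0 < s) {f : Nil ι → ℂ} (hf : Continuous f) :
    Continuous (F.avg s f) := by
  have := isProbabilityMeasure_subord (J := Idx ι) hs
  obtain ⟨C, hC⟩ := exists_bound_of_continuous hf
  refine Nil.continuous_iff.2 ?_
  refine continuous_of_dominated (bound := fun _ => C) (fun g => ?_) (fun g => ?_)
    (integrable_const _) (Eventually.of_forall fun p => ?_)
  · exact (hf.comp ((Nil.continuous_act_right (Nil.mk g)).comp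
      (F.continuous_expY.comp continuous_snd))).aestronglyMeasurable
  · exact Eventually.of_forall fun p => hC _
  · exact hf.comp ((Nil.continuous_act_left _).comp Nil.continuous_mk)

end AdaptedBasis

/-- A right translation moves any point to the image of the centre of the box, near which the
measure is Lebesgue. Full support is what upgrades almost-everywhere equality of continuous
functions to equality. -/
instance : (haar ι).IsOpenPosMeasure := by
  refine ⟨fun U hU hne => ?_⟩
  obtain ⟨x, hx⟩ := hne
  set y : ℝ × (Idx ι → ℝ) := (1 / 2, fun _ => 1 / 2) with hy
  obtain ⟨g, rfl⟩ := Nil.mk_surjective x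
  set y' : Grp ι := Grp.of y.1 y.2 with hy'
  set k : Grp ι := y'⁻¹ * g with hk
  have hU' : IsOpen ((fun z : Nil ι => z.act k) ⁻¹' U) := hU.preimage (Nil.continuous_act_left k)
  have hmU : MeasurableSet U := by
    have : MeasurableSet (Nil.mk ⁻¹' U) := (hU.preimage Nil.continuous_mk).measurableSet
    exact this
  rw [← (measurePreserving_act k).measure_preimage hmU.nullMeasurableSet]
  have hmU' : MeasurableSet ((fun z : Nil ι => z.act k) ⁻¹' U) :=
    (measurePreserving_act k).measurable hmU
  have hmkm : Measurable fun p : ℝ × (Idx ι → ℝ) => Nil.mk (Grp.of p.1 p.2) :=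
    Nil.measurable_mk.comp Grp.continuous_of.measurable
  rw [haar, Measure.map_apply hmkm hmU', Measure.restrict_apply (hmkm hmU')]
  refine ne_of_gt ?_
  have hopen : IsOpen ((fun p : ℝ × (Idx ι → ℝ) => Nil.mk (Grp.of p.1 p.2)) ⁻¹'
      ((fun z : Nil ι => z.act k) ⁻¹' U)
      ∩ (Set.Ioo (0 : ℝ) 1 ×ˢ Set.univ.pi fun _ => Set.Ioo (0 : ℝ) 1)) :=
    (hU'.preimage (Nil.continuous_mk.comp Grp.continuous_of)).inter
      (isOpen_Ioo.prod (isOpen_set_pi Set.finite_univ fun _ _ => isOpen_Ioo))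
  refine (hopen.measure_pos volume ⟨y, ?_, ?_⟩).trans_le (measure_mono ?_)
  · change (Nil.mk y').act k ∈ U
    rw [Nil.act_mk, hk, mul_inv_cancel_left]
    exact hx
  · simp only [hy, Set.mem_prod, Set.mem_Ioo, Set.mem_pi, Set.mem_univ, forall_const]
    norm_num
  · refine Set.inter_subset_inter_right _ (Set.prod_mono Set.Ioo_subset_Ico_self ?_)
    exact Set.pi_mono fun _ _ => Set.Ioo_subset_Ico_self

/-! ### Continuity of orbit integrals in the base point. -/

namespace AdaptedBasis

variable {F : AdaptedBasis ι}

theorem orbInt_ne_top (hF : F.Normalised) {s : ℝ} (hs : (Fintype.card (Idx ι) : ℝ) / 4 < s)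
    {g : Nil ι → ℂ} (hg : Measurable g) (hg2 : MemLp g 2 (haar ι)) (x : Nil ι) (T : ℝ) :
    F.orbInt s g x T ≠ ⊤ := by
  obtain ⟨N, hN⟩ := exists_orbInt_le hF hs T
  exact ne_top_of_le_ne_top (ENNReal.mul_ne_top ENNReal.coe_ne_top hg2.2.ne) (hN g hg x)

theorem exists_enorm_orb_sub_le (hF : F.Normalised) {s : ℝ}
    (hs : (Fintype.card (Idx ι) : ℝ) / 4 < s) (T : ℝ) :
    ∃ N : ℝ≥0, ∀ g g' : Nil ι → ℂ, Measurable g → MemLp g 2 (haar ι) → Measurable g' →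
      MemLp g' 2 (haar ι) → ∀ r ∈ Set.Icc 0 T, ∀ x,
      ‖F.orb s g r x - F.orb s g' r x‖ₑ ≤ N * eLpNorm (fun x => g x - g' x) 2 (haar ι) := by
  have hs0 : 0 < s := lt_of_le_of_lt (by positivity) hs
  obtain ⟨N, hN⟩ := exists_orbInt_le hF hs T
  refine ⟨N, fun g g' hg hg2 hg' hg2' r hr x => ?_⟩
  rw [orb_sub hs0 hg hg' (orbInt_ne_top hF hs hg hg2 x T) (orbInt_ne_top hF hs hg' hg2' x T) hr]
  exact (enorm_orb_le s _ x hr).trans (hN _ (hg.sub hg') x)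

theorem continuous_avg_act {s : ℝ} (hs : 0 < s) {f : Nil ι → ℂ} (hf : Continuous f) :
    Continuous fun q : Grp ι × ℝ => F.avg s f ((Nil.mk q.1).act (expG (q.2 • F.X))) :=
  (continuous_avg hs hf).comp (Nil.continuous_mk.comp
    (continuous_fst.mul ((continuous_expG_smul F.X).comp continuous_snd)))

theorem continuous_orb_mk {s : ℝ} (hs : 0 < s) {f : Nil ι → ℂ} (hf : Continuous f) :
    Continuous fun q : Grp ι × ℝ => F.orb s f q.2 (Nil.mk q.1) :=
  intervalIntegral.continuous_parametric_primitive_of_continuous (μ := volume)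
    (f := fun (g : Grp ι) (t : ℝ) => F.avg s f ((Nil.mk g).act (expG (t • F.X)))) (a₀ := 0)
    (continuous_avg_act hs hf)

/-- Averaging smooths only along 𝔞, and a function of the base coordinate alone is left unchanged.
Integrating along X as well makes the result continuous. -/
theorem continuous_orb (hF : F.Normalised) {s : ℝ}
    (hs : (Fintype.card (Idx ι) : ℝ) / 4 < s) {g : Nil ι → ℂ} (hg : Measurable g)
    (hg2 : MemLp g 2 (haar ι)) {r : ℝ} (hr : 0 ≤ r) : Continuous (F.orb s g r) := by
  have hs0 : 0 < s := lt_of_le_of_lt (by positivity) hs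
  obtain ⟨N, hN⟩ := exists_enorm_orb_sub_le hF hs r
  refine continuous_of_approx (P := fun g => F.orb s g r)
    (fun g g' hg hg2 hg' hg2' x => hN g g' hg hg2 hg' hg2' r ⟨hr, le_rfl⟩ x)
    (fun f hf => Nil.continuous_iff.2 ?_) hg hg2
  exact (continuous_orb_mk hs0 hf.continuous).comp (Continuous.prodMk_left r)

theorem intervalIntegrable_orb {s : ℝ} (hs : 0 < s) {g : Nil ι → ℂ}
    (hg : Measurable g) {x : Nil ι} (hfin : F.orbInt s g x 1 ≠ ⊤) :
    IntervalIntegrable (fun r => F.orb s g r x) volume 0 1 := by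
  have h := intervalIntegral.continuousOn_primitive_interval (μ := volume) (a := 0) (b := 1)
    (f := fun t : ℝ => F.avg s g (x.act (expG (t • F.X))))
    (by rw [Set.uIcc_of_le zero_le_one]; exact integrableOn_avg_act hs hg hfin)
  exact h.intervalIntegrable

/-- The mean value of `orb s g r` for `0 ≤ r ≤ 1`. -/
def orbMean (F : AdaptedBasis ι) (s : ℝ) (g : Nil ι → ℂ) (x : Nil ι) : ℂ :=
  ∫ r in (0 : ℝ)..1, F.orb s g r x

theorem continuous_orbMean (hF : F.Normalised) {s : ℝ}
    (hs : (Fintype.card (Idx ι) : ℝ) / 4 < s) {g : Nil ι → ℂ} (hg : Measurable g)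
    (hg2 : MemLp g 2 (haar ι)) : Continuous (F.orbMean s g) := by
  have hs0 : 0 < s := lt_of_le_of_lt (by positivity) hs
  obtain ⟨N, hN⟩ := exists_enorm_orb_sub_le hF hs 1
  refine continuous_of_approx (P := F.orbMean s) (N := N)
    (fun g g' hg hg2 hg' hg2' x => ?_) (fun f hf => Nil.continuous_iff.2 ?_) hg hg2
  · rw [orbMean, orbMean, ← intervalIntegral.integral_sub
      (intervalIntegrable_orb hs0 hg (orbInt_ne_top hF hs hg hg2 x 1))
      (intervalIntegrable_orb hs0 hg' (orbInt_ne_top hF hs hg' hg2' x 1))]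
    refine (enorm_intervalIntegral_le (T := 1) (by simp) (by simp)).trans ?_
    refine (setLIntegral_mono' measurableSet_Icc
      fun r hr => hN g g' hg hg2 hg' hg2' r hr x).trans ?_
    simp
  · exact intervalIntegral.continuous_parametric_intervalIntegral_of_continuous'
      (f := fun (g : Grp ι) (r : ℝ) => F.orb s f r (Nil.mk g)) (continuous_orb_mk hs0 hf.continuous)
      0 1

end AdaptedBasis

/-! ### Transverse Sobolev spaces and Birkhoff averages -/

namespace AdaptedBasis

section Sobolev

variable (F : AdaptedBasis ι)

theorem inner_negPow (σ : ℝ) (g h : L2 ι) :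
    inner ℂ (F.negPow σ g) h = inner ℂ g (F.negPow σ h) :=
  (ContinuousLinearMap.isSelfAdjoint_iff_isSymmetric.1 (F.isSelfAdjoint_negPow σ)) g h

theorem exists_negPow_wave {σ : ℝ} (hσ : 0 < σ) {h : L2 ι} (hh : h ∈ waveSet ι) :
    ∃ k ∈ waveSet ι, F.negPow σ k = h := by
  obtain ⟨m, c, hc, rfl⟩ := hh
  refine ⟨((hc.mulSymb F m (σ / 2)).smooth_wave m).toL2, ⟨m, _, hc.mulSymb F m (σ / 2), rfl⟩, ?_⟩
  rw [F.negPow_wave hσ (hc.mulSymb F m (σ / 2))]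
  refine toL2_congr _ _ ?_
  rw [mulSymb_mulSymb, neg_add_cancel, mulSymb_zero]

/-- The operator is self-adjoint and its range contains the waves, so an element of its kernel is
orthogonal to a dense subspace. -/
theorem negPow_injective {σ : ℝ} (hσ : 0 < σ) : Function.Injective (F.negPow σ) := by
  refine (injective_iff_map_eq_zero _).2 fun g hg => ?_
  have h : g ∈ (ℂ ∙ g)ᗮ := by
    refine mem_of_wave _ (Submodule.isClosed_orthogonal _) (fun h hh => ?_) g
    obtain ⟨k, -, rfl⟩ := F.exists_negPow_wave hσ hh
    refine Submodule.mem_orthogonal_singleton_iff_inner_left.2 ?_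
    rw [inner_negPow, hg, inner_zero_right]
  exact inner_self_eq_zero.1 (Submodule.mem_orthogonal_singleton_iff_inner_left.1 h)

theorem exists_resolvent_pow_of_smooth (k : ℕ) {φ : Nil ι → ℂ} (hφ : Smooth φ) :
    ∃ g : L2 ι, (F.resolvent ^ k) g = hφ.toL2 := by
  induction k generalizing φ with
  | zero => exact ⟨hφ.toL2, by rw [pow_zero, one_apply_eq_self]⟩
  | succ k ih =>
    obtain ⟨g, hg⟩ := ih (F.smooth_opA hφ)
    exact ⟨g, by rw [pow_succ', mul_apply_eq_comp, hg, F.resolvent_opA hφ]⟩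

theorem negPow_two_mul (k : ℕ) : F.negPow (2 * (k + 1 : ℕ)) = F.resolvent ^ (k + 1) := by
  induction k with
  | zero => simpa using F.negPow_two
  | succ k ih =>
    have h : (2 * ((k + 1 + 1 : ℕ) : ℝ)) = 2 * (k + 1 : ℕ) + 2 := by push_cast; ring
    rw [h, F.negPow_add (by positivity) two_pos, ih, negPow_two, pow_succ _ (k + 1)]

/-- Applying I + Δ_Y repeatedly writes φ as a high power of the resolvent applied to some g. Since
2(k + 1) > σ, this power factors through (I + Δ_Y)^{-σ/2}. -/
theorem exists_negPow_of_smooth {σ : ℝ} (hσ : 0 < σ) {φ : Nil ι → ℂ} (hφ : Smooth φ) :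
    ∃ g : L2 ι, F.negPow σ g = hφ.toL2 := by
  obtain ⟨k, hk⟩ := exists_nat_gt σ
  obtain ⟨g, hg⟩ := F.exists_resolvent_pow_of_smooth (k + 1) hφ
  have hk' : σ < 2 * (k + 1 : ℕ) := by push_cast; linarith
  refine ⟨F.negPow (2 * (k + 1 : ℕ) - σ) g, ?_⟩
  rw [← mul_apply_eq_comp, ← F.negPow_add hσ (sub_pos.2 hk'), add_sub_cancel, negPow_two_mul, hg]

theorem tNorm_eq {σ : ℝ} (hσ : 0 < σ) {f : Nil ι → ℂ} {g : L2 ι}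
    (h : F.negPow σ g =ᵐ[haar ι] f) : F.tNorm σ f = ‖g‖ₑ := by
  refine le_antisymm (iInf₂_le g h) (le_iInf₂ fun g' hg' => le_of_eq ?_)
  rw [F.negPow_injective hσ (Lp.ext (h.trans hg'.symm))]

theorem exists_of_tNorm_ne_top {σ : ℝ} {f : Nil ι → ℂ} (h : F.tNorm σ f ≠ ⊤) :
    ∃ g : L2 ι, F.negPow σ g =ᵐ[haar ι] f := by
  by_contra hn
  push Not at hn
  refine h ?_
  simp only [tNorm, iInf_eq_top]
  exact fun g hg => absurd hg (hn g)

theorem negPow_sub_ae {σ : ℝ} {f f' : Nil ι → ℂ} {g g' : L2 ι}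
    (h : F.negPow σ g =ᵐ[haar ι] f) (h' : F.negPow σ g' =ᵐ[haar ι] f') :
    F.negPow σ (g - g') =ᵐ[haar ι] fun x => f x - f' x := by
  rw [map_sub]
  filter_upwards [Lp.coeFn_sub (F.negPow σ g) (F.negPow σ g'), h, h'] with x h1 h2 h3
  rw [h1, Pi.sub_apply, h2, h3]

/-- By injectivity the Sobolev norm is transported from L² through (I + Δ_Y)^{-σ/2}. What remains is
density: preimages of smooth functions are dense, because waves are among them. -/
theorem memW_iff {σ : ℝ} (hσ : 0 < σ) {f : Nil ι → ℂ} :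
    F.MemW σ f ↔ ∃ g : L2 ι, F.negPow σ g =ᵐ[haar ι] f := by
  constructor
  · intro hf
    obtain ⟨φ, hφ, hlt⟩ := hf 1 one_pos
    obtain ⟨g, hg⟩ := F.exists_of_tNorm_ne_top (hlt.trans ENNReal.one_lt_top).ne
    obtain ⟨g', hg'⟩ := F.exists_negPow_of_smooth hσ hφ
    refine ⟨g + g', ?_⟩
    rw [map_add, hg']
    filter_upwards [Lp.coeFn_add (F.negPow σ g) hφ.toL2, hg, hφ.coeFn_toL2] with x h1 h2 h3
    rw [h1, Pi.add_apply, h2, h3, sub_add_cancel]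
  · rintro ⟨g, hg⟩ ε hε
    have hdense : g ∈ ((LinearMap.range (inclLin ι)).comap
        (F.negPow σ : L2 ι →ₗ[ℂ] L2 ι)).topologicalClosure := by
      refine mem_of_wave _ (Submodule.isClosed_topologicalClosure _) (fun h hh => ?_) g
      obtain ⟨m, c, hc, rfl⟩ := hh
      refine subset_closure ?_
      exact ⟨⟨_, (hc.mulSymb F m (-(σ / 2))).smooth_wave m⟩, (F.negPow_wave hσ hc).symm⟩
    have hopen : IsOpen {h : L2 ι | ‖g - h‖ₑ < ε} := isOpen_lt (by fun_prop) continuous_const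
    obtain ⟨h, hlt, ⟨φ, hφ⟩⟩ := mem_closure_iff.1 hdense _ hopen
      (by change ‖g - g‖ₑ < ε; simpa using hε)
    refine ⟨φ.1, φ.2, ?_⟩
    have h1 : F.negPow σ h =ᵐ[haar ι] φ.1 := by
      have h2 : F.negPow σ h = Smooth.toL2 φ.2 := hφ.symm
      rw [h2]
      exact Smooth.coeFn_toL2 φ.2
    rw [F.tNorm_eq hσ (F.negPow_sub_ae hg h1)]
    exact hlt

end Sobolev

variable {F : AdaptedBasis ι}

theorem memLp_coeFn (g : L2 ι) : MemLp g 2 (haar ι) := Lp.memLp g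

theorem measurable_avg {s : ℝ} (hs : 0 < s) {g : Nil ι → ℂ} (hg : Measurable g) :
    Measurable (F.avg s g) := by
  have := isProbabilityMeasure_subord (J := Idx ι) hs
  have hm : Measurable fun z : Nil ι × (ℝ × (Idx ι → ℝ)) => g (z.1.act (F.expY z.2.2)) :=
    hg.comp (F.measurePreserving_act_expY hs).measurable
  exact hm.stronglyMeasurable.integral_prod_right.measurable

/-- The relation φ = avg g holds only almost everywhere and says nothing on one orbit. By invariance
and Fubini the two orbit integrals agree for almost every x, and both are continuous in x. -/
theorem integral_smooth_eq_orb (hF : F.Normalised) {σ : ℝ}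
    (hσ : (Fintype.card (Idx ι) : ℝ) / 2 < σ) {φ : Nil ι → ℂ} (hφ : Smooth φ) {g : L2 ι}
    (hg : F.negPow σ g =ᵐ[haar ι] φ) {T : ℝ} (hT : 0 ≤ T) (x : Nil ι) :
    ∫ t in (0 : ℝ)..T, φ (x.act (expG (t • F.X))) = F.orb (σ / 2) g T x := by
  have hσ0 : 0 < σ := lt_of_le_of_lt (by positivity) hσ
  have hs : (Fintype.card (Idx ι) : ℝ) / 4 < σ / 2 := by linarith
  have h1 : Continuous fun x : Nil ι => ∫ t in (0 : ℝ)..T, φ (x.act (expG (t • F.X))) := by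
    refine Nil.continuous_iff.2 ?_
    refine intervalIntegral.continuous_parametric_intervalIntegral_of_continuous'
      (f := fun (g : Grp ι) (t : ℝ) => φ ((Nil.mk g).act (expG (t • F.X)))) ?_ 0 T
    exact hφ.continuous.comp (Nil.continuous_mk.comp
      (continuous_fst.mul ((continuous_expG_smul F.X).comp continuous_snd)))
  have h2 := continuous_orb hF hs (measurable_coeFn g) (memLp_coeFn g) hT
  have h3 : (fun x : Nil ι => ∫ t in (0 : ℝ)..T, φ (x.act (expG (t • F.X))))
      =ᵐ[haar ι] F.orb (σ / 2) g T := by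
    have h4 : φ =ᵐ[haar ι] F.avg (σ / 2) g := hg.symm.trans (F.negPow_eq_avg hσ0 g)
    have h5 : ∀ t : ℝ, ∀ᵐ x ∂haar ι, φ (x.act (expG (t • F.X)))
        = F.avg (σ / 2) g (x.act (expG (t • F.X))) := fun t =>
      (measurePreserving_act (expG (t • F.X))).quasiMeasurePreserving.ae_eq_comp h4
    have hms : MeasurableSet {z : ℝ × Nil ι | φ (z.2.act (expG (z.1 • F.X)))
        = F.avg (σ / 2) g (z.2.act (expG (z.1 • F.X)))} := by
      have hm : Measurable fun z : ℝ × Nil ι => z.2.act (expG (z.1 • F.X)) :=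
        (measurable_act_expG F.X).comp measurable_swap
      exact measurableSet_eq_fun (hφ.measurable.comp hm)
        ((measurable_avg (half_pos hσ0) (measurable_coeFn g)).comp hm)
    have h6 := (Measure.ae_ae_comm (μ := (volume : Measure ℝ)) (ν := haar ι) hms).1
      (Eventually.of_forall h5)
    filter_upwards [h6] with x hx
    exact intervalIntegral.integral_congr_ae (hx.mono fun t ht _ => ht)
  exact congrFun (Continuous.ae_eq_iff_eq (haar ι) h1 h2 |>.1 h3) x

theorem hasBirkhoff (hF : F.Normalised) {σ : ℝ} (hσ : (Fintype.card (Idx ι) : ℝ) / 2 < σ)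
    {f : Nil ι → ℂ} {g : L2 ι} (hg : F.negPow σ g =ᵐ[haar ι] f) {T : ℝ} (hT : 0 ≤ T)
    (x : Nil ι) : F.HasBirkhoff σ x T f ((1 / T : ℂ) * F.orb (σ / 2) g T x) := by
  have hσ0 : 0 < σ := lt_of_le_of_lt (by positivity) hσ
  have hs : (Fintype.card (Idx ι) : ℝ) / 4 < σ / 2 := by linarith
  obtain ⟨N, hN⟩ := exists_enorm_orb_sub_le hF hs T
  have key : ∀ φ : {φ : Nil ι → ℂ // Smooth φ},
      edist (birkhoff F.X x T φ.1) ((1 / T : ℂ) * F.orb (σ / 2) g T x)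
        ≤ (‖(1 / T : ℂ)‖ₑ * N) * F.tNorm σ fun x => φ.1 x - f x := by
    rintro ⟨φ, hφ⟩
    obtain ⟨g', hg'⟩ := F.exists_negPow_of_smooth hσ0 hφ
    have h1 : F.negPow σ g' =ᵐ[haar ι] φ := by
      rw [hg']
      exact hφ.coeFn_toL2
    rw [F.tNorm_eq hσ0 (F.negPow_sub_ae h1 hg), edist_eq_enorm_sub, birkhoff,
      integral_smooth_eq_orb hF hσ hφ h1 hT, ← mul_sub, enorm_mul, mul_assoc]
    gcongr
    refine (hN _ _ (measurable_coeFn g') (memLp_coeFn g') (measurable_coeFn g) (memLp_coeFn g)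
      T ⟨hT, le_rfl⟩ x).trans (le_of_eq ?_)
    rw [Lp.enorm_def]
    congr 1
    exact eLpNorm_congr_ae (Lp.coeFn_sub g' g).symm
  rw [HasBirkhoff, tendsto_iff_edist_tendsto_0]
  have h0 : Tendsto (fun φ : {φ : Nil ι → ℂ // Smooth φ} =>
      (‖(1 / T : ℂ)‖ₑ * N) * F.tNorm σ fun x => φ.1 x - f x) (F.smoothNhds σ f) (𝓝 0) := by
    have h1 : Tendsto (fun φ : {φ : Nil ι → ℂ // Smooth φ} => F.tNorm σ fun x => φ.1 x - f x)
      (F.smoothNhds σ f) (𝓝 0) := tendsto_comap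
    have h2 := ENNReal.Tendsto.const_mul (a := ‖(1 / T : ℂ)‖ₑ * N) h1
      (Or.inr (by finiteness))
    rwa [mul_zero] at h2
  exact tendsto_of_tendsto_of_tendsto_of_le_of_le tendsto_const_nhds h0 (fun _ => zero_le) key

theorem le_mul_inv_rpow_iff {X c W : ℝ≥0∞} (hc : c ≠ 0) (hc' : c ≠ ⊤) :
    X ≤ c * W⁻¹ ^ (1 / 2 : ℝ) ↔ W ≤ ((X / c) ^ (2 : ℝ))⁻¹ := by
  rw [ENNReal.le_inv_iff_le_inv, mul_comm, ← ENNReal.div_le_iff hc hc', one_div,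
    ENNReal.le_rpow_inv_iff two_pos]

/-- The estimate is solved for the width before taking the supremum over Ω, so an empty or
unattained supremum needs no separate treatment. -/
theorem avgWidth_le_of_forall {x : Nil ι} {T : ℝ} (hT : 0 < T) {X K : ℝ≥0∞}
    (hK : K ≠ 0) (hK' : K ≠ ⊤)
    (h : ∀ Ω ∈ F.admissible x T, X ≤ K * (∫⁻ t in Set.Icc 0 T, (widthFun Ω t)⁻¹) ^ (1 / 2 : ℝ)) :
    F.avgWidth x T ≤ ((X / (K * ENNReal.ofReal T ^ (1 / 2 : ℝ))) ^ (2 : ℝ))⁻¹ := by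
  have hT0 : ENNReal.ofReal T ≠ 0 := by simpa using hT
  have hT1 : ENNReal.ofReal T ^ (1 / 2 : ℝ) ≠ 0 := by
    simp [hT]
  have hT2 : ENNReal.ofReal T ^ (1 / 2 : ℝ) ≠ ⊤ := by finiteness
  refine iSup₂_le fun Ω hΩ => ?_
  rw [← le_mul_inv_rpow_iff (mul_ne_zero hK hT1) (ENNReal.mul_ne_top hK' hT2), inv_inv]
  refine (h Ω hΩ).trans (le_of_eq ?_)
  rw [mul_assoc, ← ENNReal.mul_rpow_of_nonneg _ _ (by norm_num), ← mul_assoc,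
    ENNReal.mul_inv_cancel hT0 ENNReal.ofReal_ne_top, one_mul]

theorem enorm_birkhoff_le (hF : F.Normalised) {σ : ℝ}
    (hσ : (Fintype.card (Idx ι) : ℝ) / 2 < σ) (g : L2 ι) {T : ℝ} (hT : 0 < T)
    {x : Nil ι} {C : ℝ≥0}
    (hC0 : 0 < C) (hC : subordConst (Fintype.card (Idx ι)) (σ / 2) ≤ C) :
    ‖(1 / T : ℂ) * F.orb (σ / 2) g T x‖ₑ
      ≤ C / (ENNReal.ofReal T ^ (1 / 2 : ℝ) * F.avgWidth x T ^ (1 / 2 : ℝ)) * ‖g‖ₑ := by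
  have hσ0 : 0 < σ := lt_of_le_of_lt (by positivity) hσ
  have hs : (Fintype.card (Idx ι) : ℝ) / 4 < σ / 2 := by linarith
  have hX := enorm_orb_le (F := F) (σ / 2) g x (r := T) ⟨hT.le, le_rfl⟩
  -- Solving for the width divides by ‖g‖, so the zero case is settled first by the qualitative
  -- bound.
  rcases eq_or_ne ‖g‖ₑ 0 with h0 | h0
  · obtain ⟨N, hN⟩ := exists_orbInt_le hF hs T
    have h1 := hX.trans (hN g (measurable_coeFn g) x)
    rw [← Lp.enorm_def, h0, mul_zero, nonpos_iff_eq_zero] at h1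
    rw [enorm_mul, h1, mul_zero]
    exact zero_le
  set R : ℝ≥0∞ := ENNReal.ofReal T ^ (1 / 2 : ℝ) with hR
  have hR0 : R ≠ 0 := by simp [hR, hT]
  have hR1 : R ≠ ⊤ := by finiteness
  have hRR : R * R = ENNReal.ofReal T := by
    rw [hR, ← ENNReal.rpow_add_of_nonneg _ _ (by norm_num) (by norm_num)]
    norm_num
  have hK : (C : ℝ≥0∞) * ‖g‖ₑ ≠ 0 := mul_ne_zero (by simpa using hC0.ne') h0
  have hK' : (C : ℝ≥0∞) * ‖g‖ₑ ≠ ⊤ := by finiteness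
  have h2 := avgWidth_le_of_forall (F := F) (x := x) hT hK hK' (X := ‖F.orb (σ / 2) g T x‖ₑ)
    fun Ω hΩ => by
      refine (hX.trans (orbInt_le_of_admissible hF (half_pos hσ0) (measurable_coeFn g) hΩ)).trans ?_
      rw [← Lp.enorm_def, mul_assoc]
      gcongr
  rw [← le_mul_inv_rpow_iff (mul_ne_zero hK hR0) (ENNReal.mul_ne_top hK' hR1)] at h2
  have hTn : ‖(1 / T : ℂ)‖ₑ = R⁻¹ * R⁻¹ := by
    rw [← ENNReal.mul_inv (Or.inl hR0) (Or.inl hR1), hRR, one_div,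
      enorm_inv (by exact_mod_cast hT.ne'), ← ofReal_norm, Complex.norm_real, Real.norm_eq_abs,
      abs_of_pos hT]
  rw [enorm_mul, hTn, div_eq_mul_inv (C : ℝ≥0∞), ENNReal.mul_inv (Or.inl hR0) (Or.inl hR1),
    ← ENNReal.inv_rpow (F.avgWidth x T)]
  calc R⁻¹ * R⁻¹ * ‖F.orb (σ / 2) g T x‖ₑ
      ≤ R⁻¹ * R⁻¹ * (C * ‖g‖ₑ * R * (F.avgWidth x T)⁻¹ ^ (1 / 2 : ℝ)) := by gcongr
    _ = R⁻¹ * R * (C * (R⁻¹ * (F.avgWidth x T)⁻¹ ^ (1 / 2 : ℝ)) * ‖g‖ₑ) := by ring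
    _ = _ := by rw [ENNReal.inv_mul_cancel hR0 hR1, one_mul]

end AdaptedBasis

/-! ### Weak derivatives along the flow -/

theorem integrable_act_prod_of_finite {P : Type*} [MeasurableSpace P] (ν : Measure P)
    [IsFiniteMeasure ν] {k : P → Grp ι} (hk : Measurable k) {g : Nil ι → ℂ} (hg : Measurable g)
    (hgi : Integrable g (haar ι)) :
    Integrable (fun z : P × Nil ι => g (z.2.act (k z.1))) (ν.prod (haar ι)) := by
  have hm : Measurable fun z : P × Nil ι => g (z.2.act (k z.1)) :=
    hg.comp (Nil.measurable_act.comp (measurable_snd.prodMk (hk.comp measurable_fst)))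
  refine ⟨hm.aestronglyMeasurable, ?_⟩
  rw [HasFiniteIntegral, lintegral_prod _ hm.enorm.aemeasurable]
  simp only [lintegral_act hg.enorm, lintegral_const]
  exact ENNReal.mul_lt_top hgi.2 (measure_lt_top ν _)

theorem integral_mul_act {φ W : Nil ι → ℂ} (hφ : Measurable φ) (hW : Measurable W)
    (Z : LieAlg ι) (t : ℝ) :
    ∫ x, φ (x.act (expG (-t • Z))) * W x ∂haar ι
      = ∫ x, φ x * W (x.act (expG (t • Z))) ∂haar ι := by
  have hm : Measurable fun x : Nil ι => φ (x.act (expG (-t • Z))) * W x :=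
    (hφ.comp (measurePreserving_act _).measurable).mul hW
  rw [← integral_act hm.aestronglyMeasurable (expG (t • Z))]
  refine integral_congr_ae (Eventually.of_forall fun x => ?_)
  change φ ((x.act (expG (t • Z))).act (expG (-t • Z))) * _ = _
  rw [← Nil.act_mul, ← expG_add_smul, add_neg_cancel, expG_zero_smul, Nil.act_one]

/-- Tested against a smooth φ, the flow can be moved from U to φ by invariance. There the increment
is the integral of the derivative of φ along Z, and the weak equation converts it back into V.
Testing against conjugate waves then identifies the two sides. -/
theorem weak_flow {Z : LieAlg ι} {U V : Nil ι → ℂ} (hU : Measurable U) (hU2 : MemLp U 2 (haar ι))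
    (hV : Measurable V) (hV2 : MemLp V 2 (haar ι))
    (hw : ∀ φ, Smooth φ → ∫ x, U x * lieD Z φ x ∂haar ι = -∫ x, V x * φ x ∂haar ι) {r : ℝ}
    (hI : MemLp (fun x => ∫ t in (0 : ℝ)..r, V (x.act (expG (t • Z)))) 2 (haar ι)) :
    ∀ᵐ x ∂haar ι, U (x.act (expG (r • Z)))
      = U x + ∫ t in (0 : ℝ)..r, V (x.act (expG (t • Z))) := by
  have hUi : Integrable U (haar ι) := hU2.integrable one_le_two
  have hVi : Integrable V (haar ι) := hV2.integrable one_le_two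
  have hmp := measurePreserving_act (ι := ι) (expG (r • Z))
  have hUr : MemLp (fun x => U (x.act (expG (r • Z)))) 2 (haar ι) := hU2.comp_measurePreserving hmp
  have hk : Measurable fun t : ℝ => expG (t • Z) := (continuous_expG_smul Z).measurable
  have hk' : Measurable fun t : ℝ => expG (-t • Z) := hk.comp measurable_neg
  have key : ∀ φ : Nil ι → ℂ, Smooth φ → ∫ x, φ x * (U (x.act (expG (r • Z))) - U x
      - ∫ t in (0 : ℝ)..r, V (x.act (expG (t • Z)))) ∂haar ι = 0 := by
    intro φ hφ
    obtain ⟨C, hC⟩ := exists_bound_of_continuous hφ.continuous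
    obtain ⟨C', hC'⟩ := exists_bound_of_continuous (hφ.lieD Z).continuous
    have hbdd : ∀ {W : Nil ι → ℂ}, Integrable W (haar ι) →
        Integrable (fun x => φ x * W x) (haar ι) := fun hW =>
      hW.bdd_mul hφ.measurable.aestronglyMeasurable (Eventually.of_forall hC)
    have hφr : Measurable fun x : Nil ι => φ (x.act (expG (-r • Z))) :=
      hφ.measurable.comp (measurePreserving_act _).measurable
    have h1 : ∫ x, φ x * U (x.act (expG (r • Z))) ∂haar ι - ∫ x, φ x * U x ∂haar ι
        = ∫ x, (φ (x.act (expG (-r • Z))) - φ x) * U x ∂haar ι := by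
      rw [← integral_mul_act hφ.measurable hU Z r, ← integral_sub _ (hbdd hUi)]
      · simp only [sub_mul]
      · exact hUi.bdd_mul hφr.aestronglyMeasurable (Eventually.of_forall fun x => hC _)
    have h2 : ∀ x, (φ (x.act (expG (-r • Z))) - φ x) * U x
        = -∫ t in (0 : ℝ)..r, U x * lieD Z φ (x.act (expG (-t • Z))) := by
      intro x
      rw [hφ.act_sub, intervalIntegral.integral_const_mul,
        intervalIntegral.integral_comp_neg (fun t => lieD Z φ (x.act (expG (t • Z)))),
        intervalIntegral.integral_symm, neg_zero]
      ring
    have h3 : ∀ t : ℝ, ∫ x, U x * lieD Z φ (x.act (expG (-t • Z))) ∂haar ι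
        = -∫ x, φ x * V (x.act (expG (t • Z))) ∂haar ι := by
      intro t
      have h4 := hw _ (hφ.act (expG (-t • Z)))
      simp only [lieD_act] at h4
      rw [h4, ← integral_mul_act hφ.measurable hV Z t]
      simp only [mul_comm]
    have hs1 : Integrable (Function.uncurry fun (t : ℝ) (x : Nil ι) =>
        U x * lieD Z φ (x.act (expG (-t • Z))))
        ((volume.restrict (Set.uIoc 0 r)).prod (haar ι)) := by
      have : IsFiniteMeasure (volume.restrict (Set.uIoc 0 r)) := ⟨by simp⟩
      refine (hUi.comp_snd _).mul_bdd (c := C') ?_ (Eventually.of_forall fun z => hC' _)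
      exact ((hφ.lieD Z).measurable.comp (Nil.measurable_act.comp
        (measurable_snd.prodMk (hk'.comp measurable_fst)))).aestronglyMeasurable
    have hs2 : Integrable (Function.uncurry fun (t : ℝ) (x : Nil ι) =>
        φ x * V (x.act (expG (t • Z))))
        ((volume.restrict (Set.uIoc 0 r)).prod (haar ι)) := by
      have : IsFiniteMeasure (volume.restrict (Set.uIoc 0 r)) := ⟨by simp⟩
      refine (integrable_act_prod_of_finite _ hk hV hVi).bdd_mul (c := C)
        ?_ (Eventually.of_forall fun z => hC _)
      exact (hφ.measurable.comp measurable_snd).aestronglyMeasurable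
    have h5 : ∫ x, φ x * U (x.act (expG (r • Z))) ∂haar ι - ∫ x, φ x * U x ∂haar ι
        = ∫ x, φ x * (∫ t in (0 : ℝ)..r, V (x.act (expG (t • Z)))) ∂haar ι := by
      rw [h1]
      simp only [h2]
      rw [integral_neg, ← intervalIntegral_integral_swap hs1]
      simp only [h3]
      rw [intervalIntegral.integral_neg, neg_neg, intervalIntegral_integral_swap hs2]
      simp only [intervalIntegral.integral_const_mul]
    simp only [mul_sub]
    rw [integral_sub, integral_sub (hbdd (hUr.integrable one_le_two)) (hbdd hUi), h5, sub_self]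
    · exact (hbdd (hUr.integrable one_le_two)).sub (hbdd hUi)
    · exact hbdd (hI.integrable one_le_two)
  have h := ae_eq_zero_of_wave ((hUr.sub hU2).sub hI)
    fun m c hc => key _ (hc.smooth_wave m).conj
  filter_upwards [h] with x hx
  have hx' : U (x.act (expG (r • Z))) - U x
      - ∫ t in (0 : ℝ)..r, V (x.act (expG (t • Z))) = 0 := hx
  linear_combination hx'

/-! ### The continuous representative of a function with a weak derivative along X. -/

namespace AdaptedBasis

variable {F : AdaptedBasis ι}

theorem measurable_orb {s : ℝ} (hs : 0 < s) {g : Nil ι → ℂ} (hg : Measurable g) :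
    Measurable fun z : ℝ × Nil ι => F.orb s g z.1 z.2 := by
  have h1 : ∀ z : ℝ × Nil ι, F.orb s g z.1 z.2
      = z.1 • ∫ t in Set.Ioc (0 : ℝ) 1, F.avg s g (z.2.act (expG ((z.1 * t) • F.X))) := by
    intro z
    have h := intervalIntegral.smul_integral_comp_mul_left (a := 0) (b := 1)
      (fun t : ℝ => F.avg s g (z.2.act (expG (t • F.X)))) z.1
    rw [mul_zero, mul_one] at h
    rw [orb, ← h, intervalIntegral.integral_of_le zero_le_one]
  simp only [h1]
  refine measurable_fst.smul (StronglyMeasurable.measurable ?_)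
  have hm : Measurable fun y : (ℝ × Nil ι) × ℝ =>
      F.avg s g (y.1.2.act (expG ((y.1.1 * y.2) • F.X))) := by
    refine (measurable_avg hs hg).comp (Nil.measurable_act.comp
      ((measurable_snd.comp measurable_fst).prodMk ?_))
    exact (continuous_expG_smul F.X).measurable.comp
      ((measurable_fst.comp measurable_fst).mul measurable_snd)
  exact hm.stronglyMeasurable.integral_prod_right

/-- The continuous representative of `avg s g` when the weak derivative of the latter along `X` is
`avg s k`. -/
def contRep (F : AdaptedBasis ι) (s : ℝ) (g k : Nil ι → ℂ) (x : Nil ι) : ℂ :=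
  F.orb s g 1 x - F.orbMean s k x

variable {s : ℝ} {g k : Nil ι → ℂ}

theorem continuous_contRep (hF : F.Normalised) (hs : (Fintype.card (Idx ι) : ℝ) / 4 < s)
    (hg : Measurable g) (hg2 : MemLp g 2 (haar ι)) (hk : Measurable k)
    (hk2 : MemLp k 2 (haar ι)) : Continuous (F.contRep s g k) :=
  (continuous_orb hF hs hg hg2 zero_le_one).sub (continuous_orbMean hF hs hk hk2)

theorem ae_avg_act_eq (hF : F.Normalised) (hs : (Fintype.card (Idx ι) : ℝ) / 4 < s)
    (hg : Measurable g) (hg2 : MemLp (F.avg s g) 2 (haar ι)) (hk : Measurable k)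
    (hk2 : MemLp k 2 (haar ι)) (hk2' : MemLp (F.avg s k) 2 (haar ι))
    (hw : ∀ φ, Smooth φ → ∫ x, F.avg s g x * lieD F.X φ x ∂haar ι
      = -∫ x, F.avg s k x * φ x ∂haar ι) {r : ℝ} (hr : 0 ≤ r) :
    ∀ᵐ x ∂haar ι, F.avg s g (x.act (expG (r • F.X))) = F.avg s g x + F.orb s k r x := by
  have hs0 : 0 < s := lt_of_le_of_lt (by positivity) hs
  refine weak_flow (measurable_avg hs0 hg) hg2 (measurable_avg hs0 hk) hk2' hw ?_
  have hc := continuous_orb hF hs hk hk2 hr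
  obtain ⟨C, hC⟩ := exists_bound_of_continuous hc
  exact MemLp.of_bound (Nil.measurable_of_continuous hc).aestronglyMeasurable C
    (Eventually.of_forall hC)

/-- Integrate avg g(x) = avg g(x exp rX) − ∫_0^r avg k over 0 ≤ r ≤ 1. -/
theorem contRep_ae_eq (hF : F.Normalised) (hs : (Fintype.card (Idx ι) : ℝ) / 4 < s)
    (hg : Measurable g) (hk : Measurable k) (hk2 : MemLp k 2 (haar ι))
    (h : ∀ r ∈ Set.Icc (0 : ℝ) 1, ∀ᵐ x ∂haar ι,
      F.avg s g (x.act (expG (r • F.X))) = F.avg s g x + F.orb s k r x) :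
    F.contRep s g k =ᵐ[haar ι] F.avg s g := by
  have hs0 : 0 < s := lt_of_le_of_lt (by positivity) hs
  have hms : MeasurableSet {z : ℝ × Nil ι | F.avg s g (z.2.act (expG (z.1 • F.X)))
      = F.avg s g z.2 + F.orb s k z.1 z.2} := by
    have hm : Measurable fun z : ℝ × Nil ι => z.2.act (expG (z.1 • F.X)) :=
      (measurable_act_expG F.X).comp measurable_swap
    exact measurableSet_eq_fun ((measurable_avg hs0 hg).comp hm)
      (((measurable_avg hs0 hg).comp measurable_snd).add (measurable_orb hs0 hk))
  have h6 := (Measure.ae_ae_comm (μ := (volume.restrict (Set.Icc (0 : ℝ) 1))) (ν := haar ι) hms).1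
    ((ae_restrict_iff' measurableSet_Icc).2 (Eventually.of_forall h))
  filter_upwards [h6] with x hx
  have h7 : F.orb s g 1 x = ∫ r in (0 : ℝ)..1, (F.avg s g x + F.orb s k r x) := by
    rw [orb]
    refine intervalIntegral.integral_congr_ae_restrict ?_
    rw [Set.uIoc_of_le zero_le_one]
    exact ae_restrict_of_ae_restrict_of_subset Set.Ioc_subset_Icc_self hx
  rw [contRep, h7, intervalIntegral.integral_add (by simp)
    (intervalIntegrable_orb hs0 hk (orbInt_ne_top hF hs hk hk2 x 1)), orbMean]
  simp

theorem contRep_act (hF : F.Normalised) (hs : (Fintype.card (Idx ι) : ℝ) / 4 < s)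
    (hg : Measurable g) (hg2 : MemLp g 2 (haar ι)) (hk : Measurable k)
    (hk2 : MemLp k 2 (haar ι))
    (h : ∀ r ∈ Set.Icc (0 : ℝ) 1, ∀ᵐ x ∂haar ι,
      F.avg s g (x.act (expG (r • F.X))) = F.avg s g x + F.orb s k r x)
    {t : ℝ} (ht : t ∈ Set.Icc (0 : ℝ) 1) (x : Nil ι) :
    F.contRep s g k (x.act (expG (t • F.X))) = F.contRep s g k x + F.orb s k t x := by
  have hc := continuous_contRep hF hs hg hg2 hk hk2
  have h1 := contRep_ae_eq hF hs hg hk hk2 h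
  have h2 := (measurePreserving_act (expG (t • F.X))).quasiMeasurePreserving.ae_eq_comp h1
  have h3 : (fun x => F.contRep s g k (x.act (expG (t • F.X))))
      =ᵐ[haar ι] fun x => F.contRep s g k x + F.orb s k t x := by
    filter_upwards [h1, h2, h t ht] with x h1 h2 h3
    have h2' : F.contRep s g k (x.act (expG (t • F.X)))
      = F.avg s g (x.act (expG (t • F.X))) := h2
    rw [h2', h3, h1]
  exact congrFun (Continuous.ae_eq_iff_eq (haar ι) (hc.comp (Nil.continuous_act_left _))
    (hc.add (continuous_orb hF hs hk hk2 ht.1)) |>.1 h3) x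

/-- The value at time t is the mean of the function over the unit segment plus the mean over r of
the integral of its derivative from r to t. Each of these is at most an orbit integral over the
whole segment. -/
theorem enorm_contRep_act_le (hF : F.Normalised) (hs : (Fintype.card (Idx ι) : ℝ) / 4 < s)
    (hg : Measurable g) (hg2 : MemLp g 2 (haar ι)) (hk : Measurable k)
    (hk2 : MemLp k 2 (haar ι))
    (h : ∀ r ∈ Set.Icc (0 : ℝ) 1, ∀ᵐ x ∂haar ι,
      F.avg s g (x.act (expG (r • F.X))) = F.avg s g x + F.orb s k r x)
    {t : ℝ} (ht : t ∈ Set.Icc (0 : ℝ) 1) (x : Nil ι) :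
    ‖F.contRep s g k (x.act (expG (t • F.X)))‖ₑ ≤ F.orbInt s g x 1 + F.orbInt s k x 1 := by
  have hs0 : 0 < s := lt_of_le_of_lt (by positivity) hs
  have hfin := orbInt_ne_top hF hs hk hk2 x 1
  have h1 : F.contRep s g k x + F.orb s k t x
      = F.orb s g 1 x + ∫ r in (0 : ℝ)..1, (F.orb s k t x - F.orb s k r x) := by
    rw [intervalIntegral.integral_sub (by simp) (intervalIntegrable_orb hs0 hk hfin), contRep,
      orbMean]
    simp
    ring
  rw [contRep_act hF hs hg hg2 hk hk2 h ht, h1]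
  refine (enorm_add_le _ _).trans (add_le_add (enorm_orb_le s g x (by simp)) ?_)
  refine (enorm_intervalIntegral_le (T := 1) (by simp) (by simp)).trans ?_
  calc ∫⁻ r in Set.Icc (0 : ℝ) 1, ‖F.orb s k t x - F.orb s k r x‖ₑ
      ≤ ∫⁻ r in Set.Icc (0 : ℝ) 1, F.orbInt s k x 1 := by
        refine setLIntegral_mono' measurableSet_Icc fun r hr => ?_
        have h0 : (0 : ℝ) ∈ Set.Icc (0 : ℝ) 1 := by simp
        rw [orb, orb, intervalIntegral.integral_interval_sub_left
          (intervalIntegrable_avg_act hs0 hk hfin h0 ht)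
          (intervalIntegrable_avg_act hs0 hk hfin h0 hr)]
        exact (enorm_intervalIntegral_le hr ht).trans (lintegral_enorm_avg_act_le s k x 1)
    _ = F.orbInt s k x 1 := by simp

end AdaptedBasis

/-! ### The pointwise estimate. -/

namespace AdaptedBasis

variable {F : AdaptedBasis ι}

theorem enorm_contRep_le (hF : F.Normalised) {σ : ℝ}
    (hσ : (Fintype.card (Idx ι) : ℝ) / 2 < σ) {g k : L2 ι}
    (h : ∀ r ∈ Set.Icc (0 : ℝ) 1, ∀ᵐ x ∂haar ι,
      F.avg (σ / 2) g (x.act (expG (r • F.X))) = F.avg (σ / 2) g x + F.orb (σ / 2) k r x)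
    {C : ℝ≥0} (hC0 : 0 < C) (hC : subordConst (Fintype.card (Idx ι)) (σ / 2) ≤ C) (y : Nil ι) :
    ‖F.contRep (σ / 2) g k y‖ₑ ≤ C / F.ptWidth y ^ (1 / 2 : ℝ) * (‖g‖ₑ + ‖k‖ₑ) := by
  have hσ0 : 0 < σ := lt_of_le_of_lt (by positivity) hσ
  have hs : (Fintype.card (Idx ι) : ℝ) / 4 < σ / 2 := by linarith
  have hb : ∀ x : Nil ι, ∀ t ∈ Set.Icc (0 : ℝ) 1, y = x.act (expG (t • F.X)) →
      ‖F.contRep (σ / 2) g k y‖ₑ ≤ F.orbInt (σ / 2) g x 1 + F.orbInt (σ / 2) k x 1 := by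
    rintro x t ht rfl
    exact enorm_contRep_act_le hF hs (measurable_coeFn g) (memLp_coeFn g) (measurable_coeFn k)
      (memLp_coeFn k) h ht x
  rcases eq_or_ne (‖g‖ₑ + ‖k‖ₑ) 0 with h0 | h0
  · obtain ⟨N, hN⟩ := exists_orbInt_le hF hs 1
    have h1 := (hb y 0 (by simp) (by rw [expG_zero_smul, Nil.act_one])).trans
      (add_le_add (hN g (measurable_coeFn g) y) (hN k (measurable_coeFn k) y))
    rw [← Lp.enorm_def, ← Lp.enorm_def, ← mul_add, h0, mul_zero] at h1
    exact h1.trans zero_le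
  have hK : (C : ℝ≥0∞) * (‖g‖ₑ + ‖k‖ₑ) ≠ 0 := mul_ne_zero (by simpa using hC0.ne') h0
  have hK' : (C : ℝ≥0∞) * (‖g‖ₑ + ‖k‖ₑ) ≠ ⊤ := by finiteness
  -- The bound holds from every x whose unit segment passes through y, so the supremum over such x
  -- may be taken.
  have h2 : F.ptWidth y
      ≤ ((‖F.contRep (σ / 2) g k y‖ₑ / (C * (‖g‖ₑ + ‖k‖ₑ))) ^ (2 : ℝ))⁻¹ := by
    refine iSup₂_le fun x hx => ?_
    obtain ⟨t, ht, hy⟩ := hx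
    have h3 := avgWidth_le_of_forall (F := F) (x := x) one_pos hK hK'
      (X := ‖F.contRep (σ / 2) g k y‖ₑ) fun Ω hΩ => by
        refine ((hb x t ht hy).trans (add_le_add
          (orbInt_le_of_admissible hF (half_pos hσ0) (measurable_coeFn g) hΩ)
          (orbInt_le_of_admissible hF (half_pos hσ0) (measurable_coeFn k) hΩ))).trans ?_
        rw [← Lp.enorm_def, ← Lp.enorm_def, ← mul_add, ← add_mul, mul_assoc]
        gcongr
    simpa using h3
  rw [← le_mul_inv_rpow_iff hK hK'] at h2
  refine h2.trans (le_of_eq ?_)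
  rw [div_eq_mul_inv (C : ℝ≥0∞), ENNReal.inv_rpow]
  ring

/-! ### Derivatives along the Abelian ideal -/

theorem exists_eq_sum_smul_Y (hF : F.Normalised) {Z : LieAlg ι} (hZ : Z.1 = 0) :
    ∃ c : Idx ι → ℝ, Z = ∑ j, c j • F.Y j := by
  have hdet : IsUnit F.mat.det := by
    refine isUnit_iff_ne_zero.2 fun h0 => ?_
    have := hF.mul_det
    rw [h0, mul_zero] at this
    exact zero_ne_one this
  refine ⟨F.mat⁻¹.mulVec Z.2, ?_⟩
  rw [sum_smul_Y, Matrix.mulVec_mulVec, Matrix.mul_nonsing_inv _ hdet, Matrix.one_mulVec]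
  exact Prod.ext hZ rfl

variable (F)

theorem negPow_one_sq : F.negPow 1 * F.negPow 1 = F.resolvent := by
  rw [← F.negPow_add one_pos one_pos, one_add_one_eq_two, negPow_two]

theorem norm_negPow_one_opA {f : Nil ι → ℂ} (hf : Smooth f) :
    ‖F.negPow 1 (F.smooth_opA hf).toL2‖ ^ 2
      = ‖hf.toL2‖ ^ 2 + ∑ j, ‖(hf.lieD (F.Y j)).toL2‖ ^ 2 := by
  have h1 : inner ℂ (F.negPow 1 (F.smooth_opA hf).toL2) (F.negPow 1 (F.smooth_opA hf).toL2)
      = inner ℂ hf.toL2 (F.smooth_opA hf).toL2 := by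
    rw [← F.inner_negPow, ← mul_apply_eq_comp, negPow_one_sq, F.resolvent_opA hf]
  rw [F.re_inner_opA hf, inner_self_eq_norm_sq_to_K] at h1
  exact Complex.ofReal_injective ((Complex.ofReal_pow _ _).trans h1)

/-- The map `(I + Δ_Y) ψ ↦ (I + Δ_Y)^{1/2} ψ` on `C^∞(M)`. -/
def sqrtLin : smoothSub ι →ₗ[ℂ] L2 ι := (F.negPow 1 : L2 ι →ₗ[ℂ] L2 ι) ∘ₗ F.opALin

variable (ι) in
/-- The derivative along `Z` as a linear map on `C^∞(M)`. -/
def derivLin (Z : LieAlg ι) : smoothSub ι →ₗ[ℂ] L2 ι where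
  toFun f := (Smooth.lieD f.2 Z).toL2
  map_add' f g := (toL2_congr _ _ (lieD_add_fun f.2 g.2 Z)).trans
    ((Smooth.lieD f.2 Z).toL2_add (Smooth.lieD g.2 Z))
  map_smul' c f := (toL2_congr (Smooth.lieD (c • f).2 Z)
    ((Smooth.const c).mul (Smooth.lieD f.2 Z))
    (lieD_const_mul_fun f.2 c Z)).trans ((Smooth.lieD f.2 Z).toL2_const_mul c)

theorem waveSet_subset_range_sqrtLin : waveSet ι ⊆ Set.range F.sqrtLin := by
  intro h hh
  obtain ⟨k, hk, rfl⟩ := F.exists_negPow_wave one_pos hh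
  obtain ⟨ψ, rfl⟩ := F.waveSet_subset_range_opALin hk
  exact ⟨ψ, rfl⟩

/-- The bounded operator `Z (I + Δ_Y)^{-1/2}`, for `Z ∈ 𝔞`. -/
def rieszOp (Z : LieAlg ι) : L2 ι →L[ℂ] L2 ι := (derivLin ι Z).extendOfNorm F.sqrtLin

variable {F}

/-- The square of ‖(I + Δ_Y)^{1/2}ψ‖ is ‖ψ‖² + ∑ ‖Y_jψ‖², which dominates each ‖Y_jψ‖². A general Z
in 𝔞 is a combination of the Y_j. -/
theorem norm_derivLin_le (c : Idx ι → ℝ) (ψ : smoothSub ι) :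
    ‖derivLin ι (∑ j, c j • F.Y j) ψ‖ ≤ (∑ j, |c j|) * ‖F.sqrtLin ψ‖ := by
  have hψ : Smooth ψ.1 := ψ.2
  have h1 : ∀ j, ‖derivLin ι (F.Y j) ψ‖ ≤ ‖F.sqrtLin ψ‖ := by
    intro j
    refine le_of_sq_le_sq ?_ (norm_nonneg _)
    have h2 := F.norm_negPow_one_opA hψ
    change ‖(hψ.lieD (F.Y j)).toL2‖ ^ 2 ≤ ‖F.negPow 1 (F.smooth_opA hψ).toL2‖ ^ 2
    rw [h2]
    have h3 := Finset.single_le_sum (f := fun j => ‖(hψ.lieD (F.Y j)).toL2‖ ^ 2)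
      (fun j _ => sq_nonneg _) (Finset.mem_univ j)
    have h4 := sq_nonneg ‖hψ.toL2‖
    linarith
  have h5 : derivLin ι (∑ j, c j • F.Y j) ψ = ∑ j, (c j : ℂ) • derivLin ι (F.Y j) ψ := by
    have h6 : (⟨_, hψ.lieD (∑ j, c j • F.Y j)⟩ : smoothSub ι)
        = ∑ j, (c j : ℂ) • ⟨_, hψ.lieD (F.Y j)⟩ := by
      refine Subtype.ext (funext fun x => ?_)
      rw [Submodule.coe_sum, Finset.sum_apply]
      exact hψ.lieD_sum_smul _ _ _ _
    change inclLin ι ⟨_, hψ.lieD (∑ j, c j • F.Y j)⟩ = _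
    rw [h6, map_sum]
    refine Finset.sum_congr rfl fun j _ => ?_
    rw [map_smul]
    rfl
  rw [h5, Finset.sum_mul]
  refine (norm_sum_le _ _).trans (Finset.sum_le_sum fun j _ => ?_)
  rw [norm_smul, Complex.norm_real, Real.norm_eq_abs]
  exact mul_le_mul_of_nonneg_left (h1 j) (abs_nonneg _)

theorem rieszOp_sqrtLin (hF : F.Normalised) {Z : LieAlg ι} (hZ : Z.1 = 0) (ψ : smoothSub ι) :
    F.rieszOp Z (F.sqrtLin ψ) = derivLin ι Z ψ := by
  obtain ⟨c, rfl⟩ := exists_eq_sum_smul_Y hF hZ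
  exact LinearMap.extendOfNorm_eq (denseRange_of_waveSet _ F.waveSet_subset_range_sqrtLin)
    ⟨_, norm_derivLin_le c⟩ ψ

/-- For Z in 𝔞 both Z and the powers of I + Δ_Y multiply the coefficient of a wave by functions of
t, so they commute and the exponents add. -/
theorem negPow_rieszOp_wave (hF : F.Normalised) {Z : LieAlg ι} (hZ : Z.1 = 0) {σ : ℝ}
    (hσ : 0 < σ) {m : Idx ι → ℤ} {c : ℝ → ℂ} (hc : IsCoeff c) :
    F.negPow σ (F.rieszOp Z (hc.smooth_wave m).toL2)
      = (((hc.mulSymb F m (-((σ + 1) / 2))).smooth_wave m).lieD Z).toL2 := by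
  set θ : ℝ → ℂ := fun t => ang m ((twist ι t).mulVec Z.2) * Complex.I with hθ
  have hθc : ContDiff ℝ ∞ θ :=
    (Complex.ofRealCLM.contDiff.comp (contDiff_ang_twist m Z.2)).mul contDiff_const
  have hc1 := hc.mulSymb F m (-(1 / 2))
  have hw1 := hc1.smooth_wave m
  have h1 : (hc.smooth_wave m).toL2 = F.sqrtLin ⟨_, hw1⟩ := by
    have h2 : (F.smooth_opA hw1).toL2 = ((hc1.mulSymb F m 1).smooth_wave m).toL2 :=
      toL2_congr _ _ (F.opA_wave m _)
    change _ = F.negPow 1 (F.smooth_opA hw1).toL2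
    rw [h2, F.negPow_wave one_pos (hc1.mulSymb F m 1)]
    refine toL2_congr _ _ ?_
    rw [mulSymb_mulSymb, mulSymb_mulSymb]
    norm_num [mulSymb_zero]
  have h3 : derivLin ι Z ⟨_, hw1⟩ = ((hc1.mul hθc).smooth_wave m).toL2 :=
    toL2_congr (hw1.lieD Z) ((hc1.mul hθc).smooth_wave m) (funext fun x => lieD_wave m _ hZ x)
  rw [h1, rieszOp_sqrtLin hF hZ, h3, F.negPow_wave hσ (hc1.mul hθc)]
  refine toL2_congr _ _ (funext fun x => ?_)
  rw [lieD_wave m _ hZ]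
  simp only [wave, mulSymb]
  rw [show -((σ + 1) / 2) = -(1 / 2) + -(σ / 2) by ring, Real.rpow_add (F.symb_pos m _)]
  push_cast
  ring

/-- The difference of the two sides is a continuous linear functional of g. On waves it vanishes by
integration by parts, and waves span a dense subspace. -/
theorem isWeakDeriv_rieszOp (hF : F.Normalised) {Z : LieAlg ι} (hZ : Z.1 = 0) {σ : ℝ}
    (hσ : 0 < σ) (g : L2 ι) {φ : Nil ι → ℂ} (hφ : Smooth φ) :
    ∫ x, F.negPow (σ + 1) g x * lieD Z φ x ∂haar ι
      = -∫ x, F.negPow σ (F.rieszOp Z g) x * φ x ∂haar ι := by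
  have hpair : ∀ {ψ : Nil ι → ℂ} (hψ : Smooth ψ) (h : L2 ι),
      inner ℂ hψ.conj.toL2 h = ∫ x, h x * ψ x ∂haar ι := by
    intro ψ hψ h
    rw [inner_toL2]
    simp only [Complex.conj_conj, mul_comm]
  let Λ : L2 ι →L[ℂ] ℂ := (innerSL ℂ (hφ.lieD Z).conj.toL2).comp (F.negPow (σ + 1))
    + (innerSL ℂ hφ.conj.toL2).comp ((F.negPow σ).comp (F.rieszOp Z))
  have hΛ : ∀ h, Λ h = inner ℂ (hφ.lieD Z).conj.toL2 (F.negPow (σ + 1) h)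
    + inner ℂ hφ.conj.toL2 (F.negPow σ (F.rieszOp Z h)) := fun _ => rfl
  have h0 : g ∈ LinearMap.ker (Λ : L2 ι →ₗ[ℂ] ℂ) := by
    refine mem_of_wave _ Λ.isClosed_ker ?_ g
    rintro _ ⟨m, c, hc, rfl⟩
    have hw := (hc.mulSymb F m (-((σ + 1) / 2))).smooth_wave m
    change Λ _ = 0
    rw [hΛ, negPow_rieszOp_wave hF hZ hσ hc, F.negPow_wave (by positivity) hc, hpair (hφ.lieD Z), hpair hφ]
    have h1 : ∫ x, hw.toL2 x * lieD Z φ x ∂haar ι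
        = ∫ x, wave m (F.mulSymb m (-((σ + 1) / 2)) c) x * lieD Z φ x ∂haar ι :=
      integral_congr_ae (by filter_upwards [hw.coeFn_toL2] with x hx; rw [hx])
    have h2 : ∫ x, (hw.lieD Z).toL2 x * φ x ∂haar ι
        = ∫ x, lieD Z (wave m (F.mulSymb m (-((σ + 1) / 2)) c)) x * φ x ∂haar ι :=
      integral_congr_ae (by filter_upwards [(hw.lieD Z).coeFn_toL2] with x hx; rw [hx])
    rw [h1, h2, hw.integral_lieD_mul hφ Z, add_neg_cancel]
  have h1 : Λ g = 0 := h0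
  rw [hΛ, hpair (hφ.lieD Z), hpair hφ] at h1
  exact eq_neg_of_add_eq_zero_left h1

end AdaptedBasis

end QuasiAbelian

end

/-! ### Assembly of the two estimates. -/

theorem theorem3 :
    -- Birkhoff averages
    (∀ (a : ℕ) (σ : ℝ), (a : ℝ) / 2 < σ → ∃ C : ℝ≥0, 0 < C ∧
      ∀ (n : ℕ) (ι : Fin n → ℕ), (∀ m, 1 ≤ ι m) → ∑ m, ι m = a →
      ∀ F : QuasiAbelian.AdaptedBasis ι, F.Normalised →
      ∀ f : QuasiAbelian.Nil ι → ℂ, F.MemW σ f →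
      ∀ T : ℝ, 1 ≤ T → ∀ x : QuasiAbelian.Nil ι, 0 < F.avgWidth x T →
        ∃ b : ℂ, F.HasBirkhoff σ x T f b ∧
          ‖b‖ₑ ≤ C / (ENNReal.ofReal T ^ (1 / 2 : ℝ) * F.avgWidth x T ^ (1 / 2 : ℝ))
            * F.tNorm σ f) ∧
    -- the pointwise bound
    (∀ σ : ℝ, ∃ C' : ℝ≥0, 0 < C' ∧ ∀ a : ℕ, (a : ℝ) / 2 < σ → ∃ C : ℝ≥0, 0 < C ∧
      ∀ (n : ℕ) (ι : Fin n → ℕ), (∀ m, 1 ≤ ι m) → ∑ m, ι m = a →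
      ∀ F : QuasiAbelian.AdaptedBasis ι, F.Normalised →
      ∀ u v : QuasiAbelian.Nil ι → ℂ, F.MemW (σ + 1) u →
        QuasiAbelian.IsWeakDeriv F.X u v → F.MemW σ v →
        ∃ z : QuasiAbelian.Idx ι → QuasiAbelian.Nil ι → ℂ,
          (∀ j, QuasiAbelian.IsWeakDeriv (QuasiAbelian.bracket F.X (F.Y j)) u (z j) ∧
            F.MemW σ (z j)) ∧
          ∃ u₀ : QuasiAbelian.Nil ι → ℂ, Continuous u₀ ∧ u₀ =ᵐ[QuasiAbelian.haar ι] u ∧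
            ∀ y : QuasiAbelian.Nil ι,
              ‖u₀ y‖ₑ ≤ C / F.ptWidth y ^ (1 / 2 : ℝ)
                * (F.tNorm σ u + F.tNorm σ v + C' * ∑ j, F.tNorm σ (z j))) := by
  have hcard : ∀ {n : ℕ} (ι : Fin n → ℕ), Fintype.card (QuasiAbelian.Idx ι) = ∑ m, ι m := by
    intro n ι
    simp
  constructor
  · intro a σ hσ
    have hC : QuasiAbelian.subordConst a (σ / 2) ≠ ⊤ :=
      QuasiAbelian.subordConst_ne_top (by linarith)
    -- Adding 1 only makes the constant positive; it depends on a and σ alone.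
    refine ⟨(QuasiAbelian.subordConst a (σ / 2)).toNNReal + 1, by positivity, ?_⟩
    intro n ι _ hsum F hF f hf T hT x _
    obtain rfl : Fintype.card (QuasiAbelian.Idx ι) = a := (hcard ι).trans hsum
    have hσ0 : 0 < σ := lt_of_le_of_lt (by positivity) hσ
    have hT0 : 0 < T := one_pos.trans_le hT
    obtain ⟨g, hg⟩ := (F.memW_iff hσ0).1 hf
    refine ⟨_, QuasiAbelian.AdaptedBasis.hasBirkhoff hF hσ hg hT0.le x, ?_⟩
    rw [F.tNorm_eq hσ0 hg]
    refine QuasiAbelian.AdaptedBasis.enorm_birkhoff_le hF hσ g hT0 (by positivity) ?_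
    rw [ENNReal.coe_add, ENNReal.coe_toNNReal hC]
    exact le_self_add
  · intro σ
    -- The estimate holds without the commutator terms, so any positive constant in front of them
    -- will do.
    refine ⟨1, one_pos, fun a hσ => ?_⟩
    have hC : QuasiAbelian.subordConst a (σ / 2) ≠ ⊤ :=
      QuasiAbelian.subordConst_ne_top (by linarith)
    refine ⟨(QuasiAbelian.subordConst a (σ / 2)).toNNReal + 1, by positivity, ?_⟩
    intro n ι _ hsum F hF u v hu huv hv
    obtain rfl : Fintype.card (QuasiAbelian.Idx ι) = a := (hcard ι).trans hsum
    have hσ0 : 0 < σ := lt_of_le_of_lt (by positivity) hσ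
    have hs0 : 0 < σ / 2 := half_pos hσ0
    have hs : (Fintype.card (QuasiAbelian.Idx ι) : ℝ) / 4 < σ / 2 := by linarith
    obtain ⟨g₁, hg₁⟩ := (F.memW_iff (by positivity)).1 hu
    obtain ⟨k, hk⟩ := (F.memW_iff hσ0).1 hv
    obtain ⟨hu2, hv2, hw⟩ := huv
    -- Half an order of I + Δ_Y is spent here: g represents u at level σ, so ‖g‖ is |u|_{F,σ}, while
    -- g₁ keeps the extra derivative for the commutators.
    set g := F.negPow 1 g₁ with hgdef
    have hg : F.negPow σ g =ᵐ[QuasiAbelian.haar ι] u := by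
      rw [hgdef, ← mul_apply_eq_comp, ← F.negPow_add hσ0 one_pos]
      exact hg₁
    have hgu : F.avg (σ / 2) g =ᵐ[QuasiAbelian.haar ι] u := (F.negPow_eq_avg hσ0 g).symm.trans hg
    have hkv : F.avg (σ / 2) k =ᵐ[QuasiAbelian.haar ι] v := (F.negPow_eq_avg hσ0 k).symm.trans hk
    have hflow : ∀ r ∈ Set.Icc (0 : ℝ) 1, ∀ᵐ x ∂QuasiAbelian.haar ι,
        F.avg (σ / 2) g (x.act (QuasiAbelian.expG (r • F.X)))
          = F.avg (σ / 2) g x + F.orb (σ / 2) k r x := by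
      intro r hr
      refine QuasiAbelian.AdaptedBasis.ae_avg_act_eq hF hs (QuasiAbelian.measurable_coeFn g)
        (hu2.ae_eq hgu.symm) (QuasiAbelian.measurable_coeFn k)
        (QuasiAbelian.AdaptedBasis.memLp_coeFn k) (hv2.ae_eq hkv.symm) (fun φ hφ => ?_) hr.1
      have h1 : ∫ x, F.avg (σ / 2) g x * QuasiAbelian.lieD F.X φ x ∂QuasiAbelian.haar ι
          = ∫ x, u x * QuasiAbelian.lieD F.X φ x ∂QuasiAbelian.haar ι :=
        integral_congr_ae (by filter_upwards [hgu] with x hx; rw [hx])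
      have h2 : ∫ x, F.avg (σ / 2) k x * φ x ∂QuasiAbelian.haar ι
          = ∫ x, v x * φ x ∂QuasiAbelian.haar ι :=
        integral_congr_ae (by filter_upwards [hkv] with x hx; rw [hx])
      rw [h1, h2, hw φ hφ]
    refine ⟨fun j => F.negPow σ (F.rieszOp (QuasiAbelian.bracket F.X (F.Y j)) g₁), fun j => ⟨?_, ?_⟩,
      F.contRep (σ / 2) g k, ?_, ?_, fun y => ?_⟩
    · refine ⟨hu2, QuasiAbelian.AdaptedBasis.memLp_coeFn _, fun φ hφ => ?_⟩
      -- Brackets lie in 𝔞 by definition, which is why `rfl` proves the membership.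
      rw [← QuasiAbelian.AdaptedBasis.isWeakDeriv_rieszOp hF rfl hσ0 g₁ hφ]
      exact integral_congr_ae (by filter_upwards [hg₁] with x hx; rw [hx])
    · exact (F.memW_iff hσ0).2 ⟨_, Filter.EventuallyEq.rfl⟩
    · exact QuasiAbelian.AdaptedBasis.continuous_contRep hF hs (QuasiAbelian.measurable_coeFn g)
        (QuasiAbelian.AdaptedBasis.memLp_coeFn g) (QuasiAbelian.measurable_coeFn k)
        (QuasiAbelian.AdaptedBasis.memLp_coeFn k)
    · exact (QuasiAbelian.AdaptedBasis.contRep_ae_eq hF hs (QuasiAbelian.measurable_coeFn g)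
        (QuasiAbelian.measurable_coeFn k) (QuasiAbelian.AdaptedBasis.memLp_coeFn k) hflow).trans hgu
    · rw [F.tNorm_eq hσ0 hg, F.tNorm_eq hσ0 hk]
      refine (QuasiAbelian.AdaptedBasis.enorm_contRep_le hF hσ hflow
        (C := (QuasiAbelian.subordConst (Fintype.card (QuasiAbelian.Idx ι)) (σ / 2)).toNNReal + 1)
        (by positivity) ?_ y).trans ?_
      · rw [ENNReal.coe_add, ENNReal.coe_toNNReal hC]
        exact le_self_add
      · exact mul_le_mul_right le_self_add _
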